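/- Let $k$ be an algebraically closed field (of arbitrary characteristic), let $N\cong\mathbb Z^n$ be a lattice with dual lattice $M=\operatorname{Hom}(N,\mathbb Z)$, and let $\Delta$ be a fan in $N_{\mathbb R}=N\otimes\mathbb R$, that is, a finite non-empty collection of strongly convex rational polyhedral cones in $N_{\mathbb R}$ that is closed under taking faces and any two members of which meet in a common face. Let $X(\Delta)$ denote the associated toric variety over $k$, obtained by gluing the affine schemes $U_\sigma=\operatorname{Spec} k[\sigma^\vee\cap M]$, $\sigma\in\Delta$, along the open immersions $U_\tau\hookrightarrow U_\sigma$ for $\tau\subseteq\sigma$. Then there exists a projective simplicial subdivision $\widetilde\Delta$ of $\Delta$ with the same one-dimensional cones as $\Delta$. Precisely, there is a fan $\widetilde\Delta$ in $N_{\mathbb R}$ such that: 1. every cone of $\widetilde\Delta$ is contained in a cone of $\Delta$, and the two fans have the same support $\bigcup_{\sigma\in\widetilde\Delta}\sigma=\bigcup_{\sigma\in\Delta}\sigma$; 2. every cone of $\widetilde\Delta$ is simplicial, i.e. generated by linearly independent vectors; 3. the toric morphism $X(\widetilde\Delta)\to X(\Delta)$ induced by the identity of $N$ is projective, i.e. it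 is proper and there is an invertible sheaf on $X(\widetilde\Delta)$ that is ample relative to it; 4. $X(\widetilde\Delta)$ is $\mathbb Q$-factorial, i.e. it is a normal integral locally Noetherian scheme on which every Weil divisor has a positive multiple that is Cartier; 5. the set of one-dimensional cones of $\widetilde\Delta$ is equal to that of $\Delta$. -/

import Mathlib

open CategoryTheory CategoryTheory.Limits AlgebraicGeometry
open scoped TensorProduct

universe u

noncomputable section

/-! ## Cones and fans -/

namespace Toric

section Lattice

variable (N : Type u) [AddCommGroup N]

/-- The real vector space `N ⊗ ℝ` spanned by a lattice `N`. -/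
abbrev RealSpace : Type u := ℝ ⊗[ℤ] N

/-- The dual lattice `M = Hom(N, ℤ)`. -/
abbrev DualLattice : Type u := Module.Dual ℤ N

variable {N}

/-- The image of a lattice vector in `N ⊗ ℝ`. -/
def latticeVec (v : N) : RealSpace N := (1 : ℝ) ⊗ₜ[ℤ] v

/-- The real extension of a character `m ∈ M` to a linear form on `N ⊗ ℝ`. -/
def pairing (m : DualLattice N) : RealSpace N →ₗ[ℝ] ℝ :=
  Module.Dual.baseChange ℝ m

/-- A cone of `N ⊗ ℝ` is rational polyhedral if it is generated by finitely many lattice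
vectors. -/
def IsRationalPolyhedral (σ : PointedCone ℝ (RealSpace N)) : Prop :=
  ∃ S : Set N, S.Finite ∧ PointedCone.hull ℝ (latticeVec '' S) = σ

/-- The dimension of a cone is the dimension of its linear span. -/
def coneDim (σ : PointedCone ℝ (RealSpace N)) : ℕ :=
  Module.finrank ℝ (Submodule.span ℝ (σ : Set (RealSpace N)))

end Lattice

/-- A fan in `N ⊗ ℝ`: a finite nonempty collection of strongly convex rational polyhedral cones,
closed under taking faces, any two of which meet in a common face. -/
structure Fan (N : Type u) [AddCommGroup N] where
  cones : Set (PointedCone ℝ (RealSpace N))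
  finite : cones.Finite
  nonempty : cones.Nonempty
  rational : ∀ σ ∈ cones, IsRationalPolyhedral σ
  salient : ∀ σ ∈ cones, (σ : ConvexCone ℝ (RealSpace N)).Salient
  face_mem : ∀ σ ∈ cones, ∀ τ : PointedCone ℝ (RealSpace N), τ.IsFaceOf σ → τ ∈ cones
  inf_isFaceOf : ∀ σ ∈ cones, ∀ τ ∈ cones, (σ ⊓ τ).IsFaceOf σ

namespace Fan

variable {N : Type u} [AddCommGroup N]

/-- The support of a fan, the union of its cones. -/
def support (Δ : Fan N) : Set (RealSpace N) := ⋃ σ ∈ Δ.cones, (σ : Set (RealSpace N))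

/-- The set of one-dimensional cones of a fan. -/
def rays (Δ : Fan N) : Set (PointedCone ℝ (RealSpace N)) := {σ ∈ Δ.cones | coneDim σ = 1}

/-- A fan is simplicial if each of its cones is generated by linearly independent vectors. -/
def IsSimplicial (Δ : Fan N) : Prop := ∀ σ ∈ Δ.cones, PointedCone.IsSimplicial σ

/-- `Δ'` is a subdivision of `Δ` if each cone of `Δ'` lies in a cone of `Δ` and both fans have
the same support. -/
structure IsSubdivision (Δ' Δ : Fan N) : Prop where
  exists_le : ∀ σ' ∈ Δ'.cones, ∃ σ ∈ Δ.cones, σ' ≤ σ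
  support_eq : Δ'.support = Δ.support

/-- The cones of a fan, ordered by inclusion. -/
abbrev Cone (Δ : Fan N) : Type u := {σ : PointedCone ℝ (RealSpace N) // σ ∈ Δ.cones}

lemma isFaceOf_of_le (Δ : Fan N) {σ τ : Δ.Cone} (h : τ ≤ σ) : τ.1.IsFaceOf σ.1 := by
  have := Δ.inf_isFaceOf σ.1 σ.2 τ.1 τ.2
  rwa [inf_eq_right.mpr (show τ.1 ≤ σ.1 from h)] at this

/-- The intersection of two cones of a fan. -/
def Cone.inter {Δ : Fan N} (σ τ : Δ.Cone) : Δ.Cone :=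
  ⟨σ.1 ⊓ τ.1, Δ.face_mem σ.1 σ.2 _ (Δ.inf_isFaceOf σ.1 σ.2 τ.1 τ.2)⟩

lemma inter_le_left {Δ : Fan N} (σ τ : Δ.Cone) : σ.inter τ ≤ σ :=
  show σ.1 ⊓ τ.1 ≤ σ.1 from inf_le_left

lemma inter_le_right {Δ : Fan N} (σ τ : Δ.Cone) : σ.inter τ ≤ τ :=
  show σ.1 ⊓ τ.1 ≤ τ.1 from inf_le_right

/-- Some cone of `Δ` containing the given cone of a subdivision of `Δ`. -/
def IsSubdivision.over {Δ' Δ : Fan N} (h : Δ'.IsSubdivision Δ) (σ : Δ'.Cone) : Δ.Cone :=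
  ⟨(h.exists_le σ.1 σ.2).choose, (h.exists_le σ.1 σ.2).choose_spec.1⟩

lemma IsSubdivision.le_over {Δ' Δ : Fan N} (h : Δ'.IsSubdivision Δ) (σ : Δ'.Cone) :
    σ.1 ≤ (h.over σ).1 :=
  (h.exists_le σ.1 σ.2).choose_spec.2

end Fan

/-! ## Affine toric varieties -/

section Semigroup

variable {N : Type u} [AddCommGroup N]

/-- The semigroup `S_σ = σ^∨ ∩ M`. -/
def semigroup (σ : PointedCone ℝ (RealSpace N)) : AddSubmonoid (DualLattice N) where
  carrier := {m | ∀ x ∈ σ, 0 ≤ pairing m x}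
  zero_mem' := by intro x _; simp [pairing]
  add_mem' := by
    intro m m' hm hm' x hx
    simpa [pairing] using add_nonneg (hm x hx) (hm' x hx)

lemma semigroup_anti {σ τ : PointedCone ℝ (RealSpace N)} (h : τ ≤ σ) :
    semigroup σ ≤ semigroup τ := fun _ hm x hx => hm x (h hx)

@[simp] lemma pairing_latticeVec (m : DualLattice N) (v : N) :
    pairing m (latticeVec v) = (m v : ℝ) := by
  simp [pairing, latticeVec]

@[simp] lemma pairing_add (m m' : DualLattice N) (x : RealSpace N) :
    pairing (m + m') x = pairing m x + pairing m' x := by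
  simp [pairing]

@[simp] lemma pairing_neg (m : DualLattice N) (x : RealSpace N) :
    pairing (-m) x = - pairing m x := by
  have := pairing_add m (-m) x
  rw [add_neg_cancel] at this
  have h0 : pairing (0 : DualLattice N) x = 0 := by simp [pairing]
  linarith

lemma latticeVec_add (v w : N) : latticeVec (v + w) = latticeVec v + latticeVec w :=
  TensorProduct.tmul_add _ _ _

lemma latticeVec_zero : latticeVec (0 : N) = 0 := TensorProduct.tmul_zero _ _

lemma latticeVec_nsmul (p : ℕ) (v : N) : latticeVec (p • v) = (p : ℝ) • latticeVec v := by
  induction p with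
  | zero => simp [latticeVec_zero]
  | succ p ih => rw [succ_nsmul, latticeVec_add, ih]; push_cast; rw [add_smul, one_smul]

lemma mem_semigroup_hull {S : Set N} {m : DualLattice N} :
    m ∈ semigroup (PointedCone.hull ℝ (latticeVec '' S)) ↔ ∀ v ∈ S, 0 ≤ m v := by
  constructor
  · intro h v hv
    have := h _ (PointedCone.subset_hull (Set.mem_image_of_mem _ hv))
    rw [pairing_latticeVec] at this
    exact_mod_cast this
  · intro h x hx
    induction hx using Submodule.span_induction with
    | mem x hx =>
      obtain ⟨v, hv, rfl⟩ := hx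
      rw [pairing_latticeVec]
      exact_mod_cast h v hv
    | zero => simp
    | add x y _ _ hx hy => rw [map_add]; exact add_nonneg hx hy
    | smul a x _ hx =>
      have : pairing m (a • x) = (a : ℝ) * pairing m x := map_smul (pairing m) (a : ℝ) x
      rw [this]
      exact mul_nonneg a.2 hx

/-- Integral Farkas lemma. -/
lemma farkas [Module.Free ℤ N] (n : ℕ) : ∀ (l : List N), l.length = n → ∀ b : N,
    (∃ p : ℕ, 0 < p ∧ p • b ∈ AddSubmonoid.closure {x | x ∈ l}) ∨
      ∃ f : DualLattice N, (∀ x ∈ l, 0 ≤ f x) ∧ f b < 0 := by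
  induction n with
  | zero =>
    intro l hl b
    obtain rfl := List.length_eq_zero_iff.mp hl
    by_cases hb : b = 0
    · exact Or.inl ⟨1, one_pos, by simp [hb]⟩
    · obtain ⟨f, hf⟩ := Module.Projective.exists_dual_ne_zero ℤ hb
      rcases lt_or_gt_of_ne hf with h | h
      · exact Or.inr ⟨f, by simp, h⟩
      · exact Or.inr ⟨-f, by simp, by simpa using h⟩
  | succ n ih =>
    intro l hl b
    obtain ⟨a, l, rfl⟩ := List.exists_cons_of_length_eq_add_one hl
    have hl' : l.length = n := by simpa using hl
    have hsub : {x | x ∈ l} ⊆ {x | x ∈ a :: l} := fun x hx => List.mem_cons_of_mem _ hx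
    rcases ih l hl' b with ⟨p, hp, hpb⟩ | ⟨f, hf, hfb⟩
    · exact Or.inl ⟨p, hp, AddSubmonoid.closure_mono hsub hpb⟩
    by_cases hfa : 0 ≤ f a
    · refine Or.inr ⟨f, ?_, hfb⟩
      intro x hx
      rcases List.mem_cons.mp hx with rfl | hx
      exacts [hfa, hf x hx]
    push Not at hfa
    let φ : N →ₗ[ℤ] N := (-f a) • LinearMap.id + f.smulRight a
    have hφ : ∀ x, φ x = (-f a) • x + f x • a := fun x => by simp [φ]
    rcases ih (l.map φ) (by simpa using hl') (φ b) with ⟨p, hp, hpb⟩ | ⟨g, hg, hgb⟩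
    · left
      have himg : {x | x ∈ l.map φ} = φ.toAddMonoidHom '' {x | x ∈ l} := by
        ext x; simp
      rw [himg, ← AddMonoidHom.map_mclosure] at hpb
      obtain ⟨y, hy, hyb⟩ := hpb
      have hfy : 0 ≤ f y := by
        clear hyb
        induction hy using AddSubmonoid.closure_induction with
        | mem x hx => exact hf x hx
        | zero => simp
        | add x y _ _ hx hy => rw [map_add]; exact add_nonneg hx hy
      have hyb' : φ y = p • φ b := hyb
      rw [hφ, hφ] at hyb'
      refine ⟨(-f a).toNat * p, Nat.mul_pos (by omega) hp, ?_⟩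
      have h1 : (((-f a).toNat : ℕ) : ℤ) = -f a := Int.toNat_of_nonneg (by omega)
      have h2 : 0 ≤ f y - p * f b := by nlinarith
      have h3 : (((f y - p * f b).toNat : ℕ) : ℤ) = f y - p * f b := Int.toNat_of_nonneg h2
      have key : ((-f a).toNat * p) • b = (-f a).toNat • y + (f y - p * f b).toNat • a := by
        rw [← natCast_zsmul, ← natCast_zsmul, ← natCast_zsmul, h3, Nat.cast_mul, h1]
        rw [← natCast_zsmul] at hyb'
        have h4 : (-f a) • y = (p : ℤ) • ((-f a) • b + f b • a) - f y • a :=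
          eq_sub_of_add_eq hyb'
        rw [h4]
        module
      rw [key]
      refine add_mem (nsmul_mem (AddSubmonoid.closure_mono hsub hy) _)
        (nsmul_mem (AddSubmonoid.subset_closure ?_) _)
      simp
    · right
      refine ⟨g ∘ₗ φ, ?_, hgb⟩
      intro x hx
      rcases List.mem_cons.mp hx with rfl | hx
      · have : φ x = 0 := by rw [hφ, ← add_smul]; simp
        simp [this]
      · exact hg _ (List.mem_map_of_mem hx)

/-- A face of a rational cone is cut out by a character; outside the face that character is
positive on the generators. -/
lemma exists_supporting [Module.Free ℤ N] {S : Set N} (hS : S.Finite)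
    {σ τ : PointedCone ℝ (RealSpace N)} (hσ : PointedCone.hull ℝ (latticeVec '' S) = σ)
    (hτ : τ.IsFaceOf σ) :
    ∃ m : DualLattice N, (∀ v ∈ S, latticeVec v ∈ τ → m v = 0) ∧
      ∀ v ∈ S, latticeVec v ∉ τ → 0 < m v := by
  classical
  have hmem : ∀ v ∈ S, latticeVec v ∈ σ := fun v hv => by
    rw [← hσ]; exact PointedCone.subset_hull (Set.mem_image_of_mem _ hv)
  have hsep : ∀ v ∈ S, ∃ m : DualLattice N, (∀ w ∈ S, 0 ≤ m w) ∧
      (∀ w ∈ S, latticeVec w ∈ τ → m w = 0) ∧ (latticeVec v ∉ τ → 0 < m v) := by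
    intro v hv
    by_cases hvτ : latticeVec v ∈ τ
    · exact ⟨0, by simp, by simp, fun h => absurd hvτ h⟩
    let T := hS.toFinset
    let l : List N := T.toList ++ (T.filter fun w => latticeVec w ∈ τ).toList.map (fun w => -w)
    rcases farkas l.length l rfl (-v) with ⟨p, hp, hpv⟩ | ⟨f, hf, hfv⟩
    · exfalso
      have hcl : ∀ x ∈ AddSubmonoid.closure {x | x ∈ l}, ∃ t ∈ τ, latticeVec x + t ∈ σ := by
        intro x hx
        induction hx using AddSubmonoid.closure_induction with
        | mem x hx =>
          rcases List.mem_append.mp hx with hx | hx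
          · refine ⟨0, zero_mem _, ?_⟩
            rw [add_zero]
            exact hmem x (by simpa [T] using hx)
          · obtain ⟨w, hw, rfl⟩ := List.mem_map.mp hx
            have hw' : w ∈ S ∧ latticeVec w ∈ τ := by simpa [T] using hw
            refine ⟨latticeVec w, hw'.2, ?_⟩
            rw [← latticeVec_add, neg_add_cancel, latticeVec_zero]
            exact zero_mem _
        | zero => exact ⟨0, zero_mem _, by rw [latticeVec_zero, add_zero]; exact zero_mem _⟩
        | add x y _ _ hx hy =>
          obtain ⟨t, ht, h⟩ := hx
          obtain ⟨t', ht', h'⟩ := hy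
          refine ⟨t + t', add_mem ht ht', ?_⟩
          have : latticeVec (x + y) + (t + t') = (latticeVec x + t) + (latticeVec y + t') := by
            rw [latticeVec_add]; abel
          rw [this]
          exact add_mem h h'
      obtain ⟨t, ht, h⟩ := hcl _ hpv
      have h0 : latticeVec (p • -v) = -((p : ℝ) • latticeVec v) := by
        rw [eq_neg_iff_add_eq_zero, ← latticeVec_nsmul, ← latticeVec_add, ← nsmul_add,
          neg_add_cancel, nsmul_zero, latticeVec_zero]
      refine hvτ (hτ.mem_of_smul_add_mem (hmem v hv) h (Nat.cast_pos.mpr hp) ?_)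
      rw [h0]
      simpa using ht
    · have hpos : ∀ w ∈ S, 0 ≤ f w := fun w hw =>
        hf w (List.mem_append_left _ (by simpa [T] using hw))
      refine ⟨f, hpos, fun w hw hwτ => le_antisymm ?_ (hpos w hw), fun _ => by simpa using hfv⟩
      have := hf (-w) (List.mem_append_right _ (List.mem_map.mpr ⟨w, by simp [T, hw, hwτ], rfl⟩))
      simpa using this
  choose! μ h1 h2 h3 using hsep
  refine ⟨∑ v ∈ hS.toFinset, μ v, fun w hw hwτ => ?_, fun w hw hwτ => ?_⟩
  · rw [LinearMap.sum_apply]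
    exact Finset.sum_eq_zero fun v hv => h2 v (by simpa using hv) w hw hwτ
  · rw [LinearMap.sum_apply]
    exact Finset.sum_pos' (fun v hv => h1 v (by simpa using hv) w hw)
      ⟨w, by simpa using hw, h3 w hw hwτ⟩

/-- If `m` cuts out the face `τ` of a rational cone `σ`, then `m ∈ S_σ`, `-m ∈ S_τ` and
`S_τ = S_σ + ℕ (-m)`. -/
lemma face_character_spec {S : Set N} (hS : S.Finite)
    {σ τ : PointedCone ℝ (RealSpace N)} (hSσ : PointedCone.hull ℝ (latticeVec '' S) = σ)
    (hτ : τ.IsFaceOf σ) {m : DualLattice N} (hm0 : ∀ v ∈ S, latticeVec v ∈ τ → m v = 0)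
    (hm1 : ∀ v ∈ S, latticeVec v ∉ τ → 0 < m v) :
    m ∈ semigroup σ ∧ -m ∈ semigroup τ ∧
      ∀ u ∈ semigroup τ, ∃ n : ℕ, u + n • m ∈ semigroup σ := by
  classical
  have hmem : ∀ v ∈ S, latticeVec v ∈ σ := fun v hv => by
    rw [← hSσ]; exact PointedCone.subset_hull (Set.mem_image_of_mem _ hv)
  refine ⟨?_, ?_, ?_⟩
  · rw [← hSσ, mem_semigroup_hull]
    intro v hv
    by_cases h : latticeVec v ∈ τ
    exacts [(hm0 v hv h).ge, (hm1 v hv h).le]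
  · intro x hx
    have hxσ := hτ.le hx
    rw [← hSσ, PointedCone.mem_hull_set] at hxσ
    obtain ⟨c, hc, hc0, rfl⟩ := hxσ
    rw [pairing_neg, Finsupp.sum, map_sum, ← Finset.sum_neg_distrib]
    refine (Finset.sum_eq_zero fun y hy => ?_).ge
    obtain ⟨v, hv, hvy⟩ := hc hy
    have hyτ : y ∈ τ := by
      refine hτ.mem_of_sum_smul_mem (ι := c.support) (f := fun i => i.1) (c := fun i => c i.1)
        (fun i => ?_) (fun i => hc0 _) ?_ ⟨y, hy⟩
        (lt_of_le_of_ne (hc0 _) (Ne.symm (Finsupp.mem_support_iff.mp hy)))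
      · obtain ⟨w, hw, hwi⟩ := hc i.2
        rw [← hwi]
        exact hmem w hw
      · rw [Finset.sum_coe_sort c.support (fun i => c i • i)]
        exact hx
    subst hvy
    rw [map_smul, pairing_latticeVec, hm0 v hv hyτ]
    simp
  · intro u hu
    refine ⟨∑ v ∈ hS.toFinset, (u v).natAbs, ?_⟩
    rw [← hSσ, mem_semigroup_hull]
    intro v hv
    rw [LinearMap.add_apply, LinearMap.smul_apply]
    by_cases h : latticeVec v ∈ τ
    · have h5 := hu _ h
      rw [pairing_latticeVec] at h5
      rw [hm0 v hv h, smul_zero, add_zero]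
      exact_mod_cast h5
    · have h6 := hm1 v hv h
      have h7 : (u v).natAbs ≤ ∑ v ∈ hS.toFinset, (u v).natAbs :=
        Finset.single_le_sum (f := fun v => (u v).natAbs) (fun _ _ => Nat.zero_le _)
          (by simpa using hv)
      rw [nsmul_eq_mul]
      have h8 : ((u v).natAbs : ℤ) ≤ ((∑ v ∈ hS.toFinset, (u v).natAbs : ℕ) : ℤ) := by
        exact_mod_cast h7
      have h9 : -(u v) ≤ ((u v).natAbs : ℤ) := by omega
      nlinarith

end Semigroup

section AffineChart

variable (k : Type u) [Field k] {N : Type u} [AddCommGroup N]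

/-- The coordinate ring `k[S_σ]` of the affine toric variety of a cone `σ`. -/
abbrev coordinateRing (σ : PointedCone ℝ (RealSpace N)) : Type u :=
  AddMonoidAlgebra k (semigroup σ)

/-- The inclusion `k[S_σ] → k[S_τ]` for `τ ⊆ σ`. -/
def coordinateMap {σ τ : PointedCone ℝ (RealSpace N)} (h : τ ≤ σ) :
    coordinateRing k σ →+* coordinateRing k τ :=
  AddMonoidAlgebra.mapDomainRingHom k (AddSubmonoid.inclusion (semigroup_anti h))

lemma coordinateMap_single {σ τ : PointedCone ℝ (RealSpace N)} (h : τ ≤ σ) (m : semigroup σ)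
    (c : k) : coordinateMap k h (AddMonoidAlgebra.single m c) =
      AddMonoidAlgebra.single (AddSubmonoid.inclusion (semigroup_anti h) m) c := by
  simp [coordinateMap]

lemma coordinateMap_injective {σ τ : PointedCone ℝ (RealSpace N)} (h : τ ≤ σ) :
    Function.Injective (coordinateMap k h) :=
  AddMonoidAlgebra.mapDomain_injective (AddSubmonoid.inclusion_injective (semigroup_anti h))

/-- The affine toric variety `U_σ = Spec k[S_σ]`. -/
abbrev affineChart (σ : PointedCone ℝ (RealSpace N)) : Scheme.{u} :=
  Spec (CommRingCat.of (coordinateRing k σ))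

/-- The morphism `U_τ ⟶ U_σ` for `τ ⊆ σ`. -/
def affineChartMap {σ τ : PointedCone ℝ (RealSpace N)} (h : τ ≤ σ) :
    affineChart k τ ⟶ affineChart k σ :=
  Spec.map (CommRingCat.ofHom (coordinateMap k h))

lemma affineChartMap_refl (σ : PointedCone ℝ (RealSpace N)) :
    affineChartMap k (le_refl σ) = 𝟙 (affineChart k σ) := by
  have : coordinateMap k (le_refl σ) = RingHom.id _ := by
    rw [coordinateMap, ← AddMonoidAlgebra.mapDomainRingHom_id]
    rfl
  rw [affineChartMap, this]
  exact Spec.map_id _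

lemma affineChartMap_comp {ρ τ σ : PointedCone ℝ (RealSpace N)} (h : ρ ≤ τ) (h' : τ ≤ σ) :
    affineChartMap k h ≫ affineChartMap k h' = affineChartMap k (h.trans h') := by
  have : coordinateMap k (h.trans h') = (coordinateMap k h).comp (coordinateMap k h') := by
    rw [coordinateMap, coordinateMap, coordinateMap, ← AddMonoidAlgebra.mapDomainRingHom_comp]
    rfl
  rw [affineChartMap, affineChartMap, affineChartMap, this, CommRingCat.ofHom_comp, Spec.map_comp]

/-- For a face `τ` of `σ`, the ring `k[S_τ]` is the localization of `k[S_σ]` at a character. -/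
lemma isLocalization_away {σ τ : PointedCone ℝ (RealSpace N)} (h : τ ≤ σ) (m : semigroup σ)
    (hm : -m.1 ∈ semigroup τ)
    (hu : ∀ u ∈ semigroup τ, ∃ n : ℕ, u + n • m.1 ∈ semigroup σ) :
    letI := (coordinateMap k h).toAlgebra
    IsLocalization.Away (AddMonoidAlgebra.single m (1 : k) : coordinateRing k σ)
      (coordinateRing k τ) := by
  let := (coordinateMap k h).toAlgebra
  have halg : ∀ x, algebraMap (coordinateRing k σ) (coordinateRing k τ) x =
      coordinateMap k h x := fun _ => rfl
  have hpow : ∀ n : ℕ, algebraMap (coordinateRing k σ) (coordinateRing k τ)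
      (AddMonoidAlgebra.single m (1 : k) ^ n) =
      AddMonoidAlgebra.single (n • AddSubmonoid.inclusion (semigroup_anti h) m) (1 : k) := by
    intro n
    rw [halg, map_pow, coordinateMap_single, AddMonoidAlgebra.single_pow, one_pow]
  refine
    { map_units := ?_
      surj := ?_
      exists_of_eq := ?_ }
  · rintro ⟨_, n, rfl⟩
    change IsUnit (algebraMap (coordinateRing k σ) (coordinateRing k τ)
      (AddMonoidAlgebra.single m (1 : k) ^ n))
    rw [hpow]
    refine IsUnit.of_mul_eq_one
      (AddMonoidAlgebra.single (n • (⟨-m.1, hm⟩ : semigroup τ)) (1 : k)) ?_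
    rw [AddMonoidAlgebra.single_mul_single, ← nsmul_add, one_mul]
    have : AddSubmonoid.inclusion (semigroup_anti h) m + (⟨-m.1, hm⟩ : semigroup τ) = 0 :=
      Subtype.ext (add_neg_cancel m.1)
    rw [this, nsmul_zero]
    rfl
  · suffices H : ∀ z : coordinateRing k τ, ∃ (n : ℕ) (x : coordinateRing k σ),
        z * algebraMap _ _ (AddMonoidAlgebra.single m (1 : k) ^ n) = algebraMap _ _ x by
      intro z
      obtain ⟨n, x, hx⟩ := H z
      exact ⟨(x, ⟨_, n, rfl⟩), hx⟩
    intro z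
    induction z using AddMonoidAlgebra.induction_linear with
    | zero => exact ⟨0, 0, by simp⟩
    | add f g hf hg =>
      obtain ⟨n, x, hx⟩ := hf
      obtain ⟨n', x', hx'⟩ := hg
      refine ⟨n + n', x * AddMonoidAlgebra.single m (1 : k) ^ n' +
        x' * AddMonoidAlgebra.single m (1 : k) ^ n, ?_⟩
      rw [pow_add, map_add, map_mul, map_mul, map_mul, ← hx, ← hx']
      ring
    | single u c =>
      obtain ⟨n, hn⟩ := hu u.1 u.2
      refine ⟨n, AddMonoidAlgebra.single ⟨_, hn⟩ c, ?_⟩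
      rw [hpow, AddMonoidAlgebra.single_mul_single, mul_one, halg, coordinateMap_single]
      congr 1
  · intro x y hxy
    exact ⟨1, by rw [coordinateMap_injective k h hxy]⟩

lemma affineChartMap_isOpenImmersion [Module.Free ℤ N] {σ τ : PointedCone ℝ (RealSpace N)}
    (hσ : IsRationalPolyhedral σ) (hτ : τ.IsFaceOf σ) :
    IsOpenImmersion (affineChartMap k hτ.le) := by
  obtain ⟨S, hS, hSσ⟩ := hσ
  obtain ⟨m, hm0, hm1⟩ := exists_supporting hS hSσ hτ
  obtain ⟨hm, hm', hu⟩ := face_character_spec hS hSσ hτ hm0 hm1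
  let := (coordinateMap k hτ.le).toAlgebra
  have := isLocalization_away k hτ.le ⟨m, hm⟩ hm' hu
  exact IsOpenImmersion.of_isLocalization
    (AddMonoidAlgebra.single (⟨m, hm⟩ : semigroup σ) (1 : k) : coordinateRing k σ)

lemma range_affineChartMap {σ τ : PointedCone ℝ (RealSpace N)} (h : τ ≤ σ) (m : semigroup σ)
    (hm : -m.1 ∈ semigroup τ)
    (hu : ∀ u ∈ semigroup τ, ∃ n : ℕ, u + n • m.1 ∈ semigroup σ) :
    Set.range (affineChartMap k h) = SetLike.coe (PrimeSpectrum.basicOpen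
      (AddMonoidAlgebra.single m (1 : k) : coordinateRing k σ)) := by
  let := (coordinateMap k h).toAlgebra
  have := isLocalization_away k h m hm hu
  exact PrimeSpectrum.localization_away_comap_range (coordinateRing k τ)
    (AddMonoidAlgebra.single m (1 : k) : coordinateRing k σ)

end AffineChart

/-! ## The toric variety of a fan -/

namespace Fan

variable (k : Type u) [Field k] {N : Type u} [AddCommGroup N]

/-- The diagram of the affine charts `U_σ`, `σ ∈ Δ`. -/
def chartDiagram (Δ : Fan N) : Δ.Cone ⥤ Scheme.{u} where
  obj σ := affineChart k σ.1
  map f := affineChartMap k (leOfHom f)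
  map_id σ := affineChartMap_refl k σ.1
  map_comp f g := (affineChartMap_comp k (leOfHom f) (leOfHom g)).symm

variable [Module.Free ℤ N]

instance (Δ : Fan N) {σ τ : Δ.Cone} (f : τ ⟶ σ) : IsOpenImmersion ((Δ.chartDiagram k).map f) :=
  affineChartMap_isOpenImmersion k (Δ.rational σ.1 σ.2) (Δ.isFaceOf_of_le (leOfHom f))

lemma exists_mem_chart_inter (Δ : Fan N) {σ τ ρ : Δ.Cone} (hσ : σ ≤ ρ) (hτ : τ ≤ ρ)
    (x : affineChart k σ.1) (y : affineChart k τ.1)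
    (hxy : affineChartMap k hσ x = affineChartMap k hτ y) :
    ∃ z : affineChart k (σ.inter τ).1,
      affineChartMap k (inter_le_left σ τ) z = x ∧
      affineChartMap k (inter_le_right σ τ) z = y := by
  have hfσ := Δ.isFaceOf_of_le hσ
  have hfτ := Δ.isFaceOf_of_le hτ
  have hστ : σ.inter τ ≤ ρ := (inter_le_left σ τ).trans hσ
  have hf := Δ.isFaceOf_of_le hστ
  obtain ⟨S, hS, hSρ⟩ := Δ.rational ρ.1 ρ.2
  obtain ⟨m, hm0, hm1⟩ := exists_supporting hS hSρ hfσ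
  obtain ⟨m', hm0', hm1'⟩ := exists_supporting hS hSρ hfτ
  obtain ⟨a1, a2, a3⟩ := face_character_spec hS hSρ hfσ hm0 hm1
  obtain ⟨b1, b2, b3⟩ := face_character_spec hS hSρ hfτ hm0' hm1'
  have hnn : ∀ v ∈ S, 0 ≤ m v := mem_semigroup_hull.mp (hSρ ▸ a1)
  have hnn' : ∀ v ∈ S, 0 ≤ m' v := mem_semigroup_hull.mp (hSρ ▸ b1)
  obtain ⟨c1, c2, c3⟩ := face_character_spec (m := m + m') hS hSρ hf
    (fun v hv h => by
      have h' : latticeVec v ∈ σ.1 ∧ latticeVec v ∈ τ.1 := h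
      rw [LinearMap.add_apply, hm0 v hv h'.1, hm0' v hv h'.2, add_zero])
    (fun v hv h => by
      rw [LinearMap.add_apply]
      by_cases h1 : latticeVec v ∈ σ.1
      · exact add_pos_of_nonneg_of_pos (hnn v hv) (hm1' v hv fun h2 => h ⟨h1, h2⟩)
      · exact add_pos_of_pos_of_nonneg (hm1 v hv h1) (hnn' v hv))
  have hx : affineChartMap k hσ x ∈ Set.range (affineChartMap k hσ) := ⟨x, rfl⟩
  have hy : affineChartMap k hσ x ∈ Set.range (affineChartMap k hτ) := ⟨y, hxy.symm⟩
  rw [range_affineChartMap k hσ ⟨m, a1⟩ a2 a3] at hx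
  rw [range_affineChartMap k hτ ⟨m', b1⟩ b2 b3] at hy
  have hz : affineChartMap k hσ x ∈ Set.range (affineChartMap k hστ) := by
    rw [range_affineChartMap k hστ ⟨m + m', c1⟩ c2 c3]
    have hmul : (AddMonoidAlgebra.single (⟨m + m', c1⟩ : semigroup ρ.1) (1 : k) :
        coordinateRing k ρ.1) = AddMonoidAlgebra.single ⟨m, a1⟩ (1 : k) *
          AddMonoidAlgebra.single ⟨m', b1⟩ (1 : k) := by
      rw [AddMonoidAlgebra.single_mul_single, one_mul]
      rfl
    rw [hmul, PrimeSpectrum.basicOpen_mul]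
    exact ⟨hx, hy⟩
  obtain ⟨z, hz⟩ := hz
  have i1 := affineChartMap_isOpenImmersion k (Δ.rational ρ.1 ρ.2) hfσ
  have i2 := affineChartMap_isOpenImmersion k (Δ.rational ρ.1 ρ.2) hfτ
  refine ⟨z, (affineChartMap k hσ).isOpenEmbedding.injective ?_, 
    (affineChartMap k hτ).isOpenEmbedding.injective ?_⟩
  · rw [← hz, ← affineChartMap_comp k (inter_le_left σ τ) hσ]
    rfl
  · rw [← hxy, ← hz, ← affineChartMap_comp k (inter_le_right σ τ) hτ]
    rfl

instance (Δ : Fan N) : (Δ.chartDiagram k ⋙ Scheme.forget).IsLocallyDirected where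
  cond {σ τ ρ} f g x y hxy := by
    obtain ⟨z, hz, hz'⟩ := Δ.exists_mem_chart_inter k (leOfHom f) (leOfHom g) x y hxy
    exact ⟨σ.inter τ, homOfLE (inter_le_left σ τ), homOfLE (inter_le_right σ τ), z, hz, hz'⟩

/-- The toric variety `X(Δ)` over `k`: the charts `U_σ`, `σ ∈ Δ`, glued along the open immersions
`U_τ ⟶ U_σ` for `τ ⊆ σ`. -/
def toricVariety (Δ : Fan N) : Scheme.{u} := colimit (Δ.chartDiagram k)

/-- The open immersion of the chart `U_σ` into `X(Δ)`. -/
def chartι (Δ : Fan N) (σ : Δ.Cone) : affineChart k σ.1 ⟶ Δ.toricVariety k :=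
  colimit.ι (Δ.chartDiagram k) σ

lemma affineChartMap_chartι (Δ : Fan N) {σ τ : Δ.Cone} (h : τ ≤ σ) :
    affineChartMap k h ≫ Δ.chartι k σ = Δ.chartι k τ :=
  colimit.w (Δ.chartDiagram k) (homOfLE h)

variable {Δ' Δ : Fan N}

lemma affineChartMap_chartι_eq {ρ : PointedCone ℝ (RealSpace N)} {σ τ : Δ.Cone}
    (hσ : ρ ≤ σ.1) (hτ : ρ ≤ τ.1) :
    affineChartMap k hσ ≫ Δ.chartι k σ = affineChartMap k hτ ≫ Δ.chartι k τ := by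
  have h1 := inter_le_left σ τ
  have h2 := inter_le_right σ τ
  have h0 : ρ ≤ (σ.inter τ).1 := le_inf hσ hτ
  rw [← affineChartMap_comp k h0 h1, ← affineChartMap_comp k h0 h2, Category.assoc,
    Category.assoc, affineChartMap_chartι, affineChartMap_chartι]

/-- The toric morphism `X(Δ') ⟶ X(Δ)` of a subdivision, induced by the identity of `N`: it maps
`U_σ'` to `U_σ` whenever `σ' ⊆ σ`. -/
def IsSubdivision.toricMap (h : Δ'.IsSubdivision Δ) : Δ'.toricVariety k ⟶ Δ.toricVariety k :=
  colimit.desc (Δ'.chartDiagram k)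
    { pt := Δ.toricVariety k
      ι :=
        { app := fun σ => affineChartMap k (h.le_over σ) ≫ Δ.chartι k (h.over σ)
          naturality := by
            intro τ σ f
            change affineChartMap k (leOfHom f) ≫ affineChartMap k (h.le_over σ) ≫ _ = _ ≫ 𝟙 _
            refine Eq.trans ?_ (Category.comp_id _).symm
            rw [← Category.assoc, affineChartMap_comp]
            exact affineChartMap_chartι_eq k _ _ } }

/-- The toric morphism is given on charts by the inclusions of cones. -/
lemma IsSubdivision.chartι_toricMap (h : Δ'.IsSubdivision Δ) (σ' : Δ'.Cone) (σ : Δ.Cone)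
    (hσ : σ'.1 ≤ σ.1) :
    Δ'.chartι k σ' ≫ h.toricMap k = affineChartMap k hσ ≫ Δ.chartι k σ :=
  (colimit.ι_desc _ _).trans (affineChartMap_chartι_eq k _ _)

end Fan

end Toric

/-! ## Projective morphisms and `ℚ`-factorial varieties -/

namespace SchemeGeometry

/-- The restriction of sections of the structure sheaf. -/
abbrev res {X : Scheme.{u}} {V W : X.Opens} (h : W ≤ V) : Γ(X, V) →+* Γ(X, W) :=
  (X.presheaf.map (homOfLE h).op).hom

/-- An invertible sheaf on `X`, given by an open cover and a cocycle of transition units. -/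
structure InvertibleSheaf (X : Scheme.{u}) where
  ι : Type u
  U : ι → X.Opens
  iSup_U : ⨆ i, U i = ⊤
  g : ∀ i j, Γ(X, U i ⊓ U j)ˣ
  cocycle : ∀ i j k,
    res (le_inf (inf_le_left.trans inf_le_left) (inf_le_left.trans inf_le_right) :
        U i ⊓ U j ⊓ U k ≤ U i ⊓ U j) (g i j : Γ(X, U i ⊓ U j)) *
      res (le_inf (inf_le_left.trans inf_le_right) inf_le_right :
        U i ⊓ U j ⊓ U k ≤ U j ⊓ U k) (g j k : Γ(X, U j ⊓ U k)) =
      res (le_inf (inf_le_left.trans inf_le_left) inf_le_right :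
        U i ⊓ U j ⊓ U k ≤ U i ⊓ U k) (g i k : Γ(X, U i ⊓ U k))

namespace InvertibleSheaf

variable {X : Scheme.{u}} (L : InvertibleSheaf X)

/-- A section of `L^⊗n` over `V`: local functions `s i` with `s i = (g i j)^n * s j`. -/
structure PowerSection (n : ℕ) (V : X.Opens) where
  s : ∀ i, Γ(X, V ⊓ L.U i)
  compat : ∀ i j,
    res (inf_le_inf_left V inf_le_left : V ⊓ (L.U i ⊓ L.U j) ≤ V ⊓ L.U i) (s i) =
      res (inf_le_right : V ⊓ (L.U i ⊓ L.U j) ≤ L.U i ⊓ L.U j)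
          (L.g i j : Γ(X, L.U i ⊓ L.U j)) ^ n *
        res (inf_le_inf_left V inf_le_right : V ⊓ (L.U i ⊓ L.U j) ≤ V ⊓ L.U j) (s j)

/-- The open set `X_s` of points of `V` where a section `s` of `L^⊗n` over `V` does not vanish. -/
def PowerSection.nonvanishing {L : InvertibleSheaf X} {n : ℕ} {V : X.Opens}
    (s : L.PowerSection n V) : X.Opens :=
  ⨆ i, X.basicOpen (s.s i)

/-- The restriction of `L` to `V` is ample: `V` is quasi-compact and covered by the affine open
sets among the `X_s`, for sections `s` of positive powers of `L` over `V`. -/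
def IsAmpleOn (V : X.Opens) : Prop :=
  IsCompact (V : Set X) ∧ ∀ x ∈ V, ∃ (n : ℕ) (s : L.PowerSection n V),
    0 < n ∧ x ∈ s.nonvanishing ∧ IsAffineOpen s.nonvanishing

/-- `L` is ample relative to `f : X ⟶ Y`: it is ample over the members of an affine open cover
of `Y`. -/
def IsRelativelyAmple {Y : Scheme.{u}} (f : X ⟶ Y) : Prop :=
  ∀ y : Y, ∃ W : Y.Opens, y ∈ W ∧ IsAffineOpen W ∧ L.IsAmpleOn (f ⁻¹ᵁ W)

end InvertibleSheaf

/-- A morphism (to a Noetherian scheme) is projective if it is proper and there is a relatively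
ample invertible sheaf on the source. -/
def IsProjective {X Y : Scheme.{u}} (f : X ⟶ Y) : Prop :=
  IsProper f ∧ ∃ L : InvertibleSheaf X, L.IsRelativelyAmple f

section QFactorial

variable (X : Scheme.{u}) [IsIntegral X] [IsLocallyNoetherian X]

/-- A Weil divisor: a locally finite integral combination of points of codimension one, each
standing for the prime divisor which is its closure. -/
def IsWeilDivisor (D : AlgebraicCycle X ℤ) : Prop :=
  ∀ z : X, D z ≠ 0 → Order.coheight z = 1

/-- A Weil divisor is Cartier if it is locally the divisor of a rational function. -/
def IsCartier (D : AlgebraicCycle X ℤ) : Prop :=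
  ∀ x : X, ∃ U : X.Opens, x ∈ U ∧ ∃ f : X.functionField, f ≠ 0 ∧ ∀ z ∈ U, D z = X.ord f z

end QFactorial

/-- `X` is a `ℚ`-factorial normal integral locally Noetherian scheme: every Weil divisor has a
positive multiple that is Cartier. -/
def IsQFactorial (X : Scheme.{u}) : Prop :=
  ∃ (_ : IsIntegral X) (_ : IsLocallyNoetherian X),
    (∀ x : X, IsIntegrallyClosed (X.presheaf.stalk x)) ∧
      ∀ D : AlgebraicCycle X ℤ, IsWeilDivisor X D → ∃ n : ℕ, 0 < n ∧ IsCartier X (n • D)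

end SchemeGeometry

end

/-! The subdivision is a regular triangulation that uses only the rays of `Δ`. Pick a lattice vector
`v_ρ` on each ray and a positive integral height `a_ρ`. Over a cone `σ` of `Δ`, lift the vectors to
`(v_ρ, a_ρ)` and project the lower faces of the cone that they generate. Such a face is the set of
rays of `σ` at which some character `m` attains the bound `m(v_ρ) ≤ t a_ρ`, for some `t > 0`. Linear
programming duality governs these cells. A representation of `x` of least height exists by
compactness, and Farkas' lemma certifies it by a pair `(m, t)`, so the cells cover `σ`
(`exists_isCell_of_mem`). Complementary slackness makes two cells meet in the cell of their common
rays (`IsCell.support_subset_of_mem`). Heights that avoid one nonzero integral relation for each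
dependent set of rays are linear only on independent sets (`exists_generic_heights`), so the cells
are simplicial. No ray is added, and none is lost because each ray of `Δ` is itself a cell.

After scaling to a common `t = T`, the characters of the cells compute `T` times the least height.
On each `σ` this is the maximum of the linear functions `c σ τ'`, and `c σ τ'` attains it exactly on
`τ'`. This strictness, recorded in `StrictSupport`, makes the toric morphism projective. The
function defines an invertible sheaf with transition characters `m τ - m τ'`. Over the preimage of
`U_σ`, each `c σ τ'` is a section of it whose nonvanishing locus is the affine chart `U_τ'`, and
this gives relative ampleness. The same characters give the valuative criterion. Two lifts into
charts `τ₁`, `τ₂` make `c τ₁ - c τ₂` and its negative integral, hence units, so both lifts land in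
the common chart. A lift exists in the chart `τ'` for which the character `c τ - c τ'` has the
largest value, because all quotients by it are then integral and they generate `S_τ'` over `S_σ` up
to multiples.

For `ℚ`-factoriality, evaluation at suitable lattice vectors embeds `S_τ`, for `τ` simplicial, as a
saturated submonoid of a product `P` of copies of `ℕ` and `ℤ`, with `e P` inside the image for some
`e > 0`. So `k[S_τ]` is a linear retract of the factorial ring `k[P]`, hence normal, and `k[P]` is
finite over it. The norm of a prime element of `k[P]` then cuts out, up to radical, any given prime
of height one (`HeightOneSetPrincipal.of_finite`). Hence each prime divisor has a local equation up
to a multiple, and finitely many charts allow one common multiple. -/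

noncomputable section

namespace Toric

/-! ### Cones generated by a finite family of lattice vectors, and independent families -/

section Gen

variable {N : Type u} [AddCommGroup N] {ι : Type u}

/-- The cone generated by the lattice vectors `v i`, `i ∈ T`. -/
def gen (v : ι → N) (T : Set ι) : PointedCone ℝ (RealSpace N) :=
  PointedCone.hull ℝ ((fun i => latticeVec (v i)) '' T)

lemma gen_eq_hull (v : ι → N) (T : Set ι) :
    gen v T = PointedCone.hull ℝ (latticeVec '' (v '' T)) := by
  rw [gen, Set.image_image]

lemma latticeVec_mem_gen (v : ι → N) {T : Set ι} {i : ι} (hi : i ∈ T) :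
    latticeVec (v i) ∈ gen v T :=
  PointedCone.subset_hull ⟨i, hi, rfl⟩

lemma gen_le_iff {v : ι → N} {T : Set ι} {σ : PointedCone ℝ (RealSpace N)} :
    gen v T ≤ σ ↔ ∀ i ∈ T, latticeVec (v i) ∈ σ := by
  refine ⟨fun h i hi => h (latticeVec_mem_gen v hi), fun h => ?_⟩
  refine Submodule.span_le.mpr ?_
  rintro _ ⟨i, hi, rfl⟩
  exact h i hi

lemma gen_mono (v : ι → N) {T S : Set ι} (h : T ⊆ S) : gen v T ≤ gen v S :=
  gen_le_iff.mpr fun _ hi => latticeVec_mem_gen v (h hi)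

/-- The family `v` is independent on `S`: each `v j` with `j ∈ S` is detected by a character
that vanishes at the other members. -/
def DualIndep (v : ι → N) (S : Set ι) : Prop :=
  ∀ j ∈ S, ∃ f : DualLattice N, 0 < f (v j) ∧ ∀ i ∈ S, i ≠ j → f (v i) = 0

lemma DualIndep.mono {v : ι → N} {S T : Set ι} (h : DualIndep v S) (hT : T ⊆ S) :
    DualIndep v T := fun j hj => by
  obtain ⟨f, hf, hf'⟩ := h j (hT hj)
  exact ⟨f, hf, fun i hi => hf' i (hT hi)⟩

variable [Fintype ι]

lemma mem_gen_iff {v : ι → N} {T : Set ι} {x : RealSpace N} :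
    x ∈ gen v T ↔ ∃ c : ι → ℝ, (∀ i, 0 ≤ c i) ∧ (∀ i, i ∉ T → c i = 0) ∧
      x = ∑ i, c i • latticeVec (v i) := by
  classical
  constructor
  · intro hx
    induction hx using Submodule.span_induction with
    | mem x hx =>
      obtain ⟨i, hi, rfl⟩ := hx
      refine ⟨Pi.single i 1, fun j => ?_, fun j hj => ?_, ?_⟩
      · by_cases h : j = i
        · subst h; simp
        · simp [Pi.single_eq_of_ne h]
      · exact Pi.single_eq_of_ne (fun h : j = i => hj (h ▸ hi)) _
      · rw [Finset.sum_eq_single i (fun j _ h => by simp [Pi.single_eq_of_ne h]) (by simp)]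
        simp
    | zero => exact ⟨0, by simp, by simp, by simp⟩
    | add x y _ _ hx hy =>
      obtain ⟨c, h1, h2, rfl⟩ := hx
      obtain ⟨d, k1, k2, rfl⟩ := hy
      exact ⟨c + d, fun i => add_nonneg (h1 i) (k1 i), fun i hi => by simp [h2 i hi, k2 i hi],
        by simp [add_smul, Finset.sum_add_distrib]⟩
    | smul a x _ hx =>
      obtain ⟨c, h1, h2, rfl⟩ := hx
      refine ⟨fun i => a.1 * c i, fun i => mul_nonneg a.2 (h1 i), fun i hi => by simp [h2 i hi], ?_⟩
      simp_rw [mul_smul, ← Finset.smul_sum]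
      rfl
  · rintro ⟨c, h1, h2, rfl⟩
    refine Submodule.sum_mem _ fun i _ => ?_
    by_cases hi : i ∈ T
    · exact PointedCone.smul_mem _ (h1 i) (latticeVec_mem_gen v hi)
    · rw [h2 i hi, zero_smul]
      exact zero_mem _

lemma isRationalPolyhedral_gen (v : ι → N) (T : Set ι) : IsRationalPolyhedral (gen v T) :=
  ⟨v '' T, (Set.toFinite T).image v, (gen_eq_hull v T).symm⟩

lemma pairing_sum (m : DualLattice N) (v : ι → N) (c : ι → ℝ) :
    pairing m (∑ i, c i • latticeVec (v i)) = ∑ i, c i * (m (v i) : ℝ) := by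
  simp [map_sum]

lemma pairing_sub (m m' : DualLattice N) (x : RealSpace N) :
    pairing (m - m') x = pairing m x - pairing m' x := by
  rw [sub_eq_add_neg, pairing_add, pairing_neg, sub_eq_add_neg]

/-- Real points of a lattice are separated by characters. -/
lemma eq_of_forall_pairing_eq [Module.Free ℤ N] [Module.Finite ℤ N] {x y : RealSpace N}
    (h : ∀ m : DualLattice N, pairing m x = pairing m y) : x = y := by
  let b := Module.Free.chooseBasis ℤ N
  refine (b.baseChange ℝ).ext_elem fun i => ?_
  have key : ∀ z : RealSpace N, (b.baseChange ℝ).repr z i = pairing (b.coord i) z := by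
    intro z
    induction z using TensorProduct.induction_on with
    | zero => simp
    | tmul r n => simp [pairing]
    | add x y hx hy => rw [map_add, map_add, Finsupp.add_apply, hx, hy]
  rw [key, key, h]

/-- Pairing both sums with the character that detects `v j` isolates the `j`-th coefficient. -/
lemma DualIndep.coeff_eq {v : ι → N} {S : Set ι} (h : DualIndep v S) {c d : ι → ℝ}
    (hc : ∀ i, i ∉ S → c i = 0) (hd : ∀ i, i ∉ S → d i = 0)
    (hcd : ∑ i, c i • latticeVec (v i) = ∑ i, d i • latticeVec (v i)) : c = d := by
  funext j
  by_cases hj : j ∈ S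
  · obtain ⟨f, hf, hf'⟩ := h j hj
    have h1 := congrArg (pairing f) hcd
    rw [pairing_sum, pairing_sum, Finset.sum_eq_single j, Finset.sum_eq_single j] at h1
    · exact mul_right_cancel₀ (by exact_mod_cast hf.ne') h1
    all_goals first
      | (intro i _ hij
         by_cases hi : i ∈ S
         · simp [hf' i hi hij]
         · simp [hc i hi, hd i hi])
      | simp
  · rw [hc j hj, hd j hj]

lemma DualIndep.linearIndepOn {v : ι → N} {S : Set ι} (h : DualIndep v S) :
    LinearIndepOn ℝ (fun i => latticeVec (v i)) S := by
  classical
  rw [linearIndepOn_iff'']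
  intro t g ht hg hsum i
  have : g = 0 := by
    refine h.coeff_eq (c := g) (d := 0) (fun i hi => ?_) (by simp) ?_
    · exact hg i fun hit => hi (ht hit)
    · simp only [Pi.zero_apply, zero_smul, Finset.sum_const_zero]
      rw [← hsum]
      refine (Finset.sum_subset (Finset.subset_univ _) fun i _ hi => ?_).symm
      rw [hg i hi, zero_smul]
  simp [this]

lemma DualIndep.injOn {v : ι → N} {S : Set ι} (h : DualIndep v S) :
    Set.InjOn (fun i => latticeVec (v i)) S := h.linearIndepOn.injOn

lemma DualIndep.isSimplicial {v : ι → N} {S : Set ι} (h : DualIndep v S) :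
    (gen v S).IsSimplicial :=
  ⟨_, (Set.toFinite S).image _, (linearIndepOn_iff_image h.injOn).mp h.linearIndepOn, rfl⟩

lemma DualIndep.salient {v : ι → N} {S : Set ι} (h : DualIndep v S) :
    (gen v S : ConvexCone ℝ (RealSpace N)).Salient := by
  intro x hx hx0 hx'
  obtain ⟨c, hc, hcS, rfl⟩ := mem_gen_iff.mp hx
  obtain ⟨d, hd, hdS, hcd⟩ := mem_gen_iff.mp hx'
  apply hx0
  have : c = -d := by
    refine h.coeff_eq hcS (fun i hi => by simp [hdS i hi]) ?_
    rw [eq_comm]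
    simp only [Pi.neg_apply, neg_smul, Finset.sum_neg_distrib]
    rw [← hcd, neg_neg]
  have hc0 : ∀ i, c i = 0 := fun i => by
    have h1 := congrFun this i
    have h2 := hc i
    have h3 := hd i
    simp only [Pi.neg_apply] at h1
    linarith
  simp [hc0]

/-- Coefficients are unique, so if a sum of two points has no coefficient outside `T`, the
nonnegative coefficients of the summands there add up to zero and vanish. -/
lemma DualIndep.gen_isFaceOf {v : ι → N} {S T : Set ι} (h : DualIndep v S) (hT : T ⊆ S) :
    (gen v T).IsFaceOf (gen v S) := by
  refine PointedCone.IsFaceOf.of_mem_of_add_mem_left (gen_mono v hT) fun {x y} hx hy hxy => ?_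
  obtain ⟨c, hc, hcS, rfl⟩ := mem_gen_iff.mp hx
  obtain ⟨d, hd, hdS, rfl⟩ := mem_gen_iff.mp hy
  obtain ⟨e, he, heT, hce⟩ := mem_gen_iff.mp hxy
  have : c + d = e := by
    refine h.coeff_eq (fun i hi => by simp [hcS i hi, hdS i hi])
      (fun i hi => heT i fun h => hi (hT h)) ?_
    rw [← hce]
    simp [add_smul, Finset.sum_add_distrib]
  refine mem_gen_iff.mpr ⟨c, hc, fun i hi => ?_, rfl⟩
  have h1 := congrFun this i
  rw [Pi.add_apply, heT i hi] at h1
  linarith [hc i, hd i]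

/-- The point splits as `c i • v i` plus a point of `σ`, and a face contains the summands of its
points. -/
lemma support_subset_of_mem_face {v : ι → N} {S : Set ι} {F σ : PointedCone ℝ (RealSpace N)}
    (hF : F.IsFaceOf σ) (hS : gen v S ≤ σ) {c : ι → ℝ} (hc : ∀ i, 0 ≤ c i)
    (hcS : ∀ i, i ∉ S → c i = 0) (hx : ∑ i, c i • latticeVec (v i) ∈ F) {i : ι} (hi : c i ≠ 0) :
    latticeVec (v i) ∈ F := by
  classical
  have hmem : ∀ j ∈ S, latticeVec (v j) ∈ σ := gen_le_iff.mp hS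
  have hiS : i ∈ S := by_contra fun h => hi (hcS i h)
  rw [← Finset.add_sum_erase _ _ (Finset.mem_univ i)] at hx
  refine hF.mem_of_smul_add_mem (hmem i hiS) ?_ (lt_of_le_of_ne (hc i) (Ne.symm hi)) hx
  refine Submodule.sum_mem _ fun j _ => ?_
  by_cases hj : j ∈ S
  · exact PointedCone.smul_mem _ (hc j) (hmem j hj)
  · rw [hcS j hj, zero_smul]
    exact zero_mem _

/-- A face of a generated cone is generated by the generators that it contains. -/
lemma eq_gen_of_isFaceOf {v : ι → N} {S : Set ι} {F : PointedCone ℝ (RealSpace N)}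
    (hF : F.IsFaceOf (gen v S)) : F = gen v {i ∈ S | latticeVec (v i) ∈ F} := by
  apply le_antisymm
  · intro x hx
    obtain ⟨c, hc, hcS, rfl⟩ := mem_gen_iff.mp (hF.le hx)
    refine mem_gen_iff.mpr ⟨c, hc, fun i hi => by_contra fun h0 => hi ⟨?_, ?_⟩, rfl⟩
    · exact by_contra fun h => h0 (hcS i h)
    · exact support_subset_of_mem_face hF le_rfl hc hcS hx h0
  · exact gen_le_iff.mpr fun i hi => hi.2

end Gen

end Toric

namespace Toric

/-! ### Extremal generators of strongly convex cones and the ray vectors of a fan -/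

section Rays

variable {N : Type u} [AddCommGroup N]

lemma mem_hull_singleton {w x : RealSpace N} :
    x ∈ PointedCone.hull ℝ {w} ↔ ∃ a : ℝ, 0 ≤ a ∧ x = a • w := by
  rw [PointedCone.hull, Submodule.mem_span_singleton]
  constructor
  · rintro ⟨a, rfl⟩
    exact ⟨a.1, a.2, rfl⟩
  · rintro ⟨a, ha, rfl⟩
    exact ⟨⟨a, ha⟩, rfl⟩

lemma coneDim_hull_singleton {w : RealSpace N} (hw : w ≠ 0) :
    coneDim (PointedCone.hull ℝ {w}) = 1 := by
  have : Submodule.span ℝ ((PointedCone.hull ℝ {w} : PointedCone ℝ (RealSpace N)) :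
      Set (RealSpace N)) = Submodule.span ℝ {w} := by
    refine Submodule.span_eq_of_le _ (fun x hx => PointedCone.hull_le_span ℝ _ hx)
      (Submodule.span_mono PointedCone.subset_hull)
  rw [coneDim, this, finrank_span_singleton hw]

/-- The span is a line, so every point is a real multiple of `w`. A negative multiple would put `-w`
into the cone, against strong convexity. -/
lemma hull_singleton_eq_of_coneDim {ρ : PointedCone ℝ (RealSpace N)}
    (hs : (ρ : ConvexCone ℝ (RealSpace N)).Salient) (hd : coneDim ρ = 1) {w : RealSpace N}
    (hw : w ∈ ρ) (hw0 : w ≠ 0) : PointedCone.hull ℝ {w} = ρ := by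
  apply le_antisymm
  · exact Submodule.span_le.mpr (by simpa using hw)
  · intro x hx
    have hmem : ∀ y ∈ ρ, y ∈ Submodule.span ℝ (ρ : Set (RealSpace N)) :=
      fun y hy => Submodule.subset_span hy
    obtain ⟨c, hc⟩ := (finrank_eq_one_iff_of_nonzero'
      (⟨w, hmem w hw⟩ : Submodule.span ℝ (ρ : Set (RealSpace N)))
      (fun h => hw0 (congrArg Subtype.val h))).mp hd ⟨x, hmem x hx⟩
    have hc' : c • w = x := congrArg Subtype.val hc
    refine mem_hull_singleton.mpr ⟨c, ?_, hc'.symm⟩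
    by_contra hneg
    push Not at hneg
    refine hs w hw hw0 ?_
    have : -w = (-c)⁻¹ • x := by
      rw [← hc', smul_smul, inv_neg, neg_mul, inv_mul_cancel₀ hneg.ne, neg_one_smul]
    rw [this]
    exact ρ.smul_mem (by simpa using hneg.le) hx

/-- A strongly convex rational cone is generated by finitely many lattice vectors that span
one-dimensional faces. -/
lemma exists_ray_generators {σ : PointedCone ℝ (RealSpace N)} (hσ : IsRationalPolyhedral σ)
    (hs : (σ : ConvexCone ℝ (RealSpace N)).Salient) :
    ∃ S : Set N, S.Finite ∧ PointedCone.hull ℝ (latticeVec '' S) = σ ∧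
      ∀ v ∈ S, latticeVec v ≠ 0 ∧ (PointedCone.hull ℝ {latticeVec v}).IsFaceOf σ := by
  obtain ⟨S₀, hS₀, hσ₀⟩ := hσ
  have hfin : {T : Set N | T ⊆ S₀ ∧ PointedCone.hull ℝ (latticeVec '' T) = σ}.Finite :=
    hS₀.finite_subsets.subset fun T hT => hT.1
  -- In a minimal generating set no vector lies in the cone `τ` of the others. This, with strong
  -- convexity, makes each vector span a face.
  obtain ⟨S, ⟨hSS, hSσ⟩, hmin⟩ := hfin.exists_minimal ⟨S₀, subset_rfl, hσ₀⟩
  refine ⟨S, hS₀.subset hSS, hSσ, fun v hv => ?_⟩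
  set τ := PointedCone.hull ℝ (latticeVec '' (S \ {v})) with hτ
  have hvσ : latticeVec v ∈ σ := hSσ ▸ PointedCone.subset_hull ⟨v, hv, rfl⟩
  have hτσ : τ ≤ σ := by
    rw [← hSσ]
    exact Submodule.span_mono (Set.image_mono Set.sdiff_subset)
  have hnot : latticeVec v ∉ τ := by
    intro hvτ
    have : S \ {v} ∈ {T : Set N | T ⊆ S₀ ∧ PointedCone.hull ℝ (latticeVec '' T) = σ} := by
      refine ⟨Set.sdiff_subset.trans hSS, le_antisymm hτσ ?_⟩
      rw [← hSσ]
      refine Submodule.span_le.mpr ?_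
      rintro _ ⟨w, hw, rfl⟩
      by_cases h : w = v
      · rw [h]
        exact hvτ
      · exact PointedCone.subset_hull ⟨w, ⟨hw, h⟩, rfl⟩
    exact (hmin this Set.sdiff_subset hv).2 rfl
  have hdec : ∀ x ∈ σ, ∃ a : ℝ, 0 ≤ a ∧ ∃ z ∈ τ, x = a • latticeVec v + z := by
    intro x hx
    rw [← hSσ, ← Set.insert_sdiff_self_of_mem hv, Set.image_insert_eq] at hx
    obtain ⟨a, z, hz, rfl⟩ := Submodule.mem_span_insert.mp hx
    exact ⟨a.1, a.2, z, hz, rfl⟩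
  have hzero : ∀ x ∈ σ, ∀ y ∈ σ, x + y = 0 → x = 0 := by
    intro x hx y hy hxy
    by_contra h0
    refine hs x hx h0 ?_
    rw [neg_eq_of_add_eq_zero_right hxy]
    exact hy
  have hv0 : latticeVec v ≠ 0 := fun h => hnot (h ▸ zero_mem _)
  refine ⟨hv0, PointedCone.IsFaceOf.of_mem_of_add_mem_left
    (Submodule.span_le.mpr (by simpa using hvσ)) fun {x y} hx hy hxy => ?_⟩
  obtain ⟨a, ha, z, hz, rfl⟩ := hdec x hx
  obtain ⟨b, hb, w, hw, rfl⟩ := hdec y hy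
  obtain ⟨c, hc, hsum⟩ := mem_hull_singleton.mp hxy
  have hzw : z + w = (c - a - b) • latticeVec v := by
    rw [sub_smul, sub_smul, ← hsum]
    abel
  -- A positive coefficient would express `v` through `z + w ∈ τ`.
  have hle : c - a - b ≤ 0 := by
    by_contra hpos
    push Not at hpos
    apply hnot
    have : latticeVec v = (c - a - b)⁻¹ • (z + w) := by
      rw [hzw, smul_smul, inv_mul_cancel₀ hpos.ne', one_smul]
    rw [this]
    exact τ.smul_mem (inv_nonneg.mpr hpos.le) (add_mem hz hw)
  -- The points `z` and `w + (a + b - c) v` of `σ` are opposite, hence zero by strong convexity.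
  have hz0 : z = 0 := by
    refine hzero z (hτσ hz) (w + (a + b - c) • latticeVec v)
      (add_mem (hτσ hw) (σ.smul_mem (by linarith) hvσ)) ?_
    rw [← add_assoc, hzw, ← add_smul, show c - a - b + (a + b - c) = 0 by ring, zero_smul]
  exact mem_hull_singleton.mpr ⟨a, ha, by rw [hz0, add_zero]⟩

namespace Fan

lemma exists_vec_of_ray (Δ : Fan N) (ρ : Δ.rays) :
    ∃ v : N, latticeVec v ≠ 0 ∧ PointedCone.hull ℝ {latticeVec v} = ρ.1 := by
  obtain ⟨hρ, hd⟩ := ρ.2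
  obtain ⟨S, -, hS, hS'⟩ := exists_ray_generators (Δ.rational _ hρ) (Δ.salient _ hρ)
  rcases S.eq_empty_or_nonempty with rfl | ⟨v, hv⟩
  · exfalso
    have h0 : ρ.1 = ⊥ := by rw [← hS]; simp [PointedCone.hull]
    rw [h0, coneDim] at hd
    have h1 : Submodule.span ℝ ((⊥ : PointedCone ℝ (RealSpace N)) : Set (RealSpace N)) = ⊥ := by
      simp
    rw [h1, finrank_bot] at hd
    exact zero_ne_one hd
  · refine ⟨v, (hS' v hv).1, hull_singleton_eq_of_coneDim (Δ.salient _ hρ) hd ?_ (hS' v hv).1⟩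
    rw [← hS]
    exact PointedCone.subset_hull ⟨v, hv, rfl⟩

/-- A lattice vector generating the ray `ρ`. -/
def rayVec (Δ : Fan N) (ρ : Δ.rays) : N := (Δ.exists_vec_of_ray ρ).choose

lemma hull_rayVec (Δ : Fan N) (ρ : Δ.rays) : PointedCone.hull ℝ {latticeVec (Δ.rayVec ρ)} = ρ.1 :=
  (Δ.exists_vec_of_ray ρ).choose_spec.2

instance (Δ : Fan N) : Finite Δ.rays := (Δ.finite.subset fun _ h => h.1).to_subtype

instance (Δ : Fan N) : Fintype Δ.rays := Fintype.ofFinite _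

/-- The rays that lie in a cone. -/
def raysOf (Δ : Fan N) (σ : PointedCone ℝ (RealSpace N)) : Set Δ.rays :=
  {ρ | latticeVec (Δ.rayVec ρ) ∈ σ}

/-- The extremal generators of `σ` span faces of `σ`, which belong to `Δ` and hence are among its
rays. Up to positive factors these generators are the chosen ray vectors. -/
lemma gen_raysOf (Δ : Fan N) {σ : PointedCone ℝ (RealSpace N)} (hσ : σ ∈ Δ.cones) :
    gen Δ.rayVec (Δ.raysOf σ) = σ := by
  apply le_antisymm (gen_le_iff.mpr fun ρ h => h)
  obtain ⟨S, -, hS, hS'⟩ := exists_ray_generators (Δ.rational _ hσ) (Δ.salient _ hσ)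
  conv_lhs => rw [← hS]
  refine Submodule.span_le.mpr ?_
  rintro _ ⟨v, hv, rfl⟩
  obtain ⟨hv0, hface⟩ := hS' v hv
  let ρ : Δ.rays := ⟨_, Δ.face_mem σ hσ _ hface, coneDim_hull_singleton hv0⟩
  have hρ : ρ ∈ Δ.raysOf σ := by
    apply hface.le
    have : latticeVec (Δ.rayVec ρ) ∈ PointedCone.hull ℝ {latticeVec (Δ.rayVec ρ)} :=
      PointedCone.subset_hull rfl
    rwa [Δ.hull_rayVec ρ] at this
  have h1 : latticeVec v ∈ PointedCone.hull ℝ {latticeVec (Δ.rayVec ρ)} := by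
    rw [Δ.hull_rayVec ρ]
    exact PointedCone.subset_hull rfl
  refine (Submodule.span_le.mpr ?_ : PointedCone.hull ℝ {latticeVec (Δ.rayVec ρ)} ≤ _) h1
  exact Set.singleton_subset_iff.mpr (latticeVec_mem_gen Δ.rayVec hρ)

lemma raysOf_mono (Δ : Fan N) {σ τ : PointedCone ℝ (RealSpace N)} (h : σ ≤ τ) :
    Δ.raysOf σ ⊆ Δ.raysOf τ := fun _ hρ => h hρ

end Fan

end Rays

/-! ### Generic heights -/

section Heights

variable {N : Type u} [AddCommGroup N] [Module.Free ℤ N] {ι : Type u} [Fintype ι]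

/-- Take for the `a i` the successive powers of one integer `t`. Each `g` becomes a nonzero
polynomial in `t`, and some positive `t` avoids the finitely many roots. -/
lemma exists_pos_forall_sum_ne_zero (G : Set (ι → ℤ)) (hG : G.Finite) (h0 : ∀ g ∈ G, g ≠ 0) :
    ∃ a : ι → ℤ, (∀ i, 0 < a i) ∧ ∀ g ∈ G, ∑ i, g i * a i ≠ 0 := by
  classical
  let e := Fintype.equivFin ι
  let P : (ι → ℤ) → Polynomial ℤ := fun g => ∑ i, Polynomial.monomial (e i).1 (g i)
  have hP : ∀ g ∈ G, P g ≠ 0 := by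
    intro g hg h
    apply h0 g hg
    funext i
    have := congrArg (fun p => p.coeff (e i).1) h
    simp only [P, Polynomial.finsetSum_coeff, Polynomial.coeff_monomial, Polynomial.coeff_zero] at this
    rwa [Finset.sum_eq_single i, if_pos rfl] at this
    · intro j _ hj
      rw [if_neg]
      intro h
      exact hj (e.injective (Fin.ext h))
    · simp
  have hfin : (⋃ g ∈ G, {x | (P g).IsRoot x}).Finite :=
    hG.biUnion fun g hg => Polynomial.finite_setOfPred_isRoot (hP g hg)
  obtain ⟨t, ht, ht'⟩ := ((Set.Ioi_infinite (0 : ℤ)).sdiff hfin).nonempty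
  refine ⟨fun i => t ^ (e i).1, fun i => pow_pos ht _, fun g hg h => ht' ?_⟩
  simp only [Set.mem_iUnion]
  refine ⟨g, hg, ?_⟩
  change (P g).eval t = 0
  simp only [P, Polynomial.eval_finsetSum, Polynomial.eval_monomial]
  exact h

/-- Apply Farkas' lemma to `-v j` and the vectors `± v i` with `i ≠ j` in `S`. Either a positive
multiple of `v j` is an integral combination of the others, which is a relation, or there is a
character that vanishes on the others and is positive at `v j`. -/
lemma exists_relation_of_not_dualIndep {v : ι → N} {S : Set ι} (h : ¬ DualIndep v S) :
    ∃ g : ι → ℤ, g ≠ 0 ∧ (∀ i, i ∉ S → g i = 0) ∧ ∑ i, g i • v i = 0 := by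
  classical
  simp only [DualIndep, not_forall] at h
  obtain ⟨j, hj, hf⟩ := h
  let T : Finset ι := Finset.univ.filter fun i => i ∈ S ∧ i ≠ j
  let l : List N := (T.toList.map v) ++ (T.toList.map fun i => -v i)
  have hT : ∀ {i}, i ∈ T ↔ i ∈ S ∧ i ≠ j := by simp [T]
  rcases farkas l.length l rfl (-v j) with ⟨p, hp, hpv⟩ | ⟨f, hfl, hfj⟩
  · have hcl : ∀ x ∈ AddSubmonoid.closure {x | x ∈ l}, ∃ g : ι → ℤ,
        (∀ i, i ∉ T → g i = 0) ∧ x = ∑ i, g i • v i := by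
      intro x hx
      induction hx using AddSubmonoid.closure_induction with
      | mem x hx =>
        rcases List.mem_append.mp hx with hx | hx
        all_goals
          obtain ⟨i, hi, rfl⟩ := List.mem_map.mp hx
          rw [Finset.mem_toList] at hi
        · refine ⟨Pi.single i 1, fun k hk => Pi.single_eq_of_ne (fun h : k = i => hk (h ▸ hi)) _, ?_⟩
          rw [Finset.sum_eq_single i (fun k _ h => by simp [Pi.single_eq_of_ne h]) (by simp)]
          simp
        · refine ⟨Pi.single i (-1),
            fun k hk => Pi.single_eq_of_ne (fun h : k = i => hk (h ▸ hi)) _, ?_⟩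
          rw [Finset.sum_eq_single i (fun k _ h => by simp [Pi.single_eq_of_ne h]) (by simp)]
          simp
      | zero => exact ⟨0, by simp, by simp⟩
      | add x y _ _ hx hy =>
        obtain ⟨g, h1, rfl⟩ := hx
        obtain ⟨g', h1', rfl⟩ := hy
        exact ⟨g + g', fun i hi => by simp [h1 i hi, h1' i hi],
          by simp [add_smul, Finset.sum_add_distrib]⟩
    obtain ⟨g, hg, hsum⟩ := hcl _ hpv
    have hgj : g j = 0 := hg j (by simp [hT])
    refine ⟨g + Pi.single j (p : ℤ), fun h => ?_, fun i hi => ?_, ?_⟩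
    · have := congrFun h j
      simp [hgj] at this
      omega
    · have hij : i ≠ j := fun h => hi (h ▸ hj)
      simp [hg i (fun h => hi (hT.mp h).1), Pi.single_eq_of_ne hij]
    · simp only [Pi.add_apply, add_smul, Finset.sum_add_distrib]
      rw [← hsum, Finset.sum_eq_single j (fun k _ h => by simp [Pi.single_eq_of_ne h]) (by simp)]
      simp
  · exfalso
    refine hf ⟨f, by simpa using hfj, fun i hi hij => le_antisymm ?_ ?_⟩
    · have := hfl (-v i) (List.mem_append_right _
        (List.mem_map.mpr ⟨i, Finset.mem_toList.mpr (hT.mpr ⟨hi, hij⟩), rfl⟩))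
      simpa using this
    · exact hfl (v i) (List.mem_append_left _
        (List.mem_map.mpr ⟨i, Finset.mem_toList.mpr (hT.mpr ⟨hi, hij⟩), rfl⟩))

/-- Generic heights: a family on which the heights are linear is independent. -/
lemma exists_generic_heights (v : ι → N) :
    ∃ a : ι → ℤ, (∀ i, 0 < a i) ∧ ∀ (S : Set ι) (m : DualLattice N) (t : ℤ), t ≠ 0 →
      (∀ i ∈ S, m (v i) = t * a i) → DualIndep v S := by
  classical
  have hrel : ∀ S : {S : Set ι // ¬ DualIndep v S}, ∃ g : ι → ℤ, g ≠ 0 ∧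
      (∀ i, i ∉ S.1 → g i = 0) ∧ ∑ i, g i • v i = 0 :=
    fun S => exists_relation_of_not_dualIndep S.2
  choose g hg0 hgS hgv using hrel
  obtain ⟨a, ha, hag⟩ := exists_pos_forall_sum_ne_zero (Set.range g) (Set.finite_range g)
    (by rintro _ ⟨S, rfl⟩; exact hg0 S)
  refine ⟨a, ha, fun S m t ht hm => ?_⟩
  by_contra hS
  apply hag (g ⟨S, hS⟩) ⟨_, rfl⟩
  -- Applying `m` to the relation attached to `S` turns linearity of the heights on `S` into `t * ∑
  -- g i * a i = 0`, which the choice of `a` excludes.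
  have h1 := congrArg m (hgv ⟨S, hS⟩)
  rw [map_sum, map_zero] at h1
  have h2 : t * ∑ i, g ⟨S, hS⟩ i * a i = 0 := by
    rw [← h1, Finset.mul_sum]
    refine Finset.sum_congr rfl fun i _ => ?_
    rw [map_smul, smul_eq_mul]
    by_cases hi : i ∈ S
    · rw [hm i hi]; ring
    · rw [hgS ⟨S, hS⟩ i hi]; ring
  exact (mul_eq_zero.mp h2).resolve_left ht

end Heights

end Toric

namespace Toric

namespace Fan

/-! ### The cells induced by heights: duality, faces, intersections and covering -/

section Cells

variable {N : Type u} [AddCommGroup N] (Δ : Fan N) (a : Δ.rays → ℤ)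

/-- The set `S` of rays of `σ` is the set of rays at which the character `m` attains the upper
bound `t a` given by the heights `a`. -/
structure IsCellWith (σ : PointedCone ℝ (RealSpace N)) (S : Set Δ.rays) (m : DualLattice N)
    (t : ℤ) : Prop where
  subset : S ⊆ Δ.raysOf σ
  pos : 0 < t
  eq : ∀ i ∈ S, m (Δ.rayVec i) = t * a i
  lt : ∀ i ∈ Δ.raysOf σ, i ∉ S → m (Δ.rayVec i) < t * a i

/-- The cells of the subdivision of `σ` that the heights `a` induce. -/
def IsCell (σ : PointedCone ℝ (RealSpace N)) (S : Set Δ.rays) : Prop :=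
  ∃ m t, Δ.IsCellWith a σ S m t

variable {Δ a} {σ τ : PointedCone ℝ (RealSpace N)} {S T : Set Δ.rays} {m : DualLattice N} {t : ℤ}

/-- Weak duality: `m ≤ t a` on the rays of `σ`, so `m` bounds from below `t` times the height of
every representation. -/
lemma IsCellWith.pairing_le (h : Δ.IsCellWith a σ S m t) {c : Δ.rays → ℝ} (hc : ∀ i, 0 ≤ c i)
    (hcσ : ∀ i, i ∉ Δ.raysOf σ → c i = 0) :
    pairing m (∑ i, c i • latticeVec (Δ.rayVec i)) ≤ t * ∑ i, c i * a i := by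
  rw [pairing_sum, Finset.mul_sum]
  refine Finset.sum_le_sum fun i _ => ?_
  by_cases hi : i ∈ Δ.raysOf σ
  · have h1 : m (Δ.rayVec i) ≤ t * a i := by
      by_cases hS : i ∈ S
      exacts [(h.eq i hS).le, (h.lt i hi hS).le]
    have h2 : (m (Δ.rayVec i) : ℝ) ≤ t * a i := by exact_mod_cast h1
    nlinarith [mul_le_mul_of_nonneg_left h2 (hc i)]
  · simp [hcσ i hi]

/-- Complementary slackness: if the bound is attained, no weight lies on a ray where `m < t a`. -/
lemma IsCellWith.support_subset (h : Δ.IsCellWith a σ S m t) {c : Δ.rays → ℝ} (hc : ∀ i, 0 ≤ c i)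
    (hcσ : ∀ i, i ∉ Δ.raysOf σ → c i = 0)
    (heq : t * ∑ i, c i * a i ≤ pairing m (∑ i, c i • latticeVec (Δ.rayVec i)))
    {j : Δ.rays} (hj : j ∉ S) : c j = 0 := by
  by_contra h0
  have hjσ : j ∈ Δ.raysOf σ := by_contra fun h' => h0 (hcσ j h')
  refine heq.not_gt ?_
  rw [pairing_sum, Finset.mul_sum]
  refine Finset.sum_lt_sum (fun i _ => ?_) ⟨j, Finset.mem_univ j, ?_⟩
  · by_cases hi : i ∈ Δ.raysOf σ
    · have h1 : m (Δ.rayVec i) ≤ t * a i := by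
        by_cases hS : i ∈ S
        exacts [(h.eq i hS).le, (h.lt i hi hS).le]
      have h2 : (m (Δ.rayVec i) : ℝ) ≤ t * a i := by exact_mod_cast h1
      nlinarith [mul_le_mul_of_nonneg_left h2 (hc i)]
    · simp [hcσ i hi]
  · have h2 : (m (Δ.rayVec j) : ℝ) < t * a j := by exact_mod_cast h.lt j hjσ hj
    nlinarith [mul_lt_mul_of_pos_left h2 (lt_of_le_of_ne (hc j) (Ne.symm h0))]

lemma IsCellWith.pairing_eq (h : Δ.IsCellWith a σ S m t) {c : Δ.rays → ℝ}
    (hcS : ∀ i, i ∉ S → c i = 0) :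
    pairing m (∑ i, c i • latticeVec (Δ.rayVec i)) = t * ∑ i, c i * a i := by
  rw [pairing_sum, Finset.mul_sum]
  refine Finset.sum_congr rfl fun i _ => ?_
  by_cases hi : i ∈ S
  · rw [h.eq i hi]; push_cast; ring
  · rw [hcS i hi]; ring

/-- This lets finitely many cells share one value of `t`. -/
lemma IsCellWith.scale {q : ℤ} (h : Δ.IsCellWith a σ S m t) (hq : 0 < q) :
    Δ.IsCellWith a σ S (q • m) (t * q) where
  subset := h.subset
  pos := mul_pos h.pos hq
  eq i hi := by simp [h.eq i hi]; ring
  lt i hi hiS := by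
    have := mul_lt_mul_of_pos_left (h.lt i hi hiS) hq
    simp only [LinearMap.smul_apply, smul_eq_mul]
    linarith [mul_assoc q t (a i), mul_comm q t]

lemma IsCell.of_le (h : Δ.IsCell a σ S) (hτ : τ ≤ σ) (hS : S ⊆ Δ.raysOf τ) : Δ.IsCell a τ S := by
  obtain ⟨m, t, h⟩ := h
  exact ⟨m, t, hS, h.pos, h.eq, fun i hi => h.lt i (hτ hi)⟩

lemma IsCell.le (h : Δ.IsCell a σ S) : gen Δ.rayVec S ≤ σ := by
  obtain ⟨m, t, h⟩ := h
  exact gen_le_iff.mpr fun i hi => h.subset hi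

lemma abs_le_sum_abs (f : Δ.rays → ℤ) (i : Δ.rays) : |f i| ≤ ∑ j, |f j| :=
  Finset.single_le_sum (f := fun j => |f j|) (fun _ _ => abs_nonneg _) (Finset.mem_univ i)

variable [Module.Free ℤ N]

/-- Subtracting a large multiple of the character `f` that cuts out `τ` changes nothing on `τ`. On
the other rays `f ≥ 1`, so the factor `∑ |m|` makes the value nonpositive, which is below `t a`
because heights are positive. -/
lemma IsCell.of_isFaceOf (ha : ∀ i, 0 < a i) (hσ : σ ∈ Δ.cones) (hτ : τ.IsFaceOf σ)
    (h : Δ.IsCell a τ S) : Δ.IsCell a σ S := by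
  obtain ⟨m, t, h⟩ := h
  obtain ⟨f, hf0, hf1⟩ := exists_supporting ((Set.toFinite (Δ.raysOf σ)).image Δ.rayVec)
    (by rw [← gen_eq_hull, Δ.gen_raysOf hσ]) hτ
  refine ⟨m - (∑ j, |m (Δ.rayVec j)|) • f, t, h.subset.trans (Δ.raysOf_mono hτ.le), h.pos,
    fun i hi => ?_, fun i hi hiS => ?_⟩
  · have h1 := hf0 _ ⟨i, hτ.le (h.subset hi), rfl⟩ (h.subset hi)
    simp [h1, h.eq i hi]
  · by_cases hiτ : latticeVec (Δ.rayVec i) ∈ τ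
    · have h1 := hf0 _ ⟨i, hi, rfl⟩ hiτ
      simpa [h1] using h.lt i hiτ hiS
    · have h1 := hf1 _ ⟨i, hi, rfl⟩ hiτ
      have h2 := abs_le_sum_abs (fun j => m (Δ.rayVec j)) i
      have h3 := mul_pos h.pos (ha i)
      have h4 := le_abs_self (m (Δ.rayVec i))
      have h5 : 0 ≤ ∑ j, |m (Δ.rayVec j)| := Finset.sum_nonneg fun _ _ => abs_nonneg _
      simp only [LinearMap.sub_apply, LinearMap.smul_apply, smul_eq_mul]
      nlinarith

/-- Tilting `m` by the character `f` that cuts out the face of `T` makes the inequality strict on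
`S` outside `T`. -/
lemma IsCell.mono (hS : DualIndep Δ.rayVec S) (h : Δ.IsCell a σ S) (hT : T ⊆ S) :
    Δ.IsCell a σ T := by
  obtain ⟨m, t, h⟩ := h
  obtain ⟨f, hf0, hf1⟩ := exists_supporting ((Set.toFinite S).image Δ.rayVec)
    (gen_eq_hull _ _).symm (hS.gen_isFaceOf hT)
  have hpos : ∀ i ∈ S, i ∉ T → 0 < f (Δ.rayVec i) := by
    intro i hi hiT
    refine hf1 _ ⟨i, hi, rfl⟩ fun hmem => hiT ?_
    obtain ⟨c, hc, hcT, hsum⟩ := mem_gen_iff.mp hmem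
    classical
    have h1 : Pi.single i 1 = c := by
      refine hS.coeff_eq (fun j hj => Pi.single_eq_of_ne (fun h : j = i => hj (h ▸ hi)) _)
        (fun j hj => hcT j fun h => hj (hT h)) ?_
      rw [← hsum, Finset.sum_eq_single i (fun k _ h => by simp [Pi.single_eq_of_ne h]) (by simp)]
      simp
    by_contra hiT'
    have h2 := congrFun h1 i
    rw [hcT i hiT', Pi.single_eq_same] at h2
    exact one_ne_zero h2
  -- Off `S` the integers satisfy `m ≤ t a - 1`. Multiplying by `K > |f|` leaves enough room to
  -- absorb the perturbation by `f`.
  set K : ℤ := 1 + ∑ j, |f (Δ.rayVec j)| with hK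
  have hK0 : 0 < K := by
    have : 0 ≤ ∑ j, |f (Δ.rayVec j)| := Finset.sum_nonneg fun _ _ => abs_nonneg _
    omega
  refine ⟨K • m - f, K * t, hT.trans h.subset, mul_pos hK0 h.pos, fun i hi => ?_,
    fun i hi hiT => ?_⟩
  · have h1 := hf0 _ ⟨i, hT hi, rfl⟩ (latticeVec_mem_gen _ hi)
    simp [h1, h.eq i (hT hi), mul_assoc]
  · simp only [LinearMap.sub_apply, LinearMap.smul_apply, smul_eq_mul]
    by_cases hiS : i ∈ S
    · rw [h.eq i hiS]
      linarith [hpos i hiS hiT, mul_assoc K t (a i)]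
    · have h1 := h.lt i hi hiS
      have h2 := abs_le_sum_abs (fun j => f (Δ.rayVec j)) i
      have h4 := neg_abs_le (f (Δ.rayVec i))
      nlinarith

/-- Restrict the cell to the common face `σ ⊓ τ`, then extend it from this face to `σ`. So being a
cell does not depend on the cone of `Δ` chosen around it. -/
lemma IsCell.of_gen_le (ha : ∀ i, 0 < a i) (hσ : σ ∈ Δ.cones) (hτ : τ ∈ Δ.cones)
    (h : Δ.IsCell a τ S) (hS : gen Δ.rayVec S ≤ σ) : Δ.IsCell a σ S := by
  have h1 : Δ.IsCell a (σ ⊓ τ) S := by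
    refine h.of_le inf_le_right fun i hi => ⟨gen_le_iff.mp hS i hi, ?_⟩
    exact gen_le_iff.mp h.le i hi
  exact h1.of_isFaceOf ha hσ (Δ.inf_isFaceOf σ hσ τ hτ)

/-- Two representations of a point, one of them by the rays of a cell. -/
lemma IsCell.support_subset_of_mem (hgen : ∀ {σ S}, Δ.IsCell a σ S → DualIndep Δ.rayVec S)
    (hσ : σ ∈ Δ.cones) (hτ : τ ∈ Δ.cones) (hS : Δ.IsCell a σ S) (hT : Δ.IsCell a τ T)
    {x : RealSpace N} (hxS : x ∈ gen Δ.rayVec S) (hxT : x ∈ gen Δ.rayVec T) :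
    x ∈ gen Δ.rayVec (S ∩ T) := by
  obtain ⟨c, hc, hcS, rfl⟩ := mem_gen_iff.mp hxS
  obtain ⟨d, hd, hdT, hcd⟩ := mem_gen_iff.mp hxT
  have hx : ∑ i, c i • latticeVec (Δ.rayVec i) ∈ σ ⊓ τ := ⟨hS.le hxS, hT.le hxT⟩
  have hfσ := Δ.inf_isFaceOf σ hσ τ hτ
  have hfτ : (σ ⊓ τ).IsFaceOf τ := inf_comm σ τ ▸ Δ.inf_isFaceOf τ hτ σ hσ
  -- The supports of both representations lie in the common face, where they are cells since subsets
  -- of cells are. There the two can be compared.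
  let S' : Set Δ.rays := {i | c i ≠ 0}
  let T' : Set Δ.rays := {i | d i ≠ 0}
  have hS'S : S' ⊆ S := fun i hi => by_contra fun h => hi (hcS i h)
  have hT'T : T' ⊆ T := fun i hi => by_contra fun h => hi (hdT i h)
  have hS'r : S' ⊆ Δ.raysOf (σ ⊓ τ) := fun i hi =>
    support_subset_of_mem_face hfσ hS.le hc hcS hx hi
  have hT'r : T' ⊆ Δ.raysOf (σ ⊓ τ) := fun i hi =>
    support_subset_of_mem_face hfτ hT.le hd hdT (hcd ▸ hx) hi
  obtain ⟨m, t, hm⟩ := (hS.mono (hgen hS) hS'S).of_le hfσ.le hS'r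
  obtain ⟨m', t', hm'⟩ := (hT.mono (hgen hT) hT'T).of_le hfτ.le hT'r
  have hcr : ∀ i, i ∉ Δ.raysOf (σ ⊓ τ) → c i = 0 := fun i hi => by_contra fun h => hi (hS'r h)
  have hdr : ∀ i, i ∉ Δ.raysOf (σ ⊓ τ) → d i = 0 := fun i hi => by_contra fun h => hi (hT'r h)
  -- Weak duality for `m` gives `∑ c a ≤ ∑ d a`. Complementary slackness for `m'`, applied to the
  -- representation `c`, then forces `c` to vanish off `T'`.
  have e1 := hm.pairing_eq (c := c) fun i hi => not_not.mp hi
  have e2 := hm'.pairing_eq (c := d) fun i hi => not_not.mp hi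
  have l1 := hm.pairing_le hd hdr
  rw [← hcd, e1] at l1
  have ht : (0 : ℝ) < t := by exact_mod_cast hm.pos
  have ht' : (0 : ℝ) < t' := by exact_mod_cast hm'.pos
  have l3 : ∑ i, c i * (a i : ℝ) ≤ ∑ i, d i * (a i : ℝ) := le_of_mul_le_mul_left l1 ht
  refine mem_gen_iff.mpr ⟨c, hc, fun i hi => ?_, rfl⟩
  by_cases hiS : i ∈ S
  · have hiT : i ∉ T := fun h => hi ⟨hiS, h⟩
    refine hm'.support_subset hc hcr ?_ fun h => hiT (hT'T h)
    rw [hcd, e2]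
    exact mul_le_mul_of_nonneg_left l3 ht'.le
  · exact hcS i hiS

/-- The point has a representation by the rays of `S ∩ T`, and both characters send it to `t` times
the height of that representation. The common `t` is essential. -/
lemma IsCellWith.pairing_eq_pairing (hgen : ∀ {σ S}, Δ.IsCell a σ S → DualIndep Δ.rayVec S)
    {m' : DualLattice N} (hσ : σ ∈ Δ.cones) (hτ : τ ∈ Δ.cones) (h : Δ.IsCellWith a σ S m t)
    (h' : Δ.IsCellWith a τ T m' t) {x : RealSpace N} (hx : x ∈ gen Δ.rayVec S)
    (hx' : x ∈ gen Δ.rayVec T) : pairing m x = pairing m' x := by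
  have hmem := IsCell.support_subset_of_mem hgen hσ hτ ⟨m, t, h⟩ ⟨m', t, h'⟩ hx hx'
  obtain ⟨c, -, hc, rfl⟩ := mem_gen_iff.mp hmem
  rw [h.pairing_eq fun i hi => hc i fun h => hi h.1, h'.pairing_eq fun i hi => hc i fun h => hi h.2]

variable [Module.Finite ℤ N]

/-- Positive heights bound the coefficients of all representations at most as high as a given one,
so a minimum exists by compactness. -/
lemma exists_min_heights (ha : ∀ i, 0 < a i) {x : RealSpace N}
    (hx : x ∈ gen Δ.rayVec S) : ∃ c : Δ.rays → ℝ, (∀ i, 0 ≤ c i) ∧ (∀ i, i ∉ S → c i = 0) ∧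
      x = ∑ i, c i • latticeVec (Δ.rayVec i) ∧
      ∀ d : Δ.rays → ℝ, (∀ i, 0 ≤ d i) → (∀ i, i ∉ S → d i = 0) →
        x = ∑ i, d i • latticeVec (Δ.rayVec i) → ∑ i, c i * (a i : ℝ) ≤ ∑ i, d i * (a i : ℝ) := by
  obtain ⟨e, he, heS, hxe⟩ := mem_gen_iff.mp hx
  set B := ∑ i, e i * (a i : ℝ) with hB
  have hcont : Continuous fun c : Δ.rays → ℝ => ∑ i, c i * (a i : ℝ) := by fun_prop
  -- The equation for `x` is tested on all characters, which makes it a family of closed conditions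
  -- on real numbers.
  let K : Set (Δ.rays → ℝ) := {c | (∀ i, 0 ≤ c i) ∧ (∀ i, i ∉ S → c i = 0) ∧
    (∀ m : DualLattice N, ∑ i, c i * (m (Δ.rayVec i) : ℝ) = pairing m x) ∧
    ∑ i, c i * (a i : ℝ) ≤ B}
  have hKclosed : IsClosed K := by
    have : K = (⋂ i, {c | 0 ≤ c i}) ∩ ((⋂ i, ⋂ (_ : i ∉ S), {c | c i = 0}) ∩
        ((⋂ m : DualLattice N, {c | ∑ i, c i * (m (Δ.rayVec i) : ℝ) = pairing m x}) ∩
          {c | ∑ i, c i * (a i : ℝ) ≤ B})) := by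
      ext c
      simp [K]
    rw [this]
    refine (isClosed_iInter fun i => isClosed_le (by fun_prop) (by fun_prop)).inter
      ((isClosed_iInter fun i => isClosed_iInter fun _ => isClosed_eq (by fun_prop)
        (by fun_prop)).inter ((isClosed_iInter fun m => isClosed_eq (by fun_prop)
        (by fun_prop)).inter (isClosed_le hcont (by fun_prop))))
  have hKcompact : IsCompact K := by
    refine (isCompact_Icc (a := (0 : Δ.rays → ℝ)) (b := fun _ => B)).of_isClosed_subset hKclosed ?_
    rintro c ⟨hc, -, -, hcB⟩
    refine ⟨hc, fun i => le_trans ?_ hcB⟩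
    have ha1 : ∀ j, (1 : ℝ) ≤ a j := fun j => by exact_mod_cast ha j
    have h1 : c i * a i ≤ ∑ j, c j * (a j : ℝ) :=
      Finset.single_le_sum (f := fun j => c j * (a j : ℝ))
        (fun j _ => mul_nonneg (hc j) (zero_le_one.trans (ha1 j))) (Finset.mem_univ i)
    nlinarith [hc i, ha1 i]
  obtain ⟨c, ⟨hc, hcS, hcx, hcB⟩, hmin⟩ := hKcompact.exists_isMinOn
    ⟨e, he, heS, fun m => by rw [hxe, pairing_sum], le_rfl⟩ hcont.continuousOn
  refine ⟨c, hc, hcS, eq_of_forall_pairing_eq fun m => by rw [pairing_sum, hcx m], ?_⟩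
  intro d hd hdS hxd
  by_cases hdB : ∑ i, d i * (a i : ℝ) ≤ B
  · exact hmin ⟨hd, hdS, fun m => by rw [hxd, pairing_sum], hdB⟩
  · exact hcB.trans (not_le.mp hdB).le

/-- Positive coordinates stay positive for small `ε`, and the vanishing ones move in the direction
`g i ≥ 0`. -/
lemma exists_pos_smul_le {ι : Type*} [Finite ι] (c g : ι → ℝ) (hc : ∀ i, 0 ≤ c i)
    (hg : ∀ i, c i = 0 → 0 ≤ g i) : ∃ ε : ℝ, 0 < ε ∧ ∀ i, 0 ≤ c i + ε * g i := by
  have h : ∀ᶠ ε : ℝ in nhdsWithin 0 (Set.Ioi 0), ∀ i, 0 ≤ c i + ε * g i := by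
    refine Filter.eventually_all.mpr fun i => ?_
    rcases (hc i).eq_or_lt with h0 | hpos
    · filter_upwards [self_mem_nhdsWithin] with ε hε
      rw [← h0, zero_add]
      exact mul_nonneg (le_of_lt hε) (hg i h0.symm)
    · have : Filter.Tendsto (fun ε : ℝ => c i + ε * g i) (nhds 0) (nhds (c i + 0 * g i)) :=
        Continuous.tendsto (by fun_prop) 0
      rw [zero_mul, add_zero] at this
      exact ((this.eventually (lt_mem_nhds hpos)).filter_mono nhdsWithin_le_nhds).mono
        fun ε hε => le_of_lt hε
  obtain ⟨ε, hε, hε0⟩ := (h.and self_mem_nhdsWithin).exists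
  exact ⟨ε, hε0, hε⟩

/-- The cells of a cone cover it. -/
lemma exists_isCell_of_mem (ha : ∀ i, 0 < a i) (hσ : σ ∈ Δ.cones) {x : RealSpace N} (hx : x ∈ σ) :
    ∃ S, Δ.IsCell a σ S ∧ x ∈ gen Δ.rayVec S := by
  classical
  rw [← Δ.gen_raysOf hσ] at hx
  obtain ⟨c, hc, hcσ, hxc, hmin⟩ := exists_min_heights ha hx
  -- Farkas' lemma is applied to the lifted rays `w i` of `σ`, to the opposites `-w i` for the `i`
  -- in the support of the minimal representation, and to the downward vector `(0, -1)`.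
  let w : Δ.rays → N × ℤ := fun i => (Δ.rayVec i, a i)
  let R : Finset Δ.rays := Finset.univ.filter fun i => i ∈ Δ.raysOf σ
  let T : Finset Δ.rays := Finset.univ.filter fun i => c i ≠ 0
  have hR : ∀ {i}, i ∈ R ↔ i ∈ Δ.raysOf σ := by simp [R]
  have hT : ∀ {i}, i ∈ T ↔ c i ≠ 0 := by simp [T]
  let l : List (N × ℤ) := R.toList.map w ++ T.toList.map fun i => -w i
  rcases farkas l.length l rfl ((0 : N), (-1 : ℤ)) with ⟨p, hp, hpb⟩ | ⟨f, hf, hfb⟩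
  · exfalso
    have hcl : ∀ y ∈ AddSubmonoid.closure {y | y ∈ l}, ∃ g : Δ.rays → ℤ,
        (∀ i, i ∉ Δ.raysOf σ → g i = 0) ∧ (∀ i, c i = 0 → 0 ≤ g i) ∧ y = ∑ i, g i • w i := by
      intro y hy
      induction hy using AddSubmonoid.closure_induction with
      | mem y hy =>
        rcases List.mem_append.mp hy with hy | hy
        · obtain ⟨i, hi, rfl⟩ := List.mem_map.mp hy
          rw [Finset.mem_toList, hR] at hi
          refine ⟨Pi.single i 1, fun k hk => Pi.single_eq_of_ne (fun h : k = i => hk (h ▸ hi)) _,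
            fun k _ => ?_, ?_⟩
          · by_cases h : k = i
            · subst h; simp
            · simp [Pi.single_eq_of_ne h]
          · rw [Finset.sum_eq_single i (fun k _ h => by simp [Pi.single_eq_of_ne h]) (by simp)]
            simp
        · obtain ⟨i, hi, rfl⟩ := List.mem_map.mp hy
          rw [Finset.mem_toList, hT] at hi
          refine ⟨Pi.single i (-1), fun k hk => Pi.single_eq_of_ne
            (fun h : k = i => hi (h ▸ hcσ k hk)) _, fun k hk => ?_, ?_⟩
          · rw [Pi.single_eq_of_ne (fun h : k = i => hi (h ▸ hk))]
          · rw [Finset.sum_eq_single i (fun k _ h => by simp [Pi.single_eq_of_ne h]) (by simp)]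
            simp
      | zero => exact ⟨0, by simp, by simp, by simp⟩
      | add x y _ _ hx hy =>
        obtain ⟨g, h1, h2, rfl⟩ := hx
        obtain ⟨g', h1', h2', rfl⟩ := hy
        exact ⟨g + g', fun i hi => by simp [h1 i hi, h1' i hi],
          fun i hi => add_nonneg (h2 i hi) (h2' i hi), by simp [add_smul, Finset.sum_add_distrib]⟩
    -- This relation among the rays has height `-p < 0` and is nonnegative where `c` vanishes.
    -- Moving `c` slightly along it represents the same `x` at smaller height.
    obtain ⟨g, hg1, hg2, hsum⟩ := hcl _ hpb
    have hs1 : ∑ i, g i • Δ.rayVec i = 0 := by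
      have := congrArg Prod.fst hsum
      simpa [w, Prod.fst_sum] using this.symm
    have hs2 : ∑ i, g i * a i = -p := by
      have := congrArg Prod.snd hsum
      simpa [w, Prod.snd_sum] using this.symm
    obtain ⟨ε, hε, hεc⟩ := exists_pos_smul_le c (fun i => (g i : ℝ)) hc
      fun i hi => by exact_mod_cast hg2 i hi
    have hlt := hmin (fun i => c i + ε * g i) hεc
      (fun i hi => by simp [hcσ i hi, hg1 i hi]) (by
        refine eq_of_forall_pairing_eq fun m => ?_
        rw [hxc, pairing_sum, pairing_sum]
        have h0 : ∑ i, (g i : ℝ) * (m (Δ.rayVec i) : ℝ) = 0 := by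
          have := congrArg m hs1
          rw [map_sum, map_zero] at this
          simp only [map_smul, smul_eq_mul] at this
          exact_mod_cast this
        simp only [add_mul, Finset.sum_add_distrib, mul_assoc]
        rw [← Finset.mul_sum, h0, mul_zero, add_zero])
    have h0 : ∑ i, (g i : ℝ) * (a i : ℝ) = -p := by exact_mod_cast hs2
    simp only [add_mul, Finset.sum_add_distrib, mul_assoc] at hlt
    rw [← Finset.mul_sum, h0] at hlt
    have hp' : (0 : ℝ) < p := by exact_mod_cast hp
    nlinarith [mul_pos hε hp']
  · let m : DualLattice N := -(f ∘ₗ LinearMap.inl ℤ N ℤ)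
    have hfw : ∀ i, f (w i) = f (0, 1) * a i - m (Δ.rayVec i) := by
      intro i
      have : w i = (Δ.rayVec i, 0) + a i • ((0 : N), (1 : ℤ)) := by simp [w]
      rw [this, map_add, map_smul]
      simp [m]
      ring
    have ht : 0 < f (0, 1) := by
      have : ((0 : N), (-1 : ℤ)) = -(0, 1) := by simp
      rw [this, map_neg] at hfb
      linarith
    have hle : ∀ i ∈ Δ.raysOf σ, m (Δ.rayVec i) ≤ f (0, 1) * a i := by
      intro i hi
      have h1 := hf (w i) (List.mem_append_left _
        (List.mem_map.mpr ⟨i, Finset.mem_toList.mpr (hR.mpr hi), rfl⟩))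
      rw [hfw] at h1
      linarith
    refine ⟨{i ∈ Δ.raysOf σ | m (Δ.rayVec i) = f (0, 1) * a i},
      ⟨m, f (0, 1), fun i hi => hi.1, ht, fun i hi => hi.2,
        fun i hi hi' => lt_of_le_of_ne (hle i hi) fun h => hi' ⟨hi, h⟩⟩, ?_⟩
    refine mem_gen_iff.mpr ⟨c, hc, fun i hi => ?_, hxc⟩
    by_contra h0
    have hiσ : i ∈ Δ.raysOf σ := by_contra fun h => h0 (hcσ i h)
    refine hi ⟨hiσ, le_antisymm (hle i hiσ) ?_⟩
    have h1 := hf (-w i) (List.mem_append_right _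
      (List.mem_map.mpr ⟨i, Finset.mem_toList.mpr (hT.mpr h0), rfl⟩))
    rw [map_neg, hfw] at h1
    linarith

end Cells

end Fan

end Toric

/-! ### The simplicial subdivision and its strict support function -/

namespace Toric

/-- A cone is lattice simplicial if it is generated by independent lattice vectors. -/
def IsLatticeSimplicial {N : Type u} [AddCommGroup N] (σ : PointedCone ℝ (RealSpace N)) : Prop :=
  ∃ (ι : Type u) (_ : Fintype ι) (v : ι → N) (S : Set ι), DualIndep v S ∧ gen v S = σ

namespace Fan

/-- A support function of `Δ'` that is strictly concave over the cones of `Δ`: it is given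
by `m τ` on each cone `τ` of `Δ'`, and `c σ τ` is an extension from `τ` to a cone `σ` of `Δ` that
contains `τ`, which lies below the support function away from `τ`. -/
structure StrictSupport {N : Type u} [AddCommGroup N] (Δ' Δ : Fan N) where
  m : Δ'.Cone → DualLattice N
  c : Δ.Cone → Δ'.Cone → DualLattice N
  m_eq : ∀ τ τ' : Δ'.Cone, ∀ x ∈ τ.1, x ∈ τ'.1 → pairing (m τ) x = pairing (m τ') x
  c_eq : ∀ (σ : Δ.Cone) (τ : Δ'.Cone), τ.1 ≤ σ.1 → ∀ x ∈ τ.1, pairing (c σ τ) x = pairing (m τ) x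
  c_le : ∀ (σ : Δ.Cone) (τ τ' : Δ'.Cone), τ.1 ≤ σ.1 → τ'.1 ≤ σ.1 → ∀ x ∈ τ.1,
    pairing (c σ τ') x ≤ pairing (m τ) x
  mem_of_eq : ∀ (σ : Δ.Cone) (τ τ' : Δ'.Cone), τ.1 ≤ σ.1 → τ'.1 ≤ σ.1 → ∀ x ∈ τ.1,
    pairing (c σ τ') x = pairing (m τ) x → x ∈ τ'.1

lemma gen_rayVec_singleton {N : Type u} [AddCommGroup N] (Δ : Fan N) (i : Δ.rays) :
    gen Δ.rayVec {i} = i.1 := by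
  rw [gen, Set.image_singleton, Δ.hull_rayVec]

section Refinement

variable {N : Type u} [AddCommGroup N] [Module.Free ℤ N] [Module.Finite ℤ N] (Δ : Fan N)
  (a : Δ.rays → ℤ) (ha : ∀ i, 0 < a i)
  (hgen : ∀ {σ S}, Δ.IsCell a σ S → DualIndep Δ.rayVec S)

/-- The fan of the cells that generic heights induce. -/
def cellFan : Fan N where
  cones := {τ | ∃ σ ∈ Δ.cones, ∃ S, Δ.IsCell a σ S ∧ gen Δ.rayVec S = τ}
  finite := (Set.finite_range (gen Δ.rayVec)).subset (by
    rintro _ ⟨σ, -, S, -, rfl⟩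
    exact ⟨S, rfl⟩)
  nonempty := by
    obtain ⟨σ, hσ⟩ := Δ.nonempty
    obtain ⟨S, hS, -⟩ := exists_isCell_of_mem ha hσ (zero_mem σ)
    exact ⟨_, σ, hσ, S, hS, rfl⟩
  rational := by
    rintro _ ⟨σ, -, S, -, rfl⟩
    exact isRationalPolyhedral_gen _ _
  salient := by
    rintro _ ⟨σ, -, S, hS, rfl⟩
    exact (hgen hS).salient
  face_mem := by
    rintro _ ⟨σ, hσ, S, hS, rfl⟩ τ hτ
    exact ⟨σ, hσ, _, hS.mono (hgen hS) fun i hi => hi.1, (eq_gen_of_isFaceOf hτ).symm⟩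
  inf_isFaceOf := by
    rintro _ ⟨σ, hσ, S, hS, rfl⟩ _ ⟨τ, hτ, T, hT, rfl⟩
    have : gen Δ.rayVec S ⊓ gen Δ.rayVec T = gen Δ.rayVec (S ∩ T) :=
      le_antisymm (fun x hx => hS.support_subset_of_mem hgen hσ hτ hT hx.1 hx.2)
        (le_inf (gen_mono _ Set.inter_subset_left) (gen_mono _ Set.inter_subset_right))
    rw [this]
    exact (hgen hS).gen_isFaceOf Set.inter_subset_left

lemma cellFan_isSubdivision : (Δ.cellFan a ha hgen).IsSubdivision Δ where
  exists_le := by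
    rintro _ ⟨σ, hσ, S, hS, rfl⟩
    exact ⟨σ, hσ, hS.le⟩
  support_eq := by
    ext x
    simp only [support, Set.mem_iUnion]
    constructor
    · rintro ⟨_, ⟨σ, hσ, S, hS, rfl⟩, hx⟩
      exact ⟨σ, hσ, hS.le hx⟩
    · rintro ⟨σ, hσ, hx⟩
      obtain ⟨S, hS, hxS⟩ := exists_isCell_of_mem ha hσ hx
      exact ⟨_, ⟨σ, hσ, S, hS, rfl⟩, hxS⟩

lemma cellFan_isLatticeSimplicial {τ : PointedCone ℝ (RealSpace N)}
    (hτ : τ ∈ (Δ.cellFan a ha hgen).cones) : IsLatticeSimplicial τ := by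
  obtain ⟨σ, hσ, S, hS, rfl⟩ := hτ
  exact ⟨_, inferInstance, Δ.rayVec, S, hgen hS, rfl⟩

/-- A one-dimensional cell has exactly one ray vector, by independence. Conversely a ray of `Δ` is a
cone of `Δ`, and its cell through the ray vector is all of it. -/
lemma cellFan_rays : (Δ.cellFan a ha hgen).rays = Δ.rays := by
  classical
  ext τ
  constructor
  · rintro ⟨⟨σ, hσ, S, hS, rfl⟩, hd⟩
    have hli := (hgen hS).linearIndepOn
    have hspan : Submodule.span ℝ ((gen Δ.rayVec S : PointedCone ℝ (RealSpace N)) :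
        Set (RealSpace N)) = Submodule.span ℝ ((fun i => latticeVec (Δ.rayVec i)) '' S) :=
      Submodule.span_eq_of_le _ (fun x hx => PointedCone.hull_le_span ℝ _ hx)
        (Submodule.span_mono PointedCone.subset_hull)
    rw [coneDim, hspan, Set.image_eq_range, finrank_span_eq_card hli, Fintype.card_eq_one_iff] at hd
    obtain ⟨i, hi⟩ := hd
    have hSi : S = {i.1} := Set.eq_singleton_iff_unique_mem.mpr
      ⟨i.2, fun j hj => congrArg Subtype.val (hi ⟨j, hj⟩)⟩
    rw [hSi, gen_rayVec_singleton]
    exact i.1.2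
  · intro hτ
    let i : Δ.rays := ⟨τ, hτ⟩
    obtain ⟨S, hS, hxS⟩ := exists_isCell_of_mem ha hτ.1
      (show latticeVec (Δ.rayVec i) ∈ τ by
        have : latticeVec (Δ.rayVec i) ∈ PointedCone.hull ℝ {latticeVec (Δ.rayVec i)} :=
          PointedCone.subset_hull rfl
        rwa [Δ.hull_rayVec i] at this)
    refine ⟨⟨τ, hτ.1, S, hS, le_antisymm hS.le ?_⟩, hτ.2⟩
    change i.1 ≤ _
    rw [← Δ.hull_rayVec i]
    exact Submodule.span_le.mpr (Set.singleton_subset_iff.mpr hxS)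

/-- The product of the finitely many values of `t` serves as a common one. Pairs with `τ` not inside
`σ` carry the irrelevant values `m = 0`, `t = 1`. -/
lemma exists_common_cells : ∃ (T : ℤ) (c : Δ.Cone → (Δ.cellFan a ha hgen).Cone → DualLattice N),
    ∀ σ τ, τ.1 ≤ σ.1 → ∃ S, Δ.IsCellWith a σ.1 S (c σ τ) T ∧ gen Δ.rayVec S = τ.1 := by
  classical
  have h : ∀ (σ : Δ.Cone) (τ : (Δ.cellFan a ha hgen).Cone), ∃ (m : DualLattice N) (t : ℤ), 0 < t ∧
      (τ.1 ≤ σ.1 → ∃ S, Δ.IsCellWith a σ.1 S m t ∧ gen Δ.rayVec S = τ.1) := by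
    intro σ τ
    by_cases hτσ : τ.1 ≤ σ.1
    · obtain ⟨σ', hσ', S, hS, hSτ⟩ := τ.2
      obtain ⟨m, t, hm⟩ := hS.of_gen_le ha σ.2 hσ' (hSτ ▸ hτσ)
      exact ⟨m, t, hm.pos, fun _ => ⟨S, hm, hSτ⟩⟩
    · exact ⟨0, 1, one_pos, fun h => absurd h hτσ⟩
  choose m t ht hm using h
  have : Finite Δ.Cone := Δ.finite.to_subtype
  have : Finite (Δ.cellFan a ha hgen).Cone := (Δ.cellFan a ha hgen).finite.to_subtype
  have : Fintype (Δ.Cone × (Δ.cellFan a ha hgen).Cone) := Fintype.ofFinite _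
  let T : ℤ := ∏ p : Δ.Cone × (Δ.cellFan a ha hgen).Cone, t p.1 p.2
  have hT : 0 < T := Finset.prod_pos fun p _ => ht p.1 p.2
  have hdvd : ∀ σ τ, ∃ q : ℤ, T = t σ τ * q := fun σ τ =>
    Finset.dvd_prod_of_mem (fun p : Δ.Cone × (Δ.cellFan a ha hgen).Cone => t p.1 p.2)
      (Finset.mem_univ (σ, τ))
  choose q hq using hdvd
  refine ⟨T, fun σ τ => q σ τ • m σ τ, fun σ τ hτσ => ?_⟩
  obtain ⟨S, hS, hSτ⟩ := hm σ τ hτσ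
  have hq0 : 0 < q σ τ := pos_of_mul_pos_right (hq σ τ ▸ hT) (ht σ τ).le
  exact ⟨S, hq σ τ ▸ hS.scale hq0, hSτ⟩

/-- With a common `T`, the character of a cell equals on that cell `T` times the least height, so
characters agree on overlaps. `c_le` is weak duality and `mem_of_eq` is complementary slackness. -/
lemma exists_strictSupport : Nonempty (StrictSupport (Δ.cellFan a ha hgen) Δ) := by
  obtain ⟨T, c, hc⟩ := Δ.exists_common_cells a ha hgen
  have hsub := Δ.cellFan_isSubdivision a ha hgen
  have hceq : ∀ (σ : Δ.Cone) (τ : (Δ.cellFan a ha hgen).Cone), τ.1 ≤ σ.1 → ∀ x ∈ τ.1,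
      pairing (c σ τ) x = pairing (c (hsub.over τ) τ) x := by
    intro σ τ hτσ x hx
    obtain ⟨S, hS, hSτ⟩ := hc σ τ hτσ
    obtain ⟨S', hS', hSτ'⟩ := hc _ τ (hsub.le_over τ)
    exact hS.pairing_eq_pairing hgen σ.2 (hsub.over τ).2 hS' (hSτ ▸ hx) (hSτ' ▸ hx)
  refine ⟨{ m := fun τ => c (hsub.over τ) τ, c := c, m_eq := ?_, c_eq := hceq, c_le := ?_,
            mem_of_eq := ?_ }⟩
  · intro τ τ' x hx hx'
    obtain ⟨S, hS, hSτ⟩ := hc _ τ (hsub.le_over τ)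
    obtain ⟨S', hS', hSτ'⟩ := hc _ τ' (hsub.le_over τ')
    exact hS.pairing_eq_pairing hgen (hsub.over τ).2 (hsub.over τ').2 hS' (hSτ ▸ hx) (hSτ' ▸ hx')
  · intro σ τ τ' hτ hτ' x hx
    rw [← hceq σ τ hτ x hx]
    obtain ⟨S, hS, hSτ⟩ := hc σ τ hτ
    obtain ⟨S', hS', hSτ'⟩ := hc σ τ' hτ'
    obtain ⟨d, hd, hdS, rfl⟩ := mem_gen_iff.mp (hSτ ▸ hx)
    rw [hS.pairing_eq hdS]
    exact hS'.pairing_le hd fun i hi => hdS i fun h => hi (hS.subset h)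
  · intro σ τ τ' hτ hτ' x hx heq
    rw [← hceq σ τ hτ x hx] at heq
    obtain ⟨S, hS, hSτ⟩ := hc σ τ hτ
    obtain ⟨S', hS', hSτ'⟩ := hc σ τ' hτ'
    obtain ⟨d, hd, hdS, rfl⟩ := mem_gen_iff.mp (hSτ ▸ hx)
    rw [hS.pairing_eq hdS] at heq
    rw [← hSτ']
    exact mem_gen_iff.mpr ⟨d, hd, fun i hi => hS'.support_subset hd
      (fun i hi => hdS i fun h => hi (hS.subset h)) heq.ge hi, rfl⟩

end Refinement

/-- Every fan has a simplicial subdivision with the same rays and a support function that is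
strictly concave over the cones of the fan. -/
theorem exists_simplicial_subdivision {N : Type u} [AddCommGroup N] [Module.Free ℤ N]
    [Module.Finite ℤ N] (Δ : Fan N) : ∃ Δ' : Fan N, Δ'.IsSubdivision Δ ∧
      (∀ τ ∈ Δ'.cones, IsLatticeSimplicial τ) ∧ Nonempty (StrictSupport Δ' Δ) ∧
      Δ'.rays = Δ.rays := by
  obtain ⟨a, ha, hind⟩ := exists_generic_heights Δ.rayVec
  have hgen : ∀ {σ S}, Δ.IsCell a σ S → DualIndep Δ.rayVec S := by
    rintro σ S ⟨m, t, h⟩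
    exact hind S m t h.pos.ne' h.eq
  exact ⟨Δ.cellFan a ha hgen, Δ.cellFan_isSubdivision a ha hgen,
    fun τ hτ => Δ.cellFan_isLatticeSimplicial a ha hgen hτ, Δ.exists_strictSupport a ha hgen,
    Δ.cellFan_rays a ha hgen⟩

end Fan

end Toric

/-! ### Normality of retracts, and height one primes by norms -/

section RingLemmas

/-- A retract of an integrally closed domain is integrally closed. -/
lemma IsIntegrallyClosed.of_retraction {A B : Type*} [CommRing A] [IsDomain A] [CommRing B]
    [IsDomain B] [Algebra A B] [FaithfulSMul A B] [IsIntegrallyClosed B] (π : B →ₗ[A] A)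
    (hπ : π 1 = 1) : IsIntegrallyClosed A := by
  let K := FractionRing A
  let L := FractionRing B
  have hinj : Function.Injective (algebraMap A B) := FaithfulSMul.algebraMap_injective A B
  let φ : K →+* L := IsFractionRing.map hinj
  have hφ : ∀ a : A, φ (algebraMap A K a) = algebraMap B L (algebraMap A B a) := fun a =>
    IsLocalization.map_eq _ a
  rw [isIntegrallyClosed_iff K]
  intro x hx
  have hx' : IsIntegral B (φ x) := by
    obtain ⟨p, hp, hpx⟩ := hx
    refine ⟨p.map (algebraMap A B), hp.map _, ?_⟩
    rw [Polynomial.eval₂_map]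
    have : (algebraMap B L).comp (algebraMap A B) = φ.comp (algebraMap A K) := by
      ext a
      exact (hφ a).symm
    rw [this, ← Polynomial.hom_eval₂, hpx, map_zero]
  obtain ⟨y, hy⟩ := IsIntegrallyClosed.isIntegral_iff.mp hx'
  obtain ⟨a, b, hb, rfl⟩ := IsFractionRing.div_surjective (A := A) x
  have hb0 : b ≠ 0 := nonZeroDivisors.ne_zero hb
  -- In the fraction field of `B` the element `a / b` equals `y`, so `b y = a` holds in `B`. The
  -- `A`-linear map `π` turns this into `b π(y) = a`.
  refine ⟨π y, ?_⟩
  have hbK : algebraMap A K b ≠ 0 := by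
    simpa using hb0
  rw [eq_div_iff hbK, ← map_mul]
  congr 1
  have h1 : b • y = algebraMap A B a := by
    apply IsFractionRing.injective B L
    have hbL : algebraMap B L (algebraMap A B b) ≠ 0 := by
      rw [← hφ]
      simpa using hbK
    rw [Algebra.smul_def, map_mul, hy, map_div₀, hφ, hφ, mul_div_cancel₀ _ hbL]
  have h2 := congrArg π h1
  rw [map_smul, Algebra.algebraMap_eq_smul_one, map_smul, hπ, smul_eq_mul, smul_eq_mul, mul_one] at h2
  rw [mul_comm, h2]

/-- Every prime ideal of height one is the radical of a principal ideal. -/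
def HeightOneSetPrincipal (A : Type*) [CommRing A] : Prop :=
  ∀ p : Ideal A, p.IsPrime → p ≠ ⊥ → (∀ q : Ideal A, q.IsPrime → q ≠ ⊥ → q ≤ p → q = p) →
    ∃ f ∈ p, f ≠ 0 ∧ ∀ q : Ideal A, q.IsPrime → f ∈ q → p ≤ q

lemma HeightOneSetPrincipal.of_equiv {A B : Type*} [CommRing A] [CommRing B] (e : A ≃+* B)
    (h : HeightOneSetPrincipal A) : HeightOneSetPrincipal B := by
  intro p hp hp0 hmin
  have hbot : ∀ q : Ideal B, q.comap e = ⊥ → q = ⊥ := by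
    intro q hq
    rw [eq_bot_iff]
    intro x hx
    have : e.symm x ∈ q.comap e := by
      rwa [Ideal.mem_comap, RingEquiv.apply_symm_apply]
    rw [hq, Ideal.mem_bot] at this
    simpa using this
  obtain ⟨f, hf, hf0, hfq⟩ := h (p.comap e) inferInstance (fun h0 => hp0 (hbot p h0)) (by
    intro q hq hq0 hqp
    have h1 := hmin (q.comap e.symm) inferInstance (fun h0 => hq0 (by
      rw [eq_bot_iff]
      intro x hx
      have : e x ∈ q.comap e.symm := by simpa [Ideal.mem_comap] using hx
      rw [h0, Ideal.mem_bot] at this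
      simpa using this)) (fun x hx => by
        have := hqp (Ideal.mem_comap.mp hx)
        rwa [Ideal.mem_comap, RingEquiv.apply_symm_apply] at this)
    rw [← h1]
    ext x
    simp [Ideal.mem_comap])
  refine ⟨e f, hf, by simpa using hf0, fun q hq hfq' => ?_⟩
  intro x hx
  have := hfq (q.comap e) inferInstance hfq' (show e.symm x ∈ p.comap e by
    rwa [Ideal.mem_comap, RingEquiv.apply_symm_apply])
  rwa [Ideal.mem_comap, RingEquiv.apply_symm_apply] at this

attribute [local instance] FractionRing.liftAlgebra

/-- Height one primes of a normal domain with a finite factorial extension are set-theoretically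
principal: a norm of a prime element of the extension generates them up to radical. -/
lemma HeightOneSetPrincipal.of_finite {A B : Type*} [CommRing A] [IsDomain A]
    [IsIntegrallyClosed A] [CommRing B] [IsDomain B] [UniqueFactorizationMonoid B] [Algebra A B]
    [FaithfulSMul A B] [Module.Finite A B] : HeightOneSetPrincipal A := by
  intro p hp hp0 hmin
  have hinj : Function.Injective (algebraMap A B) := FaithfulSMul.algebraMap_injective A B
  have : Module.IsTorsionFree A B := Module.isTorsionFree_iff_faithfulSMul.mpr inferInstance
  have hAB : Algebra.IsIntegral A B := inferInstance
  obtain ⟨Q, hQ, hQp⟩ := Ideal.exists_ideal_over_prime_of_isIntegral_of_isDomain (S := B) p (by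
    rw [(RingHom.injective_iff_ker_eq_bot _).mp hinj]; exact bot_le)
  have hQ0 : Q ≠ ⊥ := by
    rintro rfl
    apply hp0
    rw [← hQp, eq_bot_iff]
    intro x hx
    exact hinj (by simpa [Ideal.mem_comap] using hx)
  -- The contraction of `(g)` is nonzero by integrality and lies in `p`, so it equals `p` by
  -- minimality.
  obtain ⟨g, hgQ, hg⟩ := hQ.exists_mem_prime_of_ne_bot hQ0
  have hgp : (Ideal.span {g}).comap (algebraMap A B) = p := by
    have hgprime : (Ideal.span {g}).IsPrime := (Ideal.span_singleton_prime hg.ne_zero).mpr hg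
    refine hmin _ inferInstance ?_ ?_
    · exact Ideal.comap_ne_bot_of_integral_mem hg.ne_zero (Ideal.mem_span_singleton_self g)
        (hAB.isIntegral g)
    · rw [← hQp]
      exact Ideal.comap_mono ((Ideal.span_singleton_le_iff_mem _).mpr hgQ)
  have : FiniteDimensional (FractionRing A) (FractionRing B) :=
    .of_isLocalization A B (nonZeroDivisors A)
  refine ⟨Algebra.intNorm A B g, ?_, Algebra.intNorm_ne_zero.mpr hg.ne_zero, fun q hq hgq a ha => ?_⟩
  · rw [← hgp, Ideal.mem_comap, Ideal.mem_span_singleton]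
    exact Algebra.dvd_algebraMap_intNorm_self A B g
  · rw [← hgp, Ideal.mem_comap, Ideal.mem_span_singleton] at ha
    obtain ⟨c, hc⟩ := ha
    -- The norm of `a ∈ p` is a power of `a`. As `g` divides `a` in `B`, that power is a multiple of
    -- the norm of `g`.
    have hnorm : Algebra.intNorm A B (algebraMap A B a) =
        a ^ Module.finrank (FractionRing A) (FractionRing B) := by
      apply IsFractionRing.injective A (FractionRing A)
      rw [Algebra.algebraMap_intNorm_fractionRing, ← IsScalarTower.algebraMap_apply,
        IsScalarTower.algebraMap_apply A (FractionRing A) (FractionRing B),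
        Algebra.norm_algebraMap, map_pow]
    rw [hc, map_mul] at hnorm
    refine hq.mem_of_pow_mem (Module.finrank (FractionRing A) (FractionRing B)) ?_
    rw [← hnorm]
    exact Ideal.mul_mem_right _ _ hgq

end RingLemmas

/-! ### Gordan's lemma and monoid algebras of orthants -/

section MonoidAlgebras

/-- **Gordan's lemma** for the solutions of finitely many inequalities in a finitely generated
abelian group. -/
lemma AddSubmonoid.fg_of_forall_nonneg {M J : Type*} [AddCommGroup M] [Module.Finite ℤ M] [Finite J]
    (f : J → M →+ ℤ) (P : AddSubmonoid M) (hP : ∀ x, x ∈ P ↔ ∀ j, 0 ≤ f j x) : P.FG := by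
  obtain ⟨n, g, hg⟩ := Module.Finite.exists_fin' ℤ M
  have : Fintype J := Fintype.ofFinite J
  let I := (Fin n ⊕ Fin n) ⊕ J
  -- Two blocks of coordinates are the positive and negative parts of coefficients on generators of
  -- `M`; the third consists of slack variables. `F` records the values of the `f j` and `G` the
  -- slacks, so `P` is the image of the equalizer of `F` and `G`, which is finitely generated.
  let φ : (I → ℕ) →+ M :=
    { toFun := fun x => g fun i => (x (.inl (.inl i)) : ℤ) - x (.inl (.inr i))
      map_zero' := by
        simp only [Pi.zero_apply, Nat.cast_zero, sub_zero]
        exact map_zero g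
      map_add' := fun x y => by
        rw [← map_add]
        congr 1
        funext i
        simp only [Pi.add_apply, Nat.cast_add]
        ring }
  let F : (I → ℕ) →+ (J → ℤ) := (AddMonoidHom.mk' (fun x j => f j x) fun x y => by
    funext j; simp : M →+ (J → ℤ)).comp φ
  let G : (I → ℕ) →+ (J → ℤ) :=
    { toFun := fun x j => (x (.inr j) : ℤ)
      map_zero' := by funext j; simp
      map_add' := fun x y => by funext j; simp }
  have hmap : (F.eqLocusM G).map φ = P := by
    ext y
    rw [AddSubmonoid.mem_map, hP]
    constructor
    · rintro ⟨x, hx, rfl⟩ j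
      have : f j (φ x) = (x (.inr j) : ℤ) := congrFun hx j
      rw [this]
      exact Int.natCast_nonneg _
    · intro hy
      obtain ⟨z, rfl⟩ := hg y
      refine ⟨Sum.elim (Sum.elim (fun i => (z i).toNat) fun i => (-z i).toNat)
        fun j => (f j (g z)).toNat, ?_, ?_⟩
      all_goals
        have hφ : φ (Sum.elim (Sum.elim (fun i => (z i).toNat) fun i => (-z i).toNat)
          fun j => (f j (g z)).toNat) = g z := by
            change g _ = g z
            congr 1
            funext i
            simp only [Sum.elim_inl, Sum.elim_inr]
            omega
      · change F _ = G _
        funext j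
        change f j (φ _) = _
        rw [hφ]
        change _ = (((f j (g z)).toNat : ℕ) : ℤ)
        rw [Int.toNat_of_nonneg (hy j)]
      · exact hφ
  rw [← hmap]
  exact (AddSubmonoid.fg_eqLocusM F G).map φ

variable (k : Type*) [Field k]

/-- If `N` arises from `M` by inverting `w`, then `k[N]` is the localization of `k[M]` at the
monomial of `w`. -/
lemma AddMonoidAlgebra.isLocalization_away {M N : Type*} [AddCommMonoid M] [AddCommMonoid N]
    (h : M →+ N) (hinj : Function.Injective h) (w : M) (w' : N) (hw : h w + w' = 0)
    (hu : ∀ u : N, ∃ (n : ℕ) (x : M), u + n • h w = h x) :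
    letI := (AddMonoidAlgebra.mapDomainRingHom k h).toAlgebra
    IsLocalization.Away (AddMonoidAlgebra.single w (1 : k)) (AddMonoidAlgebra k N) := by
  let := (AddMonoidAlgebra.mapDomainRingHom k h).toAlgebra
  have halg : ∀ x, algebraMap (AddMonoidAlgebra k M) (AddMonoidAlgebra k N) x =
      AddMonoidAlgebra.mapDomainRingHom k h x := fun _ => rfl
  have hpow : ∀ n : ℕ, algebraMap (AddMonoidAlgebra k M) (AddMonoidAlgebra k N)
      (AddMonoidAlgebra.single w (1 : k) ^ n) = AddMonoidAlgebra.single (n • h w) (1 : k) := by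
    intro n
    rw [halg, map_pow]
    simp [AddMonoidAlgebra.single_pow]
  refine { map_units := ?_, surj := ?_, exists_of_eq := ?_ }
  · rintro ⟨_, n, rfl⟩
    change IsUnit (algebraMap (AddMonoidAlgebra k M) (AddMonoidAlgebra k N)
      (AddMonoidAlgebra.single w (1 : k) ^ n))
    rw [hpow]
    refine IsUnit.of_mul_eq_one (AddMonoidAlgebra.single (n • w') (1 : k)) ?_
    rw [AddMonoidAlgebra.single_mul_single, ← nsmul_add, one_mul, hw, nsmul_zero]
    rfl
  · suffices H : ∀ z : AddMonoidAlgebra k N, ∃ (n : ℕ) (x : AddMonoidAlgebra k M),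
        z * algebraMap _ _ (AddMonoidAlgebra.single w (1 : k) ^ n) = algebraMap _ _ x by
      intro z
      obtain ⟨n, x, hx⟩ := H z
      exact ⟨(x, ⟨_, n, rfl⟩), hx⟩
    intro z
    induction z using AddMonoidAlgebra.induction_linear with
    | zero => exact ⟨0, 0, by simp⟩
    | add f g hf hg =>
      obtain ⟨n, x, hx⟩ := hf
      obtain ⟨n', x', hx'⟩ := hg
      refine ⟨n + n', x * AddMonoidAlgebra.single w (1 : k) ^ n' +
        x' * AddMonoidAlgebra.single w (1 : k) ^ n, ?_⟩
      rw [pow_add, map_add, map_mul, map_mul, map_mul, ← hx, ← hx']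
      ring
    | single u c =>
      obtain ⟨n, x, hn⟩ := hu u
      refine ⟨n, AddMonoidAlgebra.single x c, ?_⟩
      rw [hpow, AddMonoidAlgebra.single_mul_single, mul_one, halg, hn]
      simp
  · intro x y hxy
    exact ⟨1, by rw [AddMonoidAlgebra.mapDomain_injective hinj hxy]⟩

/-- The vectors of `ℤ^κ` whose coordinates in `J` are nonnegative. -/
def partialOrthant (κ : Type*) (J : Set κ) : AddSubmonoid (κ → ℤ) where
  carrier := {x | ∀ j ∈ J, 0 ≤ x j}
  zero_mem' := by simp
  add_mem' hx hy j hj := add_nonneg (hx j hj) (hy j hj)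

variable {κ : Type*} (J : Set κ)

instance : IsDomain (AddMonoidAlgebra k (partialOrthant κ J)) := by
  have : NoZeroDivisors (AddMonoidAlgebra k (κ → ℤ)) := inferInstance
  have hinj : Function.Injective
      (AddMonoidAlgebra.mapDomainRingHom k (partialOrthant κ J).subtype) :=
    AddMonoidAlgebra.mapDomain_injective Subtype.val_injective
  exact hinj.isDomain _

/-- The ring is the polynomial ring in the variables `κ`, localized at the product `w` of the
variables outside `J`. -/
instance [Finite κ] : UniqueFactorizationMonoid (AddMonoidAlgebra k (partialOrthant κ J)) := by
  classical
  have : Fintype κ := Fintype.ofFinite κ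
  let h : (κ →₀ ℕ) →+ partialOrthant κ J :=
    { toFun := fun x => ⟨fun i => (x i : ℤ), fun j _ => Int.natCast_nonneg _⟩
      map_zero' := by ext; simp
      map_add' := fun x y => by ext; simp }
  have hinj : Function.Injective h := by
    intro x y hxy
    ext i
    have : (x i : ℤ) = y i := congrFun (congrArg Subtype.val hxy) i
    exact_mod_cast this
  let w : κ →₀ ℕ := Finsupp.equivFunOnFinite.symm fun i => if i ∈ J then 0 else 1
  let w' : partialOrthant κ J := ⟨fun i => if i ∈ J then 0 else -1, fun j hj => by simp [hj]⟩
  have hloc := AddMonoidAlgebra.isLocalization_away k h hinj w w' (by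
    ext i
    by_cases hi : i ∈ J <;> simp [h, w, w', hi]) (fun u => by
      -- One exponent that clears the negative coordinates of `u` outside `J` all at once.
      refine ⟨∑ i, (u.1 i).natAbs, Finsupp.equivFunOnFinite.symm fun i =>
        (u.1 i + (∑ i, (u.1 i).natAbs) • (h w).1 i).toNat, ?_⟩
      ext i
      have h1 : (u.1 i).natAbs ≤ ∑ i, (u.1 i).natAbs :=
        Finset.single_le_sum (f := fun i => (u.1 i).natAbs) (fun _ _ => Nat.zero_le _)
          (Finset.mem_univ i)
      have h0 : 0 ≤ u.1 i + (∑ i, (u.1 i).natAbs) • (h w).1 i := by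
        by_cases hi : i ∈ J
        · simpa [h, w, hi] using u.2 i hi
        · have : (h w).1 i = 1 := by simp [h, w, hi]
          rw [this, nsmul_eq_mul, mul_one]
          omega
      change u.1 i + (∑ i, (u.1 i).natAbs) • (h w).1 i = (((u.1 i +
        (∑ i, (u.1 i).natAbs) • (h w).1 i).toNat : ℕ) : ℤ)
      rw [Int.toNat_of_nonneg h0])
  let := (AddMonoidAlgebra.mapDomainRingHom k h).toAlgebra
  have : UniqueFactorizationMonoid (AddMonoidAlgebra k (κ →₀ ℕ)) :=
    inferInstanceAs (UniqueFactorizationMonoid (MvPolynomial κ k))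
  exact UniqueFactorizationMonoid.of_isLocalization
    (Submonoid.powers (AddMonoidAlgebra.single w (1 : k))) _

end MonoidAlgebras

namespace Toric

/-! ### Coordinate rings of cones and coordinates adapted to a simplicial cone -/

section SimplicialRing

variable {N : Type u} [AddCommGroup N]

/-- A character is determined by its values, so the ring embeds into the group algebra of `N → ℤ`,
which has no zero divisors. -/
lemma coordinateRing_isDomain (k : Type u) [Field k]
    (σ : PointedCone ℝ (RealSpace N)) : IsDomain (coordinateRing k σ) := by
  have : NoZeroDivisors (AddMonoidAlgebra k (N → ℤ)) := inferInstance
  let φ : semigroup σ →+ (N → ℤ) :=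
    { toFun := fun m => m.1
      map_zero' := rfl
      map_add' := fun _ _ => rfl }
  have hinj : Function.Injective (AddMonoidAlgebra.mapDomainRingHom k φ) :=
    AddMonoidAlgebra.mapDomain_injective (f := φ) fun a b h =>
      Subtype.ext (DFunLike.coe_injective h)
  exact hinj.isDomain _

variable [Module.Free ℤ N] [Module.Finite ℤ N]

lemma semigroup_fg {σ : PointedCone ℝ (RealSpace N)} (hσ : IsRationalPolyhedral σ) :
    (semigroup σ).FG := by
  obtain ⟨S, hS, rfl⟩ := hσ
  have := hS.to_subtype
  refine AddSubmonoid.fg_of_forall_nonneg (J := S)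
    (fun v => (Module.Dual.eval ℤ N v.1).toAddMonoidHom) _ fun m => ?_
  rw [mem_semigroup_hull]
  simp [Module.Dual.eval]

lemma coordinateRing_finiteType (k : Type u) [Field k] {σ : PointedCone ℝ (RealSpace N)}
    (hσ : IsRationalPolyhedral σ) : Algebra.FiniteType k (coordinateRing k σ) := by
  have : AddMonoid.FG (semigroup σ) := (AddMonoid.fg_iff_addSubmonoid_fg _).mpr (semigroup_fg hσ)
  infer_instance

lemma coordinateRing_isNoetherianRing (k : Type u) [Field k] {σ : PointedCone ℝ (RealSpace N)}
    (hσ : IsRationalPolyhedral σ) : IsNoetherianRing (coordinateRing k σ) :=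
  have := coordinateRing_finiteType k hσ
  Algebra.FiniteType.isNoetherianRing k _

/-- Coordinates of the dual lattice adapted to a simplicial cone. -/
lemma IsLatticeSimplicial.exists_coordinates {σ : PointedCone ℝ (RealSpace N)}
    (hσ : IsLatticeSimplicial σ) : ∃ (κ : Type u) (_ : Fintype κ) (w : κ → N) (J : Set κ) (e : ℕ)
      (f : κ → DualLattice N), 0 < e ∧ (∀ m, m ∈ semigroup σ ↔ ∀ j ∈ J, 0 ≤ m (w j)) ∧
        (∀ m : DualLattice N, (∀ j, m (w j) = 0) → m = 0) ∧
        (∀ j, f j (w j) = e) ∧ ∀ i j, i ≠ j → f j (w i) = 0 := by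
  classical
  obtain ⟨ι, _, v, S, hS, rfl⟩ := hσ
  let b := Module.Free.chooseBasis ℤ N
  -- A basis of `N` is adjoined so that the independent generators of the cone extend, within this
  -- family, to a real basis indexed by `B`.
  let U : ι ⊕ Module.Free.ChooseBasisIndex ℤ N → N := Sum.elim v b
  let V : ι ⊕ Module.Free.ChooseBasisIndex ℤ N → RealSpace N := fun i => latticeVec (U i)
  have hli : LinearIndepOn ℝ V (Sum.inl '' S) := by
    have := hS.linearIndepOn
    rw [LinearIndepOn] at this ⊢
    exact (linearIndependent_equiv' (Equiv.Set.image Sum.inl S Sum.inl_injective) rfl).mp this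
  obtain ⟨B, -, hSB, hspan, hB⟩ := exists_linearIndepOn_extension hli (Set.subset_univ _)
  -- Without dual independence there would be a nonzero integral relation, contrary to real
  -- independence.
  have hind : DualIndep U B := by
    by_contra hnot
    obtain ⟨g, hg0, hgB, hsum⟩ := exists_relation_of_not_dualIndep hnot
    apply hg0
    rw [linearIndepOn_iff''] at hB
    funext i
    by_cases hi : i ∉ B
    · exact hgB i hi
    have := hB (Finset.univ.filter (· ∈ B)) (fun i => (g i : ℝ)) (by simp) (by
      intro i hi
      have : i ∉ B := by simpa using hi
      simp [hgB i this]) (by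
      rw [Finset.sum_filter_of_ne (fun i _ h => by_contra fun hi => h (by simp [hgB i hi]))]
      refine eq_of_forall_pairing_eq fun m => ?_
      rw [pairing_sum, map_zero]
      have h1 := congrArg m hsum
      rw [map_sum, map_zero] at h1
      simp only [map_smul, smul_eq_mul] at h1
      exact_mod_cast h1) i (by simpa using hi)
    exact_mod_cast this
  have hf : ∀ j : B, ∃ f : DualLattice N, 0 < f (U j) ∧ ∀ i ∈ B, i ≠ j.1 → f (U i) = 0 :=
    fun j => hind j.1 j.2
  choose f hf0 hf1 using hf
  -- A common multiple of the values `f j (U j)`, so that all dual characters can be scaled to the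
  -- same value `e`.
  let e : ℕ := ∏ j, (f j (U j)).toNat
  have he : 0 < e := Finset.prod_pos fun j _ => by
    have := hf0 j
    omega
  have hdvd : ∀ j, ∃ q : ℕ, e = (f j (U j)).toNat * q := fun j =>
    Finset.dvd_prod_of_mem (fun j => (f j (U j)).toNat) (Finset.mem_univ j)
  choose q hq using hdvd
  refine ⟨B, inferInstance, fun j => U j, {j | j.1 ∈ Sum.inl '' S}, e, fun j => q j • f j, he,
    fun m => ?_, fun m hm => ?_, fun j => ?_, fun i j hij => ?_⟩
  · rw [gen_eq_hull, mem_semigroup_hull]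
    constructor
    · rintro h ⟨_, hj⟩ ⟨i, hi, rfl⟩
      exact h _ ⟨i, hi, rfl⟩
    · rintro h _ ⟨i, hi, rfl⟩
      exact h ⟨Sum.inl i, hSB ⟨i, hi, rfl⟩⟩ ⟨i, hi, rfl⟩
  · refine b.ext fun i => ?_
    have h1 : V (Sum.inr i) ∈ Submodule.span ℝ (V '' B) := hspan ⟨_, trivial, rfl⟩
    have h2 : Submodule.span ℝ (V '' B) ≤ LinearMap.ker (pairing m) := by
      rw [Submodule.span_le]
      rintro _ ⟨j, hj, rfl⟩
      simp [V, hm ⟨j, hj⟩]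
    have h3 := h2 h1
    rw [LinearMap.mem_ker] at h3
    simp only [V, pairing_latticeVec] at h3
    rw [LinearMap.zero_apply]
    exact_mod_cast h3
  · have h1 : ((f j (U j)).toNat : ℤ) = f j (U j) := Int.toNat_of_nonneg (hf0 j).le
    rw [hq j]
    simp only [LinearMap.smul_apply, nsmul_eq_mul]
    push_cast
    rw [h1]
    ring
  · simp [hf1 j i.1 i.2 fun h => hij (Subtype.ext h)]

end SimplicialRing

end Toric

/-! ### Algebras of saturated submonoids -/

section Retraction

variable (k : Type*) [Field k] {S P : Type*} [AddCommMonoid S] [AddCommMonoid P]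

/-- The inclusion of the algebra of a saturated submonoid has a linear retraction. -/
lemma AddMonoidAlgebra.exists_retraction (θ : S →+ P) (hθ : Function.Injective θ)
    (hsat : ∀ s p, θ s + p ∈ Set.range θ → p ∈ Set.range θ) :
    letI := (AddMonoidAlgebra.mapDomainRingHom k θ).toAlgebra
    ∃ π : AddMonoidAlgebra k P →ₗ[AddMonoidAlgebra k S] AddMonoidAlgebra k S, π 1 = 1 := by
  let := (AddMonoidAlgebra.mapDomainRingHom k θ).toAlgebra
  have hin : ∀ s (c : k), AddMonoidAlgebra.comapDomain θ hθ (AddMonoidAlgebra.single (θ s) c) =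
      AddMonoidAlgebra.single s c := fun s c => by simp
  have hout : ∀ p (c : k), p ∉ Set.range θ →
      AddMonoidAlgebra.comapDomain θ hθ (AddMonoidAlgebra.single p c) = 0 := fun p c hp => by
    ext s
    have : p ≠ θ s := fun h => hp ⟨s, h.symm⟩
    simp [this]
  -- The retraction drops the monomials outside the image of `θ`. By saturation, multiplication by a
  -- monomial of the image never carries such a monomial into the image, so the map is linear.
  refine ⟨{ toFun := AddMonoidAlgebra.comapDomain θ hθ
            map_add' := AddMonoidAlgebra.comapDomain_add _ _
            map_smul' := fun a b => ?_ }, ?_⟩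
  · rw [Algebra.smul_def, RingHom.id_apply, smul_eq_mul]
    change AddMonoidAlgebra.comapDomain θ hθ (AddMonoidAlgebra.mapDomainRingHom k θ a * b) = _
    induction a using AddMonoidAlgebra.induction_linear with
    | zero => simp
    | add a a' h h' => rw [map_add, add_mul, AddMonoidAlgebra.comapDomain_add, h, h', add_mul]
    | single s c =>
      induction b using AddMonoidAlgebra.induction_linear with
      | zero => simp
      | add b b' h h' => rw [mul_add, AddMonoidAlgebra.comapDomain_add, h, h',
          AddMonoidAlgebra.comapDomain_add, mul_add]
      | single p d =>
        have h0 : AddMonoidAlgebra.mapDomainRingHom k θ (AddMonoidAlgebra.single s c) =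
          AddMonoidAlgebra.single (θ s) c := by simp
        rw [h0, AddMonoidAlgebra.single_mul_single]
        by_cases hp : p ∈ Set.range θ
        · obtain ⟨t, rfl⟩ := hp
          rw [← map_add, hin, hin, AddMonoidAlgebra.single_mul_single]
        · rw [hout _ _ hp, hout _ _ (mt (hsat s p) hp), mul_zero]
  · change AddMonoidAlgebra.comapDomain θ hθ 1 = 1
    rw [AddMonoidAlgebra.one_def, ← map_zero θ, hin]
    rfl

/-- Every monomial is integral because its `e`-th power comes from `S`, and the algebra is of finite
type. -/
lemma AddMonoidAlgebra.finite_of_nsmul_mem_range [AddMonoid.FG P] (θ : S →+ P) (e : ℕ)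
    (he : 0 < e) (h : ∀ p, e • p ∈ Set.range θ) :
    (AddMonoidAlgebra.mapDomainRingHom k θ).Finite := by
  let := (AddMonoidAlgebra.mapDomainRingHom k θ).toAlgebra
  have : IsScalarTower k (AddMonoidAlgebra k S) (AddMonoidAlgebra k P) :=
    IsScalarTower.of_algebraMap_eq fun x => by
      rw [RingHom.algebraMap_toAlgebra]
      simp
  have hft : Algebra.FiniteType (AddMonoidAlgebra k S) (AddMonoidAlgebra k P) :=
    Algebra.FiniteType.of_restrictScalars_finiteType k _ _
  have hAB : Algebra.IsIntegral (AddMonoidAlgebra k S) (AddMonoidAlgebra k P) := ⟨fun b => by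
    induction b using AddMonoidAlgebra.induction_linear with
    | zero => exact isIntegral_zero
    | add a b ha hb => exact ha.add hb
    | single p c =>
      refine IsIntegral.of_pow he ?_
      obtain ⟨s, hs⟩ := h p
      rw [AddMonoidAlgebra.single_pow, ← hs]
      have : AddMonoidAlgebra.single (θ s) (c ^ e) = algebraMap (AddMonoidAlgebra k S)
        (AddMonoidAlgebra k P) (AddMonoidAlgebra.single s (c ^ e)) := by
          rw [RingHom.algebraMap_toAlgebra]
          simp
      rw [this]
      exact isIntegral_algebraMap⟩
  exact Algebra.IsIntegral.finite

end Retraction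

namespace Toric

variable {N : Type u} [AddCommGroup N] [Module.Free ℤ N] [Module.Finite ℤ N]

/-- Evaluation at the adapted vectors `w j` embeds `S_σ` as a saturated submonoid of a partial
orthant that contains all `e`-fold multiples. Saturation gives normality through the retraction; the
multiples give a finite factorial extension. -/
lemma IsLatticeSimplicial.coordinateRing_spec {σ : PointedCone ℝ (RealSpace N)}
    (hσ : IsLatticeSimplicial σ) (k : Type u) [Field k] :
    IsIntegrallyClosed (coordinateRing k σ) ∧ HeightOneSetPrincipal (coordinateRing k σ) := by
  obtain ⟨κ, _, w, J, e, f, he, hmem, hinj, hf, hf'⟩ := hσ.exists_coordinates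
  let θ : semigroup σ →+ partialOrthant κ J :=
    { toFun := fun m => ⟨fun j => m.1 (w j), fun j hj => (hmem m.1).mp m.2 j hj⟩
      map_zero' := rfl
      map_add' := fun _ _ => rfl }
  have hθ : Function.Injective θ := by
    intro m m' h
    refine Subtype.ext (sub_eq_zero.mp (hinj _ fun j => ?_))
    have := congrFun (congrArg Subtype.val h) j
    rw [LinearMap.sub_apply]
    exact sub_eq_zero.mpr this
  have hsat : ∀ s p, θ s + p ∈ Set.range θ → p ∈ Set.range θ := by
    rintro s p ⟨t, ht⟩
    have hc : ∀ j, (t.1 - s.1) (w j) = p.1 j := fun j => by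
      have : t.1 (w j) = s.1 (w j) + p.1 j := congrFun (congrArg Subtype.val ht) j
      rw [LinearMap.sub_apply, this]
      ring
    refine ⟨⟨t.1 - s.1, (hmem _).mpr fun j hj => ?_⟩, Subtype.ext (funext hc)⟩
    rw [hc]
    exact p.2 j hj
  have hrange : ∀ p, e • p ∈ Set.range θ := by
    intro p
    -- The dual characters `f i` supply the preimage of `e • p`.
    have hc : ∀ j, (∑ i, p.1 i • f i) (w j) = e • p.1 j := fun j => by
      rw [LinearMap.sum_apply, Finset.sum_eq_single j]
      · rw [LinearMap.smul_apply, hf]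
        simp [mul_comm]
      · intro i _ hij
        rw [LinearMap.smul_apply, hf' j i (Ne.symm hij), smul_zero]
      · simp
    refine ⟨⟨∑ i, p.1 i • f i, (hmem _).mpr fun j hj => ?_⟩, Subtype.ext (funext hc)⟩
    rw [hc]
    exact nsmul_nonneg (p.2 j hj) e
  have hfg : AddMonoid.FG (partialOrthant κ J) := by
    rw [AddMonoid.fg_iff_addSubmonoid_fg]
    exact AddSubmonoid.fg_of_forall_nonneg (J := J) (fun j => Pi.evalAddMonoidHom _ j.1) _
      fun x => by simp [partialOrthant]
  have := coordinateRing_isDomain k σ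
  obtain ⟨π, hπ⟩ := AddMonoidAlgebra.exists_retraction k θ hθ hsat
  let := (AddMonoidAlgebra.mapDomainRingHom k θ).toAlgebra
  have hfin : Module.Finite (coordinateRing k σ) (AddMonoidAlgebra k (partialOrthant κ J)) :=
    AddMonoidAlgebra.finite_of_nsmul_mem_range k θ e he hrange
  have : FaithfulSMul (coordinateRing k σ) (AddMonoidAlgebra k (partialOrthant κ J)) :=
    (faithfulSMul_iff_algebraMap_injective _ _).mpr (AddMonoidAlgebra.mapDomain_injective hθ)
  have hic : IsIntegrallyClosed (coordinateRing k σ) := IsIntegrallyClosed.of_retraction π hπ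
  exact ⟨hic, HeightOneSetPrincipal.of_finite (B := AddMonoidAlgebra k (partialOrthant κ J))⟩

end Toric

/-! ### Orders of vanishing and `ℚ`-Cartier divisors -/

namespace SchemeGeometry

section Order

variable {X : Scheme.{u}} [IsIntegral X] [IsLocallyNoetherian X]

lemma ord_zpow {f : X.functionField} (hf : f ≠ 0) (n : ℤ) (z : X) :
    X.ord (f ^ n) z = n * X.ord f z := by
  by_cases hz : Order.coheight z = 1
  · rw [Scheme.ord_eq_iff hz (zpow_ne_zero n hf), map_zpow₀, (Scheme.ord_eq_iff hz hf).mp rfl,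
      ← WithZero.coe_zpow, ← ofAdd_zsmul, smul_eq_mul]
  · simp [hz]

/-- The order is the length of the stalk modulo the germ of `a`. It is finite as `a ≠ 0`, and
nonzero as the germ is not a unit. -/
lemma ord_germToFunctionField_pos {U : X.Opens} [Nonempty U] {a : Γ(X, U)} (ha : a ≠ 0) {z : X}
    (hzU : z ∈ U) (hz : Order.coheight z = 1) (hza : z ∉ X.basicOpen a) :
    0 < X.ord (X.germToFunctionField U a) z := by
  have : Ring.KrullDimLE 1 (X.presheaf.stalk z) := krullDimLE_of_coheight_le hz.le
  have ha' : X.germToFunctionField U a ≠ 0 :=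
    (map_ne_zero_iff _ (Scheme.germToFunctionField_injective X U)).mpr ha
  have hg : X.presheaf.germ U z hzU a ≠ 0 :=
    (map_ne_zero_iff _ (germ_injective_of_isIntegral X z hzU)).mpr ha
  rw [Scheme.mem_basicOpen _ _ _ hzU] at hza
  obtain ⟨m, hm⟩ := ENat.ne_top_iff_exists.mp
    (Ring.ord_ne_top (a := X.presheaf.germ U z hzU a) (by simpa using hg))
  have hm0 : m ≠ 0 := by
    rintro rfl
    have h0 : Module.length (X.presheaf.stalk z) (X.presheaf.stalk z ⧸
      Ideal.span {X.presheaf.germ U z hzU a}) = 0 := hm.symm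
    rw [Module.length_eq_zero_iff, Ideal.Quotient.subsingleton_iff,
      Ideal.span_singleton_eq_top] at h0
    exact hza h0
  have : X.ord (X.germToFunctionField U a) z = m := by
    rw [Scheme.ord_eq_iff hz ha', ← Scheme.algebraMap_germ_eq_germToFunctionField X hzU]
    change Ring.ordFrac _ _ = _
    rw [Ring.ordFrac_eq_ord _ hg, Ring.ordMonoidWithZeroHom_eq_coe _ (by simpa using hg) hm.symm]
  rw [this]
  exact_mod_cast Nat.pos_of_ne_zero hm0

lemma ord_germToFunctionField_eq_zero {U : X.Opens} [Nonempty U] {a : Γ(X, U)} {z : X}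
    (hza : z ∈ X.basicOpen a) : X.ord (X.germToFunctionField U a) z = 0 := by
  by_cases hz : Order.coheight z = 1
  · have : Ring.KrullDimLE 1 (X.presheaf.stalk z) := krullDimLE_of_coheight_le hz.le
    have hzU : z ∈ U := X.basicOpen_le a hza
    rw [Scheme.mem_basicOpen _ _ _ hzU] at hza
    have ha : X.germToFunctionField U a ≠ 0 := by
      rw [← Scheme.algebraMap_germ_eq_germToFunctionField X hzU]
      exact (hza.map (algebraMap _ X.functionField)).ne_zero
    rw [Scheme.ord_eq_iff hz ha, ← Scheme.algebraMap_germ_eq_germToFunctionField X hzU]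
    exact Ring.ordFrac_of_isUnit hza
  · simp [hz]

/-- On an affine open set where primes of height one are set-theoretically principal, every prime
divisor has a local equation up to a multiple. -/
lemma exists_ord_of_heightOneSetPrincipal {U : X.Opens} (hU : IsAffineOpen U)
    (hA : HeightOneSetPrincipal Γ(X, U)) {z : X} (hzU : z ∈ U) (hz : Order.coheight z = 1) :
    ∃ f : X.functionField, f ≠ 0 ∧ 0 < X.ord f z ∧ ∀ z' ∈ U, z' ≠ z → X.ord f z' = 0 := by
  have : Nonempty U := ⟨⟨z, hzU⟩⟩
  have hht : ∀ y (hy : y ∈ U), Order.coheight y = 1 →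
      (hU.primeIdealOf ⟨y, hy⟩).asIdeal.height = 1 := by
    intro y hy hy1
    let := X.presheaf.algebra_section_stalk ⟨y, hy⟩
    have := hU.isLocalization_stalk ⟨y, hy⟩
    have h1 := IsLocalization.AtPrime.ringKrullDim_eq_height
      (hU.primeIdealOf ⟨y, hy⟩).asIdeal (X.presheaf.stalk y)
    rw [ringKrullDim_stalk_eq_coheight, hy1] at h1
    exact_mod_cast h1.symm
  have hmem : ∀ y (hy : y ∈ U) (a : Γ(X, U)),
      a ∉ (hU.primeIdealOf ⟨y, hy⟩).asIdeal ↔ y ∈ X.basicOpen a := by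
    intro y hy a
    let := X.presheaf.algebra_section_stalk ⟨y, hy⟩
    have := hU.isLocalization_stalk ⟨y, hy⟩
    rw [Scheme.mem_basicOpen _ _ _ hy]
    exact (IsLocalization.AtPrime.isUnit_to_map_iff (X.presheaf.stalk y)
      (hU.primeIdealOf ⟨y, hy⟩).asIdeal a).symm
  have hmin : ∀ y (hy : y ∈ U), Order.coheight y = 1 → ∀ q : Ideal Γ(X, U), q.IsPrime → q ≠ ⊥ →
      q ≤ (hU.primeIdealOf ⟨y, hy⟩).asIdeal → q = (hU.primeIdealOf ⟨y, hy⟩).asIdeal := by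
    intro y hy hy1 q hq hq0 hle
    by_contra hne
    have h1 := Ideal.height_add_one_le_of_lt_of_isPrime (lt_of_le_of_ne hle hne)
    have h2 := Ideal.height_add_one_le_of_lt_of_isPrime (bot_lt_iff_ne_bot.mpr hq0)
    rw [hht y hy hy1] at h1
    have h3 : (1 : ℕ∞) + 1 ≤ 1 := le_trans (by gcongr; exact le_trans (by simp) h2) h1
    exact absurd h3 (by decide)
  obtain ⟨a, hap, ha0, ha⟩ := hA (hU.primeIdealOf ⟨z, hzU⟩).asIdeal inferInstance
    (fun h => by
      have := hht z hzU hz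
      rw [h, Ideal.height_bot] at this
      exact zero_ne_one this) (hmin z hzU hz)
  refine ⟨X.germToFunctionField U a,
    (map_ne_zero_iff _ (Scheme.germToFunctionField_injective X U)).mpr ha0,
    ord_germToFunctionField_pos ha0 hzU hz fun h => (hmem z hzU a).mpr h hap, ?_⟩
  intro y hy hyz
  by_cases hy1 : Order.coheight y = 1
  · refine ord_germToFunctionField_eq_zero ((hmem y hy a).mp fun hay => hyz ?_)
    have hle := ha _ inferInstance hay
    have heq := hmin y hy hy1 _ inferInstance (fun h => by
      have := hht z hzU hz
      rw [h, Ideal.height_bot] at this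
      exact zero_ne_one this) hle
    have h2 := congrArg hU.fromSpec (PrimeSpectrum.ext heq)
    rw [hU.fromSpec_primeIdealOf, hU.fromSpec_primeIdealOf] at h2
    exact h2.symm
  · simp [hy1]

/-- Induction on the support. If `f` solves the problem for `s` with multiple `n`, and `g` vanishes
only at `y`, to order `p`, then `f ^ p * g ^ (n * d y)` solves it for the larger set with multiple
`n * p`. -/
lemma exists_ord_eq_on_finset {U : X.Opens} (hU : IsAffineOpen U)
    (hA : HeightOneSetPrincipal Γ(X, U)) (d : X → ℤ) (s : Finset X)
    (hs : ∀ z ∈ s, z ∈ U ∧ Order.coheight z = 1) :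
    ∃ (n : ℕ) (f : X.functionField), 0 < n ∧ f ≠ 0 ∧ (∀ z ∈ s, X.ord f z = n * d z) ∧
      ∀ z ∈ U, z ∉ s → X.ord f z = 0 := by
  classical
  induction s using Finset.induction_on with
  | empty =>
    refine ⟨1, 1, one_pos, one_ne_zero, by simp, fun z hz _ => ?_⟩
    simpa using ord_zpow (X := X) one_ne_zero 0 z
  | insert y s hys ih =>
    obtain ⟨n, f, hn, hf, h1, h2⟩ := ih fun z hz => hs z (Finset.mem_insert_of_mem hz)
    obtain ⟨hyU, hy⟩ := hs y (Finset.mem_insert_self _ _)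
    obtain ⟨g, hg, hgy, hg'⟩ := exists_ord_of_heightOneSetPrincipal hU hA hyU hy
    obtain ⟨p, hp⟩ := Int.eq_ofNat_of_zero_le hgy.le
    have hp0 : 0 < p := by rw [hp] at hgy; exact_mod_cast hgy
    have hord : ∀ z, X.ord (f ^ (p : ℤ) * g ^ (n * d y)) z =
        p * X.ord f z + n * d y * X.ord g z := fun z => by
      rw [Scheme.ord_mul (zpow_ne_zero _ hf) (zpow_ne_zero _ hg), ord_zpow hf, ord_zpow hg]
    refine ⟨n * p, f ^ (p : ℤ) * g ^ (n * d y), Nat.mul_pos hn hp0,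
      mul_ne_zero (zpow_ne_zero _ hf) (zpow_ne_zero _ hg), fun z hz => ?_, fun z hz hzs => ?_⟩
    · rw [hord]
      rcases Finset.mem_insert.mp hz with rfl | hz'
      · rw [h2 z hyU hys, hp]
        push_cast
        ring
      · rw [h1 z hz', hg' z (hs z hz).1 (by rintro rfl; exact hys hz')]
        push_cast
        ring
    · rw [hord, h2 z hz fun h => hzs (Finset.mem_insert_of_mem h),
        hg' z hz (by rintro rfl; exact hzs (Finset.mem_insert_self _ _))]
      ring

/-- Weil divisors are `ℚ`-Cartier if `X` is covered by finitely many affine open sets in which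
primes of height one are set-theoretically principal. -/
lemma exists_isCartier_nsmul {ι : Type*} [Finite ι] (U : ι → X.Opens)
    (hU : ∀ i, IsAffineOpen (U i)) (hcov : ∀ x, ∃ i, x ∈ U i)
    (hA : ∀ i, HeightOneSetPrincipal Γ(X, U i)) (D : AlgebraicCycle X ℤ)
    (hD : IsWeilDivisor X D) : ∃ n : ℕ, 0 < n ∧ IsCartier X (n • D) := by
  classical
  have : Fintype ι := Fintype.ofFinite ι
  have hloc : ∀ i, ∃ (n : ℕ) (f : X.functionField), 0 < n ∧ f ≠ 0 ∧
      ∀ z ∈ U i, X.ord f z = n * D z := by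
    intro i
    -- Quasi-compactness makes the locally finite support of `D` finite on the chart.
    have hfin : ((U i : Set X) ∩ Function.support D).Finite :=
      LocallyFiniteSupport.finite_inter_support_of_isCompact
        (fun z => D.supportLocallyFiniteWithinDomain z trivial) (hU i).isCompact
    obtain ⟨n, f, hn, hf, h1, h2⟩ := exists_ord_eq_on_finset (hU i) (hA i) D hfin.toFinset
      (fun z hz => by
        have := hfin.mem_toFinset.mp hz
        exact ⟨this.1, hD z this.2⟩)
    refine ⟨n, f, hn, hf, fun z hz => ?_⟩
    by_cases hzD : D z = 0
    · rw [h2 z hz (by simp [hzD]), hzD, mul_zero]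
    · exact h1 z (hfin.mem_toFinset.mpr ⟨hz, hzD⟩)
  choose n f hn hf h using hloc
  refine ⟨∏ i, n i, Finset.prod_pos fun i _ => hn i, fun x => ?_⟩
  obtain ⟨i, hi⟩ := hcov x
  obtain ⟨q, hq⟩ : n i ∣ ∏ i, n i := Finset.dvd_prod_of_mem n (Finset.mem_univ i)
  refine ⟨U i, hi, f i ^ (q : ℤ), zpow_ne_zero _ (hf i), fun z hz => ?_⟩
  rw [ord_zpow (hf i), h i z hz, hq]
  simp only [Function.locallyFinsuppWithin.coe_nsmul, Pi.smul_apply, nsmul_eq_mul]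
  push_cast
  ring

end Order

lemma isIntegrallyClosed_stalk {X : Scheme.{u}} {U : X.Opens} (hU : IsAffineOpen U)
    [IsDomain Γ(X, U)] [IsIntegrallyClosed Γ(X, U)] {x : X} (hx : x ∈ U) :
    IsIntegrallyClosed (X.presheaf.stalk x) := by
  let := X.presheaf.algebra_section_stalk ⟨x, hx⟩
  have := hU.isLocalization_stalk ⟨x, hx⟩
  exact isIntegrallyClosed_of_isLocalization (R := Γ(X, U)) (X.presheaf.stalk x)
    (hU.primeIdealOf ⟨x, hx⟩).asIdeal.primeCompl (Ideal.primeCompl_le_nonZeroDivisors _)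

end SchemeGeometry

namespace Toric

/-! ### Characters that cut out faces -/

section Cutting

variable {N : Type u} [AddCommGroup N]

/-- The character `w` is nonnegative on `σ` and vanishes there exactly on `τ`. -/
structure Cuts (w : DualLattice N) (σ τ : PointedCone ℝ (RealSpace N)) : Prop where
  le : τ ≤ σ
  mem : w ∈ semigroup σ
  mem_of_eq_zero : ∀ x ∈ σ, pairing w x = 0 → x ∈ τ
  eq_zero : ∀ x ∈ τ, pairing w x = 0

lemma Cuts.isFaceOf {w : DualLattice N} {σ τ : PointedCone ℝ (RealSpace N)} (h : Cuts w σ τ) :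
    τ.IsFaceOf σ :=
  .of_mem_of_add_mem_left h.le fun {x y} hx hy hxy => by
    refine h.mem_of_eq_zero x hx ?_
    have h1 := h.eq_zero _ hxy
    rw [map_add] at h1
    linarith [h.mem x hx, h.mem y hy]

lemma Cuts.neg_mem {w : DualLattice N} {σ τ : PointedCone ℝ (RealSpace N)} (h : Cuts w σ τ) :
    -w ∈ semigroup τ := fun x hx => by rw [pairing_neg, h.eq_zero x hx, neg_zero]

lemma Cuts.exists_add_nsmul_mem {w : DualLattice N} {σ τ : PointedCone ℝ (RealSpace N)}
    (h : Cuts w σ τ) (hσ : IsRationalPolyhedral σ) (u : DualLattice N) (hu : u ∈ semigroup τ) :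
    ∃ n : ℕ, u + n • w ∈ semigroup σ := by
  obtain ⟨S, hS, hSσ⟩ := hσ
  refine (face_character_spec hS hSσ h.isFaceOf (m := w) (fun v _ hvτ => ?_)
    fun v hv hvτ => ?_).2.2 u hu
  · have := h.eq_zero _ hvτ
    rw [pairing_latticeVec] at this
    exact_mod_cast this
  · have hvσ : latticeVec v ∈ σ := by
      rw [← hSσ]
      exact PointedCone.subset_hull (Set.mem_image_of_mem _ hv)
    have h1 := h.mem _ hvσ
    have h2 := mt (h.mem_of_eq_zero _ hvσ) hvτ
    rw [pairing_latticeVec] at h1 h2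
    have h3 := lt_of_le_of_ne h1 (Ne.symm h2)
    exact_mod_cast h3

/-- The supporting character is controlled on generators only. A vanishing sum of nonnegative terms
passes the control to all points. -/
lemma exists_cuts [Module.Free ℤ N] {σ τ : PointedCone ℝ (RealSpace N)}
    (hσ : IsRationalPolyhedral σ) (hτ : τ.IsFaceOf σ) : ∃ w, Cuts w σ τ := by
  obtain ⟨S, hS, hSσ⟩ := hσ
  obtain ⟨w, hw0, hw1⟩ := exists_supporting hS hSσ hτ
  obtain ⟨h1, h2, -⟩ := face_character_spec hS hSσ hτ hw0 hw1
  refine ⟨w, hτ.le, h1, fun x hx hwx => ?_, fun x hx => le_antisymm ?_ (h1 x (hτ.le hx))⟩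
  · rw [← hSσ, PointedCone.mem_hull_set] at hx
    obtain ⟨c, hc, hc0, rfl⟩ := hx
    rw [Finsupp.sum, map_sum, Finset.sum_eq_zero_iff_of_nonneg] at hwx
    · refine Submodule.sum_mem _ fun y hy => ?_
      have hcy := hwx y hy
      obtain ⟨v, hv, rfl⟩ := hc hy
      rw [map_smul, smul_eq_mul, mul_eq_zero, pairing_latticeVec] at hcy
      have h3 : latticeVec v ∈ τ := by
        by_contra hvτ
        have h4 := hw1 v hv hvτ
        rcases hcy with hcy | hcy
        · exact Finsupp.mem_support_iff.mp hy hcy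
        · exact h4.ne' (by exact_mod_cast hcy)
      exact Submodule.smul_mem τ (⟨c (latticeVec v), hc0 _⟩ : {a : ℝ // 0 ≤ a}) h3
    · intro y hy
      obtain ⟨v, hv, rfl⟩ := hc hy
      rw [map_smul, smul_eq_mul]
      refine mul_nonneg (hc0 _) (h1 _ ?_)
      rw [← hSσ]
      exact PointedCone.subset_hull (Set.mem_image_of_mem _ hv)
  · have := h2 x hx
    rw [pairing_neg] at this
    linarith

lemma Cuts.restrict {w : DualLattice N} {σ τ ρ : PointedCone ℝ (RealSpace N)} (h : Cuts w σ τ)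
    (hρ : ρ ≤ σ) : Cuts w ρ (ρ ⊓ τ) where
  le := inf_le_left
  mem := semigroup_anti hρ h.mem
  mem_of_eq_zero x hx hwx := ⟨hx, h.mem_of_eq_zero x (hρ hx) hwx⟩
  eq_zero x hx := h.eq_zero x hx.2

/-- The character `χ^u` as an element of `k[S_σ]`. -/
abbrev monomial (k : Type u) [Field k] {σ : PointedCone ℝ (RealSpace N)} {u : DualLattice N}
    (hu : u ∈ semigroup σ) : coordinateRing k σ :=
  AddMonoidAlgebra.single ⟨u, hu⟩ (1 : k)

lemma monomial_mul (k : Type u) [Field k] {σ : PointedCone ℝ (RealSpace N)} {u v w : DualLattice N}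
    (hu : u ∈ semigroup σ) (hv : v ∈ semigroup σ) (hw : w ∈ semigroup σ) (h : u + v = w) :
    monomial k hu * monomial k hv = monomial k hw := by
  subst h
  rw [monomial, monomial, AddMonoidAlgebra.single_mul_single, one_mul]
  rfl

lemma monomial_zero (k : Type u) [Field k] {σ : PointedCone ℝ (RealSpace N)}
    (h : (0 : DualLattice N) ∈ semigroup σ) : monomial k h = 1 := rfl

lemma coordinateMap_monomial (k : Type u) [Field k] {σ τ : PointedCone ℝ (RealSpace N)}
    (h : τ ≤ σ) {u : DualLattice N} (hu : u ∈ semigroup σ) :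
    coordinateMap k h (monomial k hu) = monomial k (semigroup_anti h hu) := by
  rw [monomial, coordinateMap_single]
  rfl

lemma Cuts.range_affineChartMap (k : Type u) [Field k] {w : DualLattice N}
    {σ τ : PointedCone ℝ (RealSpace N)} (h : Cuts w σ τ) (hσ : IsRationalPolyhedral σ) :
    Set.range (affineChartMap k h.le) =
      SetLike.coe (PrimeSpectrum.basicOpen (monomial k h.mem)) :=
  Toric.range_affineChartMap k h.le ⟨w, h.mem⟩ h.neg_mem (h.exists_add_nsmul_mem hσ)

end Cutting

namespace Fan

lemma finite_cone {N : Type u} [AddCommGroup N] (Δ : Fan N) : Finite Δ.Cone := Δ.finite.to_subtype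

/-! ### Charts of the toric variety -/

section Charts

variable (k : Type u) [Field k] {N : Type u} [AddCommGroup N] [Module.Free ℤ N] (Δ : Fan N)

instance (σ : Δ.Cone) : IsOpenImmersion (Δ.chartι k σ) :=
  inferInstanceAs (IsOpenImmersion (colimit.ι (Δ.chartDiagram k) σ))

/-- The open subset `U_σ` of `X(Δ)`. -/
def chartOpen (σ : Δ.Cone) : (Δ.toricVariety k).Opens := (Δ.chartι k σ).opensRange

lemma isAffineOpen_chartOpen (σ : Δ.Cone) : IsAffineOpen (Δ.chartOpen k σ) :=
  isAffineOpen_opensRange _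

lemma exists_mem_chartOpen (x : Δ.toricVariety k) : ∃ σ, x ∈ Δ.chartOpen k σ := by
  obtain ⟨σ, y, hy⟩ := Scheme.IsLocallyDirected.ι_jointly_surjective (Δ.chartDiagram k) x
  exact ⟨σ, y, hy⟩

lemma chartOpen_mono {σ τ : Δ.Cone} (h : τ ≤ σ) : Δ.chartOpen k τ ≤ Δ.chartOpen k σ := by
  rintro _ ⟨y, rfl⟩
  refine ⟨affineChartMap k h y, ?_⟩
  rw [← Δ.affineChartMap_chartι k h]
  rfl

/-- Points of two charts that are identified in the gluing come from a chart of some cone inside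
both, hence inside the intersection. -/
lemma chartOpen_inf (σ τ : Δ.Cone) :
    Δ.chartOpen k σ ⊓ Δ.chartOpen k τ = Δ.chartOpen k (σ.inter τ) := by
  refine le_antisymm ?_ (le_inf (Δ.chartOpen_mono k (inter_le_left σ τ))
    (Δ.chartOpen_mono k (inter_le_right σ τ)))
  rintro x ⟨⟨y, hy⟩, z, hz⟩
  obtain ⟨ρ, f, g, t, ht, ht'⟩ := (Scheme.IsLocallyDirected.ι_eq_ι_iff (Δ.chartDiagram k)
    (xi := y) (xj := z)).mp (hy.trans hz.symm)
  have hρ : ρ ≤ σ.inter τ := show ρ.1 ≤ σ.1 ⊓ τ.1 from le_inf (leOfHom f) (leOfHom g)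
  refine Δ.chartOpen_mono k hρ ⟨t, ?_⟩
  rw [← hy, ← ht, ← Δ.affineChartMap_chartι k (leOfHom f)]
  rfl

lemma mem_range_affineChartMap_of_mem_chartOpen {σ τ : Δ.Cone} (h : τ ≤ σ)
    (y : affineChart k σ.1) (hy : Δ.chartι k σ y ∈ Δ.chartOpen k τ) :
    y ∈ Set.range (affineChartMap k h) := by
  obtain ⟨z, hz⟩ := hy
  refine ⟨z, (Δ.chartι k σ).isOpenEmbedding.injective ?_⟩
  rw [← Scheme.Hom.comp_apply]
  exact (congrArg (fun f : affineChart k τ.1 ⟶ Δ.toricVariety k => f z)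
    (Δ.affineChartMap_chartι k h)).trans hz

/-- The sections of the structure sheaf over `U_σ`. -/
def chartRingEquiv (σ : Δ.Cone) :
    coordinateRing k σ.1 ≃+* Γ(Δ.toricVariety k, Δ.chartOpen k σ) :=
  ((Scheme.ΓSpecIso (CommRingCat.of (coordinateRing k σ.1))).symm ≪≫
    IsOpenImmersion.ΓIsoTop (Δ.chartι k σ)).commRingCatIsoToRingEquiv

end Charts

end Fan

end Toric

lemma AlgebraicGeometry.IsOpenImmersion.ΓIsoTop_hom_appLE {X Y : Scheme.{u}} (f : X ⟶ Y)
    [IsOpenImmersion f] (h : ⊤ ≤ f ⁻¹ᵁ f.opensRange) :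
    (IsOpenImmersion.ΓIsoTop f).hom ≫ f.appLE f.opensRange ⊤ h = 𝟙 _ := by
  have h1 : Y.presheaf.map (eqToHom (f.image_top_eq_opensRange.symm)).op ≫
      f.appLE f.opensRange ⊤ h = f.appLE (f ''ᵁ ⊤) ⊤ (by simp) := Scheme.Hom.map_appLE _ _ _
  change ((f.appIso ⊤).inv ≫ Y.presheaf.map (eqToHom (f.image_top_eq_opensRange.symm)).op) ≫ _ = _
  rw [Category.assoc, h1, Scheme.Hom.appIso_inv_appLE]
  simp

namespace Toric

namespace Fan

open SchemeGeometry

variable (k : Type u) [Field k] {N : Type u} [AddCommGroup N] [Module.Free ℤ N] (Δ : Fan N)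

lemma chartι_appLE_chartRingEquiv (σ : Δ.Cone)
    (h : ⊤ ≤ Δ.chartι k σ ⁻¹ᵁ Δ.chartOpen k σ) (a : coordinateRing k σ.1) :
    (Δ.chartι k σ).appLE (Δ.chartOpen k σ) ⊤ h (Δ.chartRingEquiv k σ a) =
      (Scheme.ΓSpecIso (CommRingCat.of (coordinateRing k σ.1))).inv a := by
  have h1 : (IsOpenImmersion.ΓIsoTop (Δ.chartι k σ)).hom ≫
      (Δ.chartι k σ).appLE (Δ.chartι k σ).opensRange ⊤ h = 𝟙 _ :=
    IsOpenImmersion.ΓIsoTop_hom_appLE _ _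
  exact congrArg (fun φ : Γ(affineChart k σ.1, ⊤) ⟶ Γ(affineChart k σ.1, ⊤) =>
    φ ((Scheme.ΓSpecIso (CommRingCat.of (coordinateRing k σ.1))).inv a)) h1

/-- Sections over `U_τ` are determined by their pullback to the affine chart, where the claim is
naturality of global sections of `Spec`. -/
lemma res_chartRingEquiv {σ τ : Δ.Cone} (h : τ ≤ σ) (a : coordinateRing k σ.1) :
    res (Δ.chartOpen_mono k h) (Δ.chartRingEquiv k σ a) =
      Δ.chartRingEquiv k τ (coordinateMap k h a) := by
  have hτ : ⊤ ≤ Δ.chartι k τ ⁻¹ᵁ Δ.chartOpen k τ := fun y _ => ⟨y, rfl⟩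
  have hσ : ⊤ ≤ Δ.chartι k σ ⁻¹ᵁ Δ.chartOpen k σ := fun y _ => ⟨y, rfl⟩
  have hinj : Function.Injective ((Δ.chartι k τ).appLE (Δ.chartOpen k τ) ⊤ hτ) := by
    intro s t hst
    obtain ⟨s, rfl⟩ := (Δ.chartRingEquiv k τ).surjective s
    obtain ⟨t, rfl⟩ := (Δ.chartRingEquiv k τ).surjective t
    rw [chartι_appLE_chartRingEquiv, chartι_appLE_chartRingEquiv] at hst
    rw [(Scheme.ΓSpecIso
      (CommRingCat.of (coordinateRing k τ.1))).symm.commRingCatIsoToRingEquiv.injective hst]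
  apply hinj
  rw [chartι_appLE_chartRingEquiv]
  have h1 : (Δ.toricVariety k).presheaf.map (homOfLE (Δ.chartOpen_mono k h)).op ≫
      (Δ.chartι k τ).appLE (Δ.chartOpen k τ) ⊤ hτ =
        (Δ.chartι k σ).appLE (Δ.chartOpen k σ) ⊤ hσ ≫ (affineChartMap k h).appTop := by
    rw [Scheme.Hom.map_appLE]
    have := Δ.affineChartMap_chartι k h
    simp_rw [← this]
    rw [← Scheme.Hom.appLE_comp_appLE (affineChartMap k h) (Δ.chartι k σ) _ ⊤ ⊤ hσ le_top]
    congr 1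
  have h2 := congrArg (fun φ : Γ(Δ.toricVariety k, Δ.chartOpen k σ) ⟶ Γ(affineChart k τ.1, ⊤) =>
    φ (Δ.chartRingEquiv k σ a)) h1
  refine h2.trans ?_
  change (affineChartMap k h).appTop ((Δ.chartι k σ).appLE (Δ.chartOpen k σ) ⊤ hσ _) = _
  rw [chartι_appLE_chartRingEquiv]
  exact congrArg (fun φ : CommRingCat.of (coordinateRing k σ.1) ⟶ Γ(affineChart k τ.1, ⊤) => φ a)
    (Scheme.ΓSpecIso_inv_naturality (CommRingCat.ofHom (coordinateMap k h))).symm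

lemma basicOpen_chartRingEquiv (σ : Δ.Cone) (a : coordinateRing k σ.1) :
    ((Δ.toricVariety k).basicOpen (Δ.chartRingEquiv k σ a) : Set (Δ.toricVariety k)) =
      Δ.chartι k σ '' SetLike.coe (PrimeSpectrum.basicOpen a) := by
  have hσ : ⊤ ≤ Δ.chartι k σ ⁻¹ᵁ Δ.chartOpen k σ := fun y _ => ⟨y, rfl⟩
  have h0 : (affineChart k σ.1).basicOpen
      ((Scheme.ΓSpecIso (CommRingCat.of (coordinateRing k σ.1))).inv a) =
        PrimeSpectrum.basicOpen a := basicOpen_eq_of_affine (R := .of (coordinateRing k σ.1)) a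
  have h1 : Δ.chartι k σ ⁻¹ᵁ (Δ.toricVariety k).basicOpen (Δ.chartRingEquiv k σ a) =
      (affineChart k σ.1).basicOpen
        ((Scheme.ΓSpecIso (CommRingCat.of (coordinateRing k σ.1))).inv a) := by
    rw [← chartι_appLE_chartRingEquiv k Δ σ hσ, Scheme.basicOpen_appLE, top_inf_eq]
  rw [← h0]
  have h2 : (Δ.toricVariety k).basicOpen (Δ.chartRingEquiv k σ a) ≤ Δ.chartOpen k σ :=
    Scheme.basicOpen_le _ _
  ext x
  constructor
  · intro hx
    obtain ⟨y, rfl⟩ := h2 hx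
    refine ⟨y, ?_, rfl⟩
    rw [← h1]
    exact hx
  · rintro ⟨y, hy, rfl⟩
    rw [← h1] at hy
    exact hy

/-- The locus in `U_σ` where a character cutting out a face `τ` does not vanish is `U_τ`. -/
lemma basicOpen_monomial {σ τ : Δ.Cone} {w : DualLattice N} (h : Cuts w σ.1 τ.1) :
    (Δ.toricVariety k).basicOpen (Δ.chartRingEquiv k σ (monomial k h.mem)) = Δ.chartOpen k τ := by
  apply SetLike.coe_injective
  have hle : τ ≤ σ := h.le
  refine (Δ.basicOpen_chartRingEquiv k σ _).trans ?_
  refine (congrArg _ (h.range_affineChartMap k (Δ.rational σ.1 σ.2))).symm.trans ?_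
  rw [← Set.range_comp]
  change _ = Set.range (Δ.chartι k τ)
  rw [← Δ.affineChartMap_chartι k hle]
  rfl

instance nonempty_affineChart (σ : PointedCone ℝ (RealSpace N)) : Nonempty (affineChart k σ) := by
  have := coordinateRing_isDomain k σ
  exact inferInstanceAs (Nonempty (PrimeSpectrum (coordinateRing k σ)))

/-- The charts are spectra of domains, and two of them always meet, because the chart of the
intersection cone is nonempty. -/
instance : IsIntegral (Δ.toricVariety k) := by
  have hd : ∀ σ : Δ.Cone, IsDomain (coordinateRing k σ.1) := fun σ =>
    coordinateRing_isDomain k σ.1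
  have hred : IsReduced (Δ.toricVariety k) := by
    have : ∀ σ, IsReduced ((Scheme.IsLocallyDirected.openCover (Δ.chartDiagram k)).X σ) := fun σ => by
      have : IsDomain (CommRingCat.of (coordinateRing k σ.1)) := hd σ
      exact inferInstanceAs (IsReduced (Spec (CommRingCat.of (coordinateRing k σ.1))))
    exact IsReduced.of_openCover _ (Scheme.IsLocallyDirected.openCover (Δ.chartDiagram k))
  have hirr : IrreducibleSpace (Δ.toricVariety k) := by
    have hne : Nonempty (Δ.toricVariety k) := by
      obtain ⟨σ, hσ⟩ := Δ.nonempty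
      exact (nonempty_affineChart k σ).map (Δ.chartι k ⟨σ, hσ⟩)
    have hU : ∀ σ : Δ.Cone,
        IsPreirreducible (Δ.chartOpen k σ : Set (Δ.toricVariety k)) := fun σ => by
      have : IrreducibleSpace (affineChart k σ.1) := inferInstance
      change IsPreirreducible (Set.range (Δ.chartι k σ))
      rw [← Set.image_univ]
      exact (PreirreducibleSpace.isPreirreducible_univ).image _
        (Δ.chartι k σ).continuous.continuousOn
    refine { toPreirreducibleSpace := ⟨?_⟩, toNonempty := hne }
    rintro V W hV hW ⟨x, -, hx⟩ ⟨y, -, hy⟩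
    obtain ⟨σ, hσ⟩ := Δ.exists_mem_chartOpen k x
    obtain ⟨τ, hτ⟩ := Δ.exists_mem_chartOpen k y
    obtain ⟨t⟩ := nonempty_affineChart k (σ.inter τ).1
    have ht : Δ.chartι k (σ.inter τ) t ∈ Δ.chartOpen k σ ⊓ Δ.chartOpen k τ := by
      rw [chartOpen_inf]
      exact ⟨t, rfl⟩
    obtain ⟨z, hz, hzV, hzτ⟩ := hU σ V _ hV (Δ.chartOpen k τ).isOpen ⟨x, hσ, hx⟩ ⟨_, ht.1, ht.2⟩
    obtain ⟨z', -, hz'V, hz'⟩ := hU τ V W hV hW ⟨z, hzτ, hzV⟩ ⟨y, hτ, hy⟩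
    exact ⟨z', trivial, hz'V, hz'⟩
  exact isIntegral_of_irreducibleSpace_of_isReduced _

variable [Module.Finite ℤ N]

instance : IsNoetherian (Δ.toricVariety k) := by
  have := Δ.finite_cone
  rw [isNoetherian_iff_of_finite_iSup_eq_top
    (S := fun σ => ⟨Δ.chartOpen k σ, Δ.isAffineOpen_chartOpen k σ⟩)]
  · intro σ
    have := coordinateRing_isNoetherianRing k (Δ.rational σ.1 σ.2)
    exact isNoetherianRing_of_ringEquiv _ (Δ.chartRingEquiv k σ)
  · ext x
    simpa using Δ.exists_mem_chartOpen k x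

lemma isQFactorial_toricVariety (h : ∀ σ ∈ Δ.cones, IsLatticeSimplicial σ) :
    IsQFactorial (Δ.toricVariety k) := by
  have := Δ.finite_cone
  refine ⟨inferInstance, inferInstance, fun x => ?_, fun D hD => ?_⟩
  · obtain ⟨σ, hσ⟩ := Δ.exists_mem_chartOpen k x
    have := coordinateRing_isDomain k σ.1
    have := ((h σ.1 σ.2).coordinateRing_spec k).1
    have : IsDomain Γ(Δ.toricVariety k, Δ.chartOpen k σ) :=
      (Δ.chartRingEquiv k σ).toMulEquiv.isDomain_iff.mp inferInstance
    have : IsIntegrallyClosed Γ(Δ.toricVariety k, Δ.chartOpen k σ) :=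
      .of_equiv (Δ.chartRingEquiv k σ)
    exact isIntegrallyClosed_stalk (Δ.isAffineOpen_chartOpen k σ) hσ
  · exact exists_isCartier_nsmul (Δ.chartOpen k) (Δ.isAffineOpen_chartOpen k)
      (Δ.exists_mem_chartOpen k)
      (fun σ => ((h σ.1 σ.2).coordinateRing_spec k).2.of_equiv (Δ.chartRingEquiv k σ)) D hD

end Fan

end Toric

namespace Toric

namespace Fan

open SchemeGeometry

/-! ### Preimages of charts under the toric morphism -/

section Preimage

variable (k : Type u) [Field k] {N : Type u} [AddCommGroup N] {Δ' Δ : Fan N}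

/-- The intersection of a cone of a subdivision with a cone of the subdivided fan. -/
def IsSubdivision.inter (h : Δ'.IsSubdivision Δ) (τ : Δ'.Cone) (σ : Δ.Cone) : Δ'.Cone :=
  ⟨τ.1 ⊓ σ.1, by
    refine Δ'.face_mem τ.1 τ.2 _ ?_
    -- As `τ` lies in `h.over τ`, intersecting it with `σ` is intersecting it with a face of `h.over
    -- τ`, which gives a face of `τ`.
    have h1 := (PointedCone.IsFaceOf.refl τ.1).inf
      (Δ.inf_isFaceOf (h.over τ).1 (h.over τ).2 σ.1 σ.2)
    have h2 : τ.1 ⊓ ((h.over τ).1 ⊓ σ.1) = τ.1 ⊓ σ.1 := by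
      rw [← inf_assoc, inf_eq_left.mpr (h.le_over τ)]
    rwa [h2, inf_eq_left.mpr (h.le_over τ)] at h1⟩

lemma IsSubdivision.inter_le_left (h : Δ'.IsSubdivision Δ) (τ : Δ'.Cone) (σ : Δ.Cone) :
    h.inter τ σ ≤ τ :=
  show τ.1 ⊓ σ.1 ≤ τ.1 from inf_le_left

lemma IsSubdivision.inter_le_right (h : Δ'.IsSubdivision Δ) (τ : Δ'.Cone) (σ : Δ.Cone) :
    (h.inter τ σ).1 ≤ σ.1 :=
  show τ.1 ⊓ σ.1 ≤ σ.1 from inf_le_right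

variable [Module.Free ℤ N]

lemma IsSubdivision.chartOpen_le_preimage (h : Δ'.IsSubdivision Δ) {τ : Δ'.Cone} {σ : Δ.Cone}
    (hle : τ.1 ≤ σ.1) : Δ'.chartOpen k τ ≤ h.toricMap k ⁻¹ᵁ Δ.chartOpen k σ := by
  rintro _ ⟨y, rfl⟩
  refine ⟨affineChartMap k hle y, ?_⟩
  exact congrArg (fun f : affineChart k τ.1 ⟶ Δ.toricVariety k => f y)
    (h.chartι_toricMap k τ σ hle).symm

/-- The character that cuts out the face `h.over τ ⊓ σ` of `h.over τ` cuts out `τ ⊓ σ` when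
restricted to `τ`, and nonvanishing loci pull back to nonvanishing loci. -/
lemma IsSubdivision.preimage_inf_chartOpen (h : Δ'.IsSubdivision Δ) (τ : Δ'.Cone) (σ : Δ.Cone) :
    h.toricMap k ⁻¹ᵁ Δ.chartOpen k σ ⊓ Δ'.chartOpen k τ = Δ'.chartOpen k (h.inter τ σ) := by
  refine le_antisymm ?_ (le_inf (h.chartOpen_le_preimage k (h.inter_le_right τ σ))
    (Δ'.chartOpen_mono k (h.inter_le_left τ σ)))
  rintro _ ⟨hx, y, rfl⟩
  have hxσ : Δ.chartι k (h.over τ) (affineChartMap k (h.le_over τ) y) ∈ Δ.chartOpen k σ := by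
    have := congrArg (fun f : affineChart k τ.1 ⟶ Δ.toricVariety k => f y)
      (h.chartι_toricMap k τ (h.over τ) (h.le_over τ))
    exact this ▸ hx
  have hxi : Δ.chartι k (h.over τ) (affineChartMap k (h.le_over τ) y) ∈
      Δ.chartOpen k ((h.over τ).inter σ) := by
    rw [← chartOpen_inf]
    exact ⟨⟨_, rfl⟩, hxσ⟩
  have hmem := Δ.mem_range_affineChartMap_of_mem_chartOpen k (Fan.inter_le_left _ _) _ hxi
  obtain ⟨w, hw⟩ := exists_cuts (Δ.rational _ (h.over τ).2)
    (Δ.isFaceOf_of_le (Fan.inter_le_left (h.over τ) σ))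
  have hw' : Cuts w τ.1 (h.inter τ σ).1 := by
    have h2 : τ.1 ⊓ ((h.over τ).1 ⊓ σ.1) = τ.1 ⊓ σ.1 := by
      rw [← inf_assoc, inf_eq_left.mpr (h.le_over τ)]
    have := hw.restrict (h.le_over τ)
    change Cuts w τ.1 (τ.1 ⊓ ((h.over τ).1 ⊓ σ.1)) at this
    rwa [h2] at this
  rw [hw.range_affineChartMap k (Δ.rational _ (h.over τ).2)] at hmem
  have hy : y ∈ Set.range (affineChartMap k hw'.le) := by
    rw [hw'.range_affineChartMap k (Δ'.rational _ τ.2)]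
    have h3 := coordinateMap_monomial k (h.le_over τ) hw.mem
    change monomial k _ ∉ y.asIdeal
    rw [← h3]
    exact hmem
  obtain ⟨z, rfl⟩ := hy
  refine ⟨z, ?_⟩
  exact congrArg (fun f : affineChart k (h.inter τ σ).1 ⟶ Δ'.toricVariety k => f z)
    (Δ'.affineChartMap_chartι k (h.inter_le_left τ σ)).symm

end Preimage

/-! ### Characters as sections of the structure sheaf -/

section Character

variable (k : Type u) [Field k] {N : Type u} [AddCommGroup N] [Module.Free ℤ N] (Δ : Fan N)

/-- The character `χ^u` extends to a regular function on some chart containing `V`. -/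
def IsRegularOn (u : DualLattice N) (V : (Δ.toricVariety k).Opens) : Prop :=
  ∃ σ : Δ.Cone, u ∈ semigroup σ.1 ∧ V ≤ Δ.chartOpen k σ

open Classical in
/-- The character `χ^u` as a section of the structure sheaf of `X(Δ)` over an open set `V` on which
it is regular. -/
def character (u : DualLattice N) (V : (Δ.toricVariety k).Opens) : Γ(Δ.toricVariety k, V) :=
  -- The chart is an arbitrary choice; `character_eq` shows that every admissible chart gives the
  -- same section.
  if h : Δ.IsRegularOn k u V then
    res h.choose_spec.2 (Δ.chartRingEquiv k h.choose (monomial k h.choose_spec.1))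
  else 0

lemma res_res {X : Scheme.{u}} {U V W : X.Opens} (h : V ≤ U) (h' : W ≤ V) (a : Γ(X, U)) :
    res h' (res h a) = res (h'.trans h) a :=
  (congrArg (fun φ : Γ(X, U) ⟶ Γ(X, W) => φ a)
    (X.presheaf.map_comp (homOfLE h).op (homOfLE h').op)).symm

/-- `V` lies in the chart of the intersection of the two cones, and both candidates restrict there
to the same monomial. -/
lemma character_eq {u : DualLattice N} {V : (Δ.toricVariety k).Opens} {σ : Δ.Cone}
    (hu : u ∈ semigroup σ.1) (hV : V ≤ Δ.chartOpen k σ) :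
    Δ.character k u V = res hV (Δ.chartRingEquiv k σ (monomial k hu)) := by
  have h : Δ.IsRegularOn k u V := ⟨σ, hu, hV⟩
  rw [character, dif_pos h]
  have hle : V ≤ Δ.chartOpen k (h.choose.inter σ) := by
    rw [← chartOpen_inf]
    exact le_inf h.choose_spec.2 hV
  have h1 := Δ.res_chartRingEquiv k (Fan.inter_le_left h.choose σ)
    (monomial k h.choose_spec.1)
  have h2 := Δ.res_chartRingEquiv k (Fan.inter_le_right h.choose σ) (monomial k hu)
  rw [coordinateMap_monomial] at h1 h2
  rw [← res_res (Δ.chartOpen_mono k (Fan.inter_le_left h.choose σ)) hle, h1,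
    ← res_res (Δ.chartOpen_mono k (Fan.inter_le_right h.choose σ)) hle, h2]

variable {Δ k}

lemma IsRegularOn.res_character {u : DualLattice N} {V W : (Δ.toricVariety k).Opens}
    (h : Δ.IsRegularOn k u V) (hW : W ≤ V) :
    res hW (Δ.character k u V) = Δ.character k u W := by
  obtain ⟨σ, hu, hV⟩ := h
  rw [Δ.character_eq k hu hV, Δ.character_eq k hu (hW.trans hV), res_res]

lemma IsRegularOn.mono {u : DualLattice N} {V W : (Δ.toricVariety k).Opens}
    (h : Δ.IsRegularOn k u V) (hW : W ≤ V) : Δ.IsRegularOn k u W := by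
  obtain ⟨σ, hu, hV⟩ := h
  exact ⟨σ, hu, hW.trans hV⟩

lemma IsRegularOn.character_mul {u v w : DualLattice N} {V : (Δ.toricVariety k).Opens}
    (hu : Δ.IsRegularOn k u V) (hv : Δ.IsRegularOn k v V) (h : u + v = w) :
    Δ.character k u V * Δ.character k v V = Δ.character k w V := by
  obtain ⟨σ, hu, hσ⟩ := hu
  obtain ⟨τ, hv, hτ⟩ := hv
  have hV : V ≤ Δ.chartOpen k (σ.inter τ) := by
    rw [← chartOpen_inf]
    exact le_inf hσ hτ
  have hu' := semigroup_anti (Fan.inter_le_left σ τ) hu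
  have hv' := semigroup_anti (Fan.inter_le_right σ τ) hv
  have hw : w ∈ semigroup (σ.inter τ).1 := h ▸ add_mem hu' hv'
  rw [Δ.character_eq k hu' hV, Δ.character_eq k hv' hV, Δ.character_eq k hw hV, ← map_mul,
    ← map_mul, monomial_mul k hu' hv' hw h]

lemma character_zero {V : (Δ.toricVariety k).Opens} {σ : Δ.Cone} (hV : V ≤ Δ.chartOpen k σ) :
    Δ.character k 0 V = 1 := by
  rw [Δ.character_eq k (zero_mem (semigroup σ.1)) hV, monomial_zero, map_one, map_one]

lemma basicOpen_character {σ τ : Δ.Cone} {w : DualLattice N} (h : Cuts w σ.1 τ.1)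
    {V : (Δ.toricVariety k).Opens} (hV : V = Δ.chartOpen k σ) :
    (Δ.toricVariety k).basicOpen (Δ.character k w V) = Δ.chartOpen k τ := by
  subst hV
  rw [Δ.character_eq k h.mem le_rfl, Scheme.basicOpen_res, Δ.basicOpen_monomial k h]
  exact inf_eq_right.mpr (Δ.chartOpen_mono k h.le)

end Character

end Fan

end Toric

namespace Toric

namespace Fan

/-! ### The relatively ample sheaf of a strict support function -/

namespace StrictSupport

open SchemeGeometry

section Cuts

variable {N : Type u} [AddCommGroup N] {Δ' Δ : Fan N} (φ : Δ'.StrictSupport Δ)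

/-- Strictness as a statement about one character: it is nonnegative on `τ` and vanishes exactly
where `τ` meets `τ'`. Allowing any `u` with the values of `φ.m τ` on `τ` covers both `φ.c σ τ` and
the `φ.m` of a larger cone. -/
lemma cuts {σ : Δ.Cone} {τ τ' : Δ'.Cone} (hτ : τ.1 ≤ σ.1) (hτ' : τ'.1 ≤ σ.1) {u : DualLattice N}
    (hu : ∀ x ∈ τ.1, pairing u x = pairing (φ.m τ) x) :
    Cuts (u - φ.c σ τ') τ.1 (τ.1 ⊓ τ'.1) where
  le := inf_le_left
  mem x hx := by
    rw [pairing_sub, hu x hx]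
    linarith [φ.c_le σ τ τ' hτ hτ' x hx]
  mem_of_eq_zero x hx h0 := by
    rw [pairing_sub, hu x hx] at h0
    exact ⟨hx, φ.mem_of_eq σ τ τ' hτ hτ' x hx (by linarith)⟩
  eq_zero x hx := by
    rw [pairing_sub, hu x hx.1, φ.c_eq σ τ' hτ' x hx.2, φ.m_eq τ τ' x hx.1 hx.2, sub_self]

lemma m_sub_mem (τ τ' : Δ'.Cone) : φ.m τ - φ.m τ' ∈ semigroup (τ.inter τ').1 := fun x hx => by
  have hx' : x ∈ τ.1 ∧ x ∈ τ'.1 := hx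
  rw [pairing_sub, φ.m_eq τ τ' x hx'.1 hx'.2, sub_self]

end Cuts

variable (k : Type u) [Field k] {N : Type u} [AddCommGroup N] [Module.Free ℤ N] {Δ' Δ : Fan N}
  (φ : Δ'.StrictSupport Δ)

lemma isRegularOn_m_sub (τ τ' : Δ'.Cone) :
    Δ'.IsRegularOn k (φ.m τ - φ.m τ') (Δ'.chartOpen k τ ⊓ Δ'.chartOpen k τ') :=
  ⟨τ.inter τ', φ.m_sub_mem τ τ', (Δ'.chartOpen_inf k τ τ').le⟩

lemma isRegularOn_m_sub' (τ τ' : Δ'.Cone) :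
    Δ'.IsRegularOn k (φ.m τ' - φ.m τ) (Δ'.chartOpen k τ ⊓ Δ'.chartOpen k τ') :=
  (φ.isRegularOn_m_sub k τ' τ).mono (le_of_eq (inf_comm _ _))

/-- The invertible sheaf of a strictly convex support function. -/
def invertibleSheaf : InvertibleSheaf (Δ'.toricVariety k) where
  ι := Δ'.Cone
  U := Δ'.chartOpen k
  iSup_U := by
    ext x
    simpa using Δ'.exists_mem_chartOpen k x
  g τ τ' :=
    { val := Δ'.character k (φ.m τ - φ.m τ') (Δ'.chartOpen k τ ⊓ Δ'.chartOpen k τ')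
      inv := Δ'.character k (φ.m τ' - φ.m τ) (Δ'.chartOpen k τ ⊓ Δ'.chartOpen k τ')
      val_inv := by
        rw [(φ.isRegularOn_m_sub k τ τ').character_mul (φ.isRegularOn_m_sub' k τ τ')
          (w := 0) (by abel), character_zero (inf_le_left)]
      inv_val := by
        rw [(φ.isRegularOn_m_sub' k τ τ').character_mul (φ.isRegularOn_m_sub k τ τ')
          (w := 0) (by abel), character_zero (inf_le_left)] }
  cocycle τ₁ τ₂ τ₃ := by
    rw [(φ.isRegularOn_m_sub k τ₁ τ₂).res_character, (φ.isRegularOn_m_sub k τ₂ τ₃).res_character,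
      (φ.isRegularOn_m_sub k τ₁ τ₃).res_character]
    exact ((φ.isRegularOn_m_sub k τ₁ τ₂).mono inf_le_left).character_mul
      ((φ.isRegularOn_m_sub k τ₂ τ₃).mono (inf_le_inf_right _ inf_le_right)) (by abel)

variable (h : Δ'.IsSubdivision Δ)

lemma isRegularOn_m_sub_c {σ : Δ.Cone} {τ' : Δ'.Cone} (hτ' : τ'.1 ≤ σ.1) (τ : Δ'.Cone) :
    Δ'.IsRegularOn k (φ.m τ - φ.c σ τ')
      (h.toricMap k ⁻¹ᵁ Δ.chartOpen k σ ⊓ Δ'.chartOpen k τ) :=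
  ⟨h.inter τ σ, (φ.cuts (h.inter_le_right τ σ) hτ'
    (fun x hx => φ.m_eq _ _ x (h.inter_le_left τ σ hx) hx)).mem,
    (h.preimage_inf_chartOpen k τ σ).le⟩

/-- The section of the invertible sheaf of a support function over the preimage of `U_σ` that is
given by the linear function `c σ τ'`. -/
def powerSection {σ : Δ.Cone} {τ' : Δ'.Cone} (hτ' : τ'.1 ≤ σ.1) :
    (φ.invertibleSheaf k).PowerSection 1 (h.toricMap k ⁻¹ᵁ Δ.chartOpen k σ) where
  s τ := Δ'.character k (φ.m τ - φ.c σ τ') (h.toricMap k ⁻¹ᵁ Δ.chartOpen k σ ⊓ Δ'.chartOpen k τ)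
  compat τ₁ τ₂ := by
    have h1 := φ.isRegularOn_m_sub_c k h hτ' τ₁
    have h2 := φ.isRegularOn_m_sub_c k h hτ' τ₂
    have h3 := φ.isRegularOn_m_sub k τ₁ τ₂
    have hle₁ : h.toricMap k ⁻¹ᵁ Δ.chartOpen k σ ⊓ (Δ'.chartOpen k τ₁ ⊓ Δ'.chartOpen k τ₂) ≤
      h.toricMap k ⁻¹ᵁ Δ.chartOpen k σ ⊓ Δ'.chartOpen k τ₁ := inf_le_inf_left _ inf_le_left
    have hle₂ : h.toricMap k ⁻¹ᵁ Δ.chartOpen k σ ⊓ (Δ'.chartOpen k τ₁ ⊓ Δ'.chartOpen k τ₂) ≤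
      h.toricMap k ⁻¹ᵁ Δ.chartOpen k σ ⊓ Δ'.chartOpen k τ₂ := inf_le_inf_left _ inf_le_right
    have hle₃ : h.toricMap k ⁻¹ᵁ Δ.chartOpen k σ ⊓ (Δ'.chartOpen k τ₁ ⊓ Δ'.chartOpen k τ₂) ≤
      Δ'.chartOpen k τ₁ ⊓ Δ'.chartOpen k τ₂ := inf_le_right
    rw [pow_one]
    refine (h1.res_character hle₁).trans (Eq.symm ?_)
    refine (congrArg₂ (· * ·) (h3.res_character hle₃) (h2.res_character hle₂)).trans ?_
    exact (h3.mono hle₃).character_mul (h2.mono hle₂) (by abel)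

/-- On the chart of `τ` the section is a character that cuts `τ ⊓ σ ⊓ τ'` out of `τ ⊓ σ`. All these
loci lie in the chart of `τ'`, and `τ = τ'` gives the whole chart. -/
lemma nonvanishing_powerSection {σ : Δ.Cone} {τ' : Δ'.Cone} (hτ' : τ'.1 ≤ σ.1) :
    (φ.powerSection k h hτ').nonvanishing = Δ'.chartOpen k τ' := by
  have key : ∀ τ : Δ'.Cone, (Δ'.toricVariety k).basicOpen ((φ.powerSection k h hτ').s τ) =
      Δ'.chartOpen k ((h.inter τ σ).inter τ') := fun τ =>
    basicOpen_character (σ := h.inter τ σ) (τ := (h.inter τ σ).inter τ')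
      (φ.cuts (h.inter_le_right τ σ) hτ'
        (fun x hx => φ.m_eq _ _ x (h.inter_le_left τ σ hx) hx)) (h.preimage_inf_chartOpen k τ σ)
  refine le_antisymm (iSup_le fun τ => ?_) ?_
  · exact (key τ).le.trans (Δ'.chartOpen_mono k (Fan.inter_le_right _ _))
  · refine le_trans ?_ (le_iSup (fun τ => (Δ'.toricVariety k).basicOpen
      ((φ.powerSection k h hτ').s τ)) τ')
    refine le_trans ?_ (key τ').ge
    exact Δ'.chartOpen_mono k
      (show τ'.1 ≤ (τ'.1 ⊓ σ.1) ⊓ τ'.1 from le_inf (le_inf le_rfl hτ') le_rfl)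

/-- A point of the chart of `τ` above `U_σ` lies in the chart of `τ ⊓ σ`, which is affine and the
nonvanishing locus of a section of the sheaf itself, so the first power suffices. -/
lemma isRelativelyAmple [Module.Finite ℤ N] :
    (φ.invertibleSheaf k).IsRelativelyAmple (h.toricMap k) := by
  intro y
  obtain ⟨σ, hσ⟩ := Δ.exists_mem_chartOpen k y
  refine ⟨Δ.chartOpen k σ, hσ, Δ.isAffineOpen_chartOpen k σ,
    TopologicalSpace.NoetherianSpace.isCompact _, fun x hx => ?_⟩
  obtain ⟨τ, hτ⟩ := Δ'.exists_mem_chartOpen k x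
  refine ⟨1, φ.powerSection k h (h.inter_le_right τ σ), one_pos, ?_, ?_⟩
  · rw [nonvanishing_powerSection, ← h.preimage_inf_chartOpen k]
    exact ⟨hx, hτ⟩
  · rw [nonvanishing_powerSection]
    exact Δ'.isAffineOpen_chartOpen k _

end StrictSupport

end Fan

end Toric

namespace Toric

lemma Cuts.exists_extension {k : Type u} [Field k] {N : Type u} [AddCommGroup N]
    {w : DualLattice N} {σ τ : PointedCone ℝ (RealSpace N)} (h : Cuts w σ τ)
    (hσ : IsRationalPolyhedral σ) {A : Type u} [CommRing A] (φ : coordinateRing k σ →+* A)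
    (hφ : IsUnit (φ (monomial k h.mem))) :
    ∃ ψ : coordinateRing k τ →+* A, ψ.comp (coordinateMap k h.le) = φ := by
  let := (coordinateMap k h.le).toAlgebra
  have := isLocalization_away k h.le ⟨w, h.mem⟩ h.neg_mem (h.exists_add_nsmul_mem hσ)
  exact ⟨IsLocalization.Away.lift (AddMonoidAlgebra.single (⟨w, h.mem⟩ : semigroup σ) (1 : k)) hφ,
    IsLocalization.Away.lift_comp (S := coordinateRing k τ) _ hφ⟩

namespace Fan

/-! ### Points of toric varieties with values in a ring -/

section Point

variable (k : Type u) [Field k] {N : Type u} [AddCommGroup N] [Module.Free ℤ N] (Δ : Fan N)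
  {A : Type u} [CommRing A]

/-- The `A`-valued point of `U_σ ⊆ X(Δ)` given by a homomorphism `k[S_σ] → A`. -/
def point (σ : Δ.Cone) (φ : coordinateRing k σ.1 →+* A) : Spec (.of A) ⟶ Δ.toricVariety k :=
  Spec.map (CommRingCat.ofHom φ) ≫ Δ.chartι k σ

lemma point_comp_coordinateMap {σ τ : Δ.Cone} (h : τ ≤ σ) (φ : coordinateRing k τ.1 →+* A) :
    Δ.point k σ (φ.comp (coordinateMap k h)) = Δ.point k τ φ := by
  rw [point, point, ← Δ.affineChartMap_chartι k h, CommRingCat.ofHom_comp, Spec.map_comp,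
    Category.assoc]
  rfl

lemma point_injective (σ : Δ.Cone) :
    Function.Injective (Δ.point k σ : (coordinateRing k σ.1 →+* A) → _) := by
  intro φ ψ h
  have h1 := Spec.map_injective ((cancel_mono (Δ.chartι k σ)).mp h)
  exact congrArg CommRingCat.Hom.hom h1

lemma specMap_point {B : Type u} [CommRing B] (ψ : A →+* B) (σ : Δ.Cone)
    (φ : coordinateRing k σ.1 →+* A) :
    Spec.map (CommRingCat.ofHom ψ) ≫ Δ.point k σ φ = Δ.point k σ (ψ.comp φ) := by
  rw [point, point, CommRingCat.ofHom_comp, Spec.map_comp, Category.assoc]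

/-- Every point of the spectrum of a local ring specializes to the closed point, so an open chart
that contains the image of the closed point contains the whole image. -/
lemma exists_point_eq [IsLocalRing A] (g : Spec (.of A) ⟶ Δ.toricVariety k) {σ : Δ.Cone}
    (hg : g (IsLocalRing.closedPoint A) ∈ Δ.chartOpen k σ) :
    ∃ φ : coordinateRing k σ.1 →+* A, Δ.point k σ φ = g := by
  have hrange : Set.range g ⊆ Set.range (Δ.chartι k σ) := by
    rintro _ ⟨x, rfl⟩
    exact ((IsLocalRing.specializes_closedPoint x).map g.continuous).mem_open
      (Δ.chartOpen k σ).isOpen hg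
  refine ⟨(Spec.preimage (IsOpenImmersion.lift (Δ.chartι k σ) g hrange)).hom, ?_⟩
  rw [point, CommRingCat.ofHom_hom, Spec.map_preimage, IsOpenImmersion.lift_fac]

lemma point_apply_mem (σ : Δ.Cone) (φ : coordinateRing k σ.1 →+* A) (x : Spec (.of A)) :
    Δ.point k σ φ x ∈ Δ.chartOpen k σ := ⟨Spec.map (CommRingCat.ofHom φ) x, rfl⟩

variable {Δ} in
lemma IsSubdivision.point_toricMap {Δ' : Fan N} (h : Δ'.IsSubdivision Δ) {τ : Δ'.Cone}
    {σ : Δ.Cone} (hle : τ.1 ≤ σ.1) (φ : coordinateRing k τ.1 →+* A) :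
    Δ'.point k τ φ ≫ h.toricMap k = Δ.point k σ (φ.comp (coordinateMap k hle)) := by
  rw [point, Category.assoc, h.chartι_toricMap k τ σ hle, point, CommRingCat.ofHom_comp,
    Spec.map_comp, Category.assoc]
  rfl

end Point

/-! ### Finite type and uniqueness in the valuative criterion -/

section Proper

variable (k : Type u) [Field k] {N : Type u} [AddCommGroup N] [Module.Free ℤ N] {Δ' Δ : Fan N}

lemma IsSubdivision.locallyOfFiniteType_toricMap [Module.Finite ℤ N] (h : Δ'.IsSubdivision Δ) :
    LocallyOfFiniteType (h.toricMap k) := by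
  have : IsZariskiLocalAtSource @LocallyOfFiniteType.{u} :=
    HasRingHomProperty.instIsZariskiLocalAtSource (Q := RingHom.FiniteType)
  refine (IsZariskiLocalAtSource.iff_of_openCover (P := @LocallyOfFiniteType.{u})
    (Scheme.IsLocallyDirected.openCover (Δ'.chartDiagram k))).mpr fun τ => ?_
  change LocallyOfFiniteType (Δ'.chartι k τ ≫ h.toricMap k)
  rw [h.chartι_toricMap k τ (h.over τ) (h.le_over τ)]
  have : LocallyOfFiniteType (affineChartMap k (h.le_over τ)) := by
    refine HasRingHomProperty.Spec_iff.mpr ?_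
    refine RingHom.FiniteType.of_comp_finiteType (f := algebraMap k (coordinateRing k _)) ?_
    have h1 : (coordinateMap k (h.le_over τ)).comp (algebraMap k (coordinateRing k _)) =
        algebraMap k (coordinateRing k τ.1) := by
      ext x
      simp [coordinateMap]
    have h2 : (algebraMap k (coordinateRing k τ.1)).FiniteType :=
      RingHom.finiteType_algebraMap.mpr (coordinateRing_finiteType k (Δ'.rational τ.1 τ.2))
    rw [← h1] at h2
    exact h2
  infer_instance

lemma StrictSupport.uniqueness (φ : Δ'.StrictSupport Δ) (h : Δ'.IsSubdivision Δ) :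
    ValuativeCriterion.Uniqueness (h.toricMap k) := by
  intro S
  refine ⟨fun l₁ l₂ => ?_⟩
  obtain ⟨σ, hσ⟩ := Δ.exists_mem_chartOpen k (S.i₂ (IsLocalRing.closedPoint S.R))
  have key : ∀ l : S.commSq.LiftStruct, ∃ τ : Δ'.Cone, τ.1 ≤ σ.1 ∧
      ∃ γ : coordinateRing k τ.1 →+* S.R, Δ'.point k τ γ = l.l := by
    intro l
    obtain ⟨τ, hτ⟩ := Δ'.exists_mem_chartOpen k (l.l (IsLocalRing.closedPoint S.R))
    refine ⟨h.inter τ σ, h.inter_le_right τ σ, Δ'.exists_point_eq k l.l ?_⟩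
    rw [← h.preimage_inf_chartOpen k]
    refine ⟨?_, hτ⟩
    rw [← l.fac_right] at hσ
    exact hσ
  obtain ⟨τ₁, hτ₁, γ₁, h₁⟩ := key l₁
  obtain ⟨τ₂, hτ₂, γ₂, h₂⟩ := key l₂
  have e₁ := l₁.fac_left
  have e₂ := l₂.fac_left
  rw [← h₁, specMap_point] at e₁
  rw [← h₂, specMap_point] at e₂
  obtain ⟨δ, hδ⟩ := Δ'.exists_point_eq k S.i₁ (σ := τ₁.inter τ₂) (by
    rw [← chartOpen_inf]
    refine ⟨?_, ?_⟩
    · rw [← e₁]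
      exact Δ'.point_apply_mem k _ _ _
    · rw [← e₂]
      exact Δ'.point_apply_mem k _ _ _)
  have d₁ : (algebraMap S.R S.K).comp γ₁ = δ.comp (coordinateMap k (Fan.inter_le_left τ₁ τ₂)) := by
    apply Δ'.point_injective k τ₁
    rw [point_comp_coordinateMap, hδ, e₁]
  have d₂ : (algebraMap S.R S.K).comp γ₂ =
      δ.comp (coordinateMap k (Fan.inter_le_right τ₁ τ₂)) := by
    apply Δ'.point_injective k τ₂
    rw [point_comp_coordinateMap, hδ, e₂]
  have c₁ : Cuts (φ.c σ τ₁ - φ.c σ τ₂) τ₁.1 (τ₁.inter τ₂).1 :=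
    φ.cuts hτ₁ hτ₂ fun x hx => φ.c_eq σ τ₁ hτ₁ x hx
  have c₂ : Cuts (φ.c σ τ₂ - φ.c σ τ₁) τ₂.1 (τ₁.inter τ₂).1 := by
    have := φ.cuts hτ₂ hτ₁ fun x hx => φ.c_eq σ τ₂ hτ₂ x hx
    rwa [inf_comm] at this
  have hinj := IsFractionRing.injective S.R S.K
  -- The two lifts agree over the fraction field, where the opposite characters `c σ τ₁ - c σ τ₂`
  -- and `c σ τ₂ - c σ τ₁` multiply to one. Hence both are units of the valuation ring, and both
  -- lifts factor through the chart of `τ₁ ⊓ τ₂`.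
  have hone : γ₁ (monomial k c₁.mem) * γ₂ (monomial k c₂.mem) = 1 := by
    apply hinj
    have a₁ := congrArg (fun f : coordinateRing k τ₁.1 →+* S.K => f (monomial k c₁.mem)) d₁
    have a₂ := congrArg (fun f : coordinateRing k τ₂.1 →+* S.K => f (monomial k c₂.mem)) d₂
    simp only [RingHom.comp_apply, coordinateMap_monomial] at a₁ a₂
    rw [map_mul, a₁, a₂, ← map_mul,
      monomial_mul k _ _ (zero_mem (semigroup (τ₁.inter τ₂).1)) (by abel), monomial_zero,
      map_one, map_one]
  obtain ⟨ε₁, hε₁⟩ := c₁.exists_extension (Δ'.rational _ τ₁.2) γ₁ (IsUnit.of_mul_eq_one _ hone)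
  obtain ⟨ε₂, hε₂⟩ := c₂.exists_extension (Δ'.rational _ τ₂.2) γ₂
    (IsUnit.of_mul_eq_one _ ((mul_comm _ _).trans hone))
  have p₁ : Δ'.point k (τ₁.inter τ₂) ε₁ = l₁.l := by
    rw [← h₁, ← hε₁]
    exact (Δ'.point_comp_coordinateMap k _ _).symm
  have p₂ : Δ'.point k (τ₁.inter τ₂) ε₂ = l₂.l := by
    rw [← h₂, ← hε₂]
    exact (Δ'.point_comp_coordinateMap k _ _).symm
  have heq : (algebraMap S.R S.K).comp ε₁ = (algebraMap S.R S.K).comp ε₂ := by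
    apply Δ'.point_injective k (τ₁.inter τ₂)
    rw [← specMap_point, ← specMap_point, p₁, p₂, l₁.fac_left, l₂.fac_left]
  have hε : ε₁ = ε₂ := RingHom.ext fun x => hinj (congrArg (fun f => f x) heq)
  ext1
  rw [← p₁, ← p₂, hε]

end Proper

end Fan

end Toric

namespace Toric

/-! ### Duality for rational cones -/

section Duality

variable {N : Type u} [AddCommGroup N] [Module.Free ℤ N]

/-- By Farkas' lemma either a positive multiple of `v` is a nonnegative integral combination of the
generators, or a character in the semigroup is negative at `v`. -/
lemma latticeVec_mem_of_forall_nonneg {σ : PointedCone ℝ (RealSpace N)}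
    (hσ : IsRationalPolyhedral σ) {v : N} (hv : ∀ f ∈ semigroup σ, 0 ≤ f v) :
    latticeVec v ∈ σ := by
  obtain ⟨S, hS, rfl⟩ := hσ
  rcases farkas hS.toFinset.toList.length hS.toFinset.toList rfl v with ⟨p, hp, hpv⟩ | ⟨f, hf, hfv⟩
  · have hcl : ∀ x ∈ AddSubmonoid.closure {x | x ∈ hS.toFinset.toList},
        latticeVec x ∈ PointedCone.hull ℝ (latticeVec '' S) := by
      intro x hx
      induction hx using AddSubmonoid.closure_induction with
      | mem x hx => exact PointedCone.subset_hull (Set.mem_image_of_mem _ (by simpa using hx))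
      | zero => rw [latticeVec_zero]; exact zero_mem _
      | add x y _ _ hx hy => rw [latticeVec_add]; exact add_mem hx hy
    have h1 := hcl _ hpv
    rw [latticeVec_nsmul] at h1
    have h2 := Submodule.smul_mem _ (⟨(p : ℝ)⁻¹, by positivity⟩ : {a : ℝ // 0 ≤ a}) h1
    have h3 : (⟨(p : ℝ)⁻¹, by positivity⟩ : {a : ℝ // 0 ≤ a}) • ((p : ℝ) • latticeVec v) =
        latticeVec v := by
      change (p : ℝ)⁻¹ • ((p : ℝ) • latticeVec v) = _
      rw [smul_smul, inv_mul_cancel₀ (by positivity), one_smul]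
    rwa [h3] at h2
  · exact absurd (hv f (mem_semigroup_hull.mpr fun w hw => hf w (by simpa using hw)))
      (not_le.mpr hfv)

variable [Module.Finite ℤ N]

/-- A character that is nonnegative on every point of `σ` where the members of `l` are nonnegative
is, up to a multiple, in the semigroup generated by `S_σ` and `l`. -/
lemma exists_nsmul_mem_closure {σ : PointedCone ℝ (RealSpace N)} (hσ : IsRationalPolyhedral σ)
    (l : Set (DualLattice N)) (hl : l.Finite) (u : DualLattice N)
    (hu : ∀ v : N, latticeVec v ∈ σ → (∀ f ∈ l, 0 ≤ f v) → 0 ≤ u v) :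
    ∃ p : ℕ, 0 < p ∧ p • u ∈ AddSubmonoid.closure ((semigroup σ : Set (DualLattice N)) ∪ l) := by
  classical
  obtain ⟨T, hT⟩ := semigroup_fg hσ
  let L := T.toList ++ hl.toFinset.toList
  rcases farkas L.length L rfl u with ⟨p, hp, hpu⟩ | ⟨F, hF, hFu⟩
  · refine ⟨p, hp, AddSubmonoid.closure_mono ?_ hpu⟩
    intro x hx
    rcases List.mem_append.mp hx with hx | hx
    · left
      rw [← hT]
      exact AddSubmonoid.subset_closure (by simpa using hx)
    · right
      simpa using hx
  · exfalso
    -- Farkas' lemma was applied in the dual lattice. By reflexivity the separating functional is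
    -- evaluation at some `v`, which lies in `σ` by biduality.
    obtain ⟨v, rfl⟩ := (Module.evalEquiv ℤ N).surjective F
    have hFv : ∀ x ∈ L, 0 ≤ x v := hF
    refine absurd (hu v ?_ fun f hf => hFv f (List.mem_append_right _ (by simpa using hf)))
      (not_le.mpr hFu)
    refine latticeVec_mem_of_forall_nonneg hσ fun f hf => ?_
    rw [← hT] at hf
    induction hf using AddSubmonoid.closure_induction with
    | mem x hx => exact hFv x (List.mem_append_left _ (by simpa using hx))
    | zero => simp
    | add x y _ _ hx hy => rw [LinearMap.add_apply]; exact add_nonneg hx hy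

end Duality

/-! ### Existence in the valuative criterion, and properness -/

namespace Fan

lemma IsSubdivision.exists_mem_inter {N : Type u} [AddCommGroup N] {Δ' Δ : Fan N}
    (h : Δ'.IsSubdivision Δ) {σ : Δ.Cone} {x : RealSpace N}
    (hx : x ∈ σ.1) : ∃ τ : Δ'.Cone, τ.1 ≤ σ.1 ∧ x ∈ τ.1 := by
  have h1 : x ∈ Δ.support := Set.mem_biUnion σ.2 hx
  rw [← h.support_eq] at h1
  obtain ⟨τ, hτ, hxτ⟩ := Set.mem_iUnion₂.mp h1
  exact ⟨h.inter ⟨τ, hτ⟩ σ, h.inter_le_right _ _, hxτ, hx⟩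

variable (k : Type u) [Field k] {N : Type u} [AddCommGroup N] [Module.Free ℤ N]
  [Module.Finite ℤ N] {Δ' Δ : Fan N}

/-- If `γ : k[S_τ] → K` maps `k[S_σ]` and the characters `c σ τ - c σ τ'` into the valuation ring
`R`, then it maps all of `k[S_τ]` into `R`. -/
lemma StrictSupport.forall_mem_range (φ : Δ'.StrictSupport Δ) (h : Δ'.IsSubdivision Δ)
    {R K : Type u} [CommRing R] [IsDomain R] [IsIntegrallyClosed R] [Field K] [Algebra R K]
    [IsFractionRing R K] {σ : Δ.Cone} {τ : Δ'.Cone} (hτ : τ.1 ≤ σ.1)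
    (γ : coordinateRing k τ.1 →+* K)
    (hσ : ∀ a, γ (coordinateMap k hτ a) ∈ (algebraMap R K).range)
    (hc : ∀ τ' : Δ'.Cone, τ'.1 ≤ σ.1 → ∀ hm : φ.c σ τ - φ.c σ τ' ∈ semigroup τ.1,
      γ (monomial k hm) ∈ (algebraMap R K).range) (a : coordinateRing k τ.1) :
    γ a ∈ (algebraMap R K).range := by
  have := Δ'.finite_cone
  let l : Set (DualLattice N) := Set.range fun τ' : {τ' : Δ'.Cone // τ'.1 ≤ σ.1} =>
    φ.c σ τ - φ.c σ τ'.1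
  have hmem : ∀ τ' : Δ'.Cone, τ'.1 ≤ σ.1 → φ.c σ τ - φ.c σ τ' ∈ semigroup τ.1 := fun τ' hτ' =>
    (φ.cuts hτ hτ' fun x hx => φ.c_eq σ τ hτ x hx).mem
  have hmono : ∀ u (hu : u ∈ semigroup τ.1), γ (monomial k hu) ∈ (algebraMap R K).range := by
    intro u hu
    obtain ⟨p, hp, hpu⟩ := exists_nsmul_mem_closure (Δ.rational σ.1 σ.2) l (Set.finite_range _) u
      (fun v hv hlv => by
        -- The point `v` of `σ` lies in some `τ'`. There `c σ τ'` is the support function, so `c σ τ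
        -- ≥ c σ τ'` at `v` forces equality, and strictness puts `v` in `τ`, where `u` is
        -- nonnegative.
        obtain ⟨τ', hτ', hvτ'⟩ := h.exists_mem_inter hv
        have h1 := hlv _ ⟨⟨τ', hτ'⟩, rfl⟩
        have h2 : (0 : ℝ) ≤ pairing (φ.c σ τ - φ.c σ τ') (latticeVec v) := by
          rw [pairing_latticeVec]
          exact_mod_cast h1
        rw [pairing_sub, φ.c_eq σ τ' hτ' _ hvτ'] at h2
        have h3 := φ.mem_of_eq σ τ' τ hτ' hτ _ hvτ'
          (le_antisymm (φ.c_le σ τ' τ hτ' hτ _ hvτ') (by linarith))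
        have h4 := hu _ h3
        rw [pairing_latticeVec] at h4
        exact_mod_cast h4)
    have hcl : ∀ x ∈ AddSubmonoid.closure ((semigroup σ.1 : Set (DualLattice N)) ∪ l),
        ∃ hx : x ∈ semigroup τ.1, γ (monomial k hx) ∈ (algebraMap R K).range := by
      intro x hx
      induction hx using AddSubmonoid.closure_induction with
      | mem x hx =>
        rcases hx with hx | ⟨τ', rfl⟩
        · refine ⟨semigroup_anti hτ hx, ?_⟩
          rw [← coordinateMap_monomial k hτ hx]
          exact hσ _
        · exact ⟨hmem _ τ'.2, hc _ τ'.2 _⟩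
      | zero => exact ⟨zero_mem _, by rw [monomial_zero, map_one]; exact one_mem _⟩
      | add x y _ _ hx hy =>
        obtain ⟨hx, hx'⟩ := hx
        obtain ⟨hy, hy'⟩ := hy
        refine ⟨add_mem hx hy, ?_⟩
        rw [← monomial_mul k hx hy (add_mem hx hy) rfl, map_mul]
        exact mul_mem hx' hy'
    obtain ⟨hpu', r, hr⟩ := hcl _ hpu
    have hpow : monomial k hu ^ p = monomial k hpu' := by
      rw [monomial, AddMonoidAlgebra.single_pow, one_pow]
      rfl
    -- Only the multiple `p • u` is generated by the known characters; integral closedness of `R`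
    -- removes the multiple.
    refine IsIntegrallyClosed.exists_algebraMap_eq_of_isIntegral_pow hp ?_
    rw [← map_pow, hpow, ← hr]
    exact isIntegral_algebraMap
  induction a using AddMonoidAlgebra.induction_linear with
  | zero => rw [map_zero]; exact zero_mem _
  | add a b ha hb => rw [map_add]; exact add_mem ha hb
  | single u c =>
    have h1 : (AddMonoidAlgebra.single u c : coordinateRing k τ.1) =
        coordinateMap k hτ (AddMonoidAlgebra.single 0 c) * monomial k u.2 := by
      rw [coordinateMap_single, monomial, AddMonoidAlgebra.single_mul_single, map_zero, zero_add,
        mul_one]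
    rw [h1, map_mul]
    exact mul_mem (hσ _) (hmono u.1 u.2)

/-- The generic point lies in a chart of some `τ ≤ σ`, but it need not extend there. It extends in
the chart of the `τ'` whose character `c σ τ - c σ τ'` has the largest value: the values of the `c σ
τ' - c σ τ''` are then at most one, as `forall_mem_range` requires. -/
lemma StrictSupport.existence (φ : Δ'.StrictSupport Δ) (h : Δ'.IsSubdivision Δ) :
    ValuativeCriterion.Existence (h.toricMap k) := by
  intro S
  have := Δ'.finite_cone
  obtain ⟨σ, hσ⟩ := Δ.exists_mem_chartOpen k (S.i₂ (IsLocalRing.closedPoint S.R))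
  obtain ⟨α, hα⟩ := Δ.exists_point_eq k S.i₂ hσ
  obtain ⟨τ, hτ, β, hβ⟩ : ∃ τ : Δ'.Cone, τ.1 ≤ σ.1 ∧
      ∃ β : coordinateRing k τ.1 →+* S.K, Δ'.point k τ β = S.i₁ := by
    obtain ⟨τ, hτ⟩ := Δ'.exists_mem_chartOpen k (S.i₁ (IsLocalRing.closedPoint S.K))
    refine ⟨h.inter τ σ, h.inter_le_right τ σ, Δ'.exists_point_eq k S.i₁ ?_⟩
    rw [← h.preimage_inf_chartOpen k]
    refine ⟨?_, hτ⟩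
    have h1 : (S.i₁ ≫ h.toricMap k) (IsLocalRing.closedPoint S.K) ∈ Δ.chartOpen k σ := by
      rw [S.commSq.w, ← hα, specMap_point]
      exact Δ.point_apply_mem k _ _ _
    exact h1
  have hβα : β.comp (coordinateMap k hτ) = (algebraMap S.R S.K).comp α := by
    apply Δ.point_injective k σ
    rw [← h.point_toricMap k hτ, hβ, S.commSq.w, ← hα, specMap_point]
  have hcuts : ∀ τ' : Δ'.Cone, τ'.1 ≤ σ.1 → Cuts (φ.c σ τ - φ.c σ τ') τ.1 (τ.inter τ').1 :=
    fun τ' hτ' => φ.cuts hτ hτ' fun x hx => φ.c_eq σ τ hτ x hx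
  have : Nonempty {τ' : Δ'.Cone // τ'.1 ≤ σ.1} := ⟨⟨τ, hτ⟩⟩
  obtain ⟨⟨τ', hτ'⟩, hmax⟩ := Finite.exists_max fun τ' : {τ' : Δ'.Cone // τ'.1 ≤ σ.1} =>
    ValuationRing.valuation S.R S.K (β (monomial k (hcuts τ'.1 τ'.2).mem))
  -- The competitor `τ' = τ` has value one, so the maximum is not zero. The generic point therefore
  -- lies in the chart of `τ ⊓ τ'`, hence in that of `τ'`.
  have hne : β (monomial k (hcuts τ' hτ').mem) ≠ 0 := by
    intro h0
    have h1 := hmax ⟨τ, hτ⟩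
    have h2 : monomial k (hcuts τ hτ).mem = 1 := by
      rw [← monomial_zero k (zero_mem (semigroup τ.1))]
      congr 2
      exact sub_self _
    simp only [h0, h2, map_one, map_zero] at h1
    exact absurd h1 (not_le.mpr zero_lt_one)
  obtain ⟨β', hβ'⟩ := (hcuts τ' hτ').exists_extension (Δ'.rational _ τ.2) β hne.isUnit
  let γ : coordinateRing k τ'.1 →+* S.K := β'.comp (coordinateMap k (Fan.inter_le_right τ τ'))
  have hγσ : γ.comp (coordinateMap k hτ') = (algebraMap S.R S.K).comp α := by
    rw [← hβα, ← hβ']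
    have : (coordinateMap k (Fan.inter_le_right τ τ')).comp (coordinateMap k hτ') =
        (coordinateMap k (hcuts τ' hτ').le).comp (coordinateMap k hτ) := by
      refine RingHom.ext fun a => ?_
      induction a using AddMonoidAlgebra.induction_linear with
      | zero => simp
      | add a b ha hb => rw [map_add, map_add, ha, hb]
      | single u c =>
        simp only [RingHom.comp_apply, coordinateMap_single]
        rfl
    rw [RingHom.comp_assoc, this, RingHom.comp_assoc]
  have hγ := φ.forall_mem_range k h (R := S.R) hτ' γ
    (fun a => ⟨α a, (congrArg (fun f : coordinateRing k σ.1 →+* S.K => f a) hγσ).symm⟩)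
    (fun τ'' hτ'' hm => by
      refine (ValuationRing.mem_integer_iff S.R S.K _).mp ?_
      rw [Valuation.mem_integer_iff]
      have e1 : γ (monomial k hm) * β (monomial k (hcuts τ' hτ').mem) =
          β (monomial k (hcuts τ'' hτ'').mem) := by
        rw [← hβ']
        change β' (coordinateMap k _ _) * β' (coordinateMap k _ _) = β' (coordinateMap k _ _)
        rw [coordinateMap_monomial, coordinateMap_monomial, coordinateMap_monomial, ← map_mul,
          monomial_mul]
        abel
      have e2 := hmax ⟨τ'', hτ''⟩
      rw [← e1, map_mul] at e2
      have hpos : 0 < ValuationRing.valuation S.R S.K (β (monomial k (hcuts τ' hτ').mem)) :=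
        (Valuation.pos_iff _).mpr hne
      exact le_of_mul_le_mul_right (e2.trans_eq (one_mul _).symm) hpos)
  have hinj := IsFractionRing.injective S.R S.K
  -- As `R` embeds in `K`, a homomorphism to `K` with values in the image of `R` descends to `R`.
  let e := (algebraMap S.R S.K).rangeRestrict
  have he : Function.Bijective e :=
    ⟨fun a b hab => hinj (congrArg Subtype.val hab), RingHom.rangeRestrict_surjective _⟩
  let ε : coordinateRing k τ'.1 →+* S.R :=
    (RingEquiv.ofBijective e he).symm.toRingHom.comp (γ.codRestrict _ hγ)
  have hε : (algebraMap S.R S.K).comp ε = γ := RingHom.ext fun a =>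
    congrArg Subtype.val ((RingEquiv.ofBijective e he).apply_symm_apply (γ.codRestrict _ hγ a))
  refine ⟨⟨⟨Δ'.point k τ' ε, ?_, ?_⟩⟩⟩
  · rw [specMap_point, hε, point_comp_coordinateMap, ← hβ, ← hβ']
    exact (Δ'.point_comp_coordinateMap k (Fan.inter_le_left τ τ') β').symm
  · rw [h.point_toricMap k hτ', ← hα]
    congr 1
    refine RingHom.ext fun a => hinj ?_
    have h1 := congrArg (fun f : coordinateRing k σ.1 →+* S.K => f a) hγσ
    rw [← hε] at h1
    exact h1

lemma StrictSupport.isProper_toricMap (φ : Δ'.StrictSupport Δ) (h : Δ'.IsSubdivision Δ) :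
    IsProper (h.toricMap k) := by
  have := h.locallyOfFiniteType_toricMap k
  exact IsProper.of_valuativeCriterion _
    (ValuativeCriterion.iff.mpr ⟨φ.existence k h, φ.uniqueness k h⟩)

end Fan

end Toric

theorem mainTheorem8 (k : Type u) [Field k] [IsAlgClosed k]
    {N : Type u} [AddCommGroup N] [Module.Free ℤ N] [Module.Finite ℤ N] (Δ : Toric.Fan N) :
    ∃ (Δ' : Toric.Fan N) (h : Δ'.IsSubdivision Δ),
      Δ'.IsSimplicial ∧
      SchemeGeometry.IsProjective (h.toricMap k) ∧
      SchemeGeometry.IsQFactorial (Δ'.toricVariety k) ∧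
      Δ'.rays = Δ.rays := by
  obtain ⟨Δ', h, hsimp, ⟨φ⟩, hrays⟩ := Δ.exists_simplicial_subdivision
  refine ⟨Δ', h, fun τ hτ => ?_, ⟨φ.isProper_toricMap k h, _, φ.isRelativelyAmple k h⟩,
    Δ'.isQFactorial_toricVariety k hsimp, hrays⟩
  obtain ⟨ι, _, v, S, hS, rfl⟩ := hsimp τ hτ
  exact hS.isSimplicial

end
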